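/- Let $n\ge 0$, $D=2n$, $\theta\in\mathbb R\setminus\{0\}$, and let $\Theta=\theta\,\mathrm{diag}(J,\dots,J)$ with $n$ blocks $J=\begin{pmatrix}0&-1\\1&0\end{pmatrix}$. For Schwartz functions $a,b\in\mathcal S=\mathcal S(\mathbb R^D)$ put $$(a\star b)(x)=\frac1{(\pi\theta)^D}\int\!\!\int a(x+y)\,b(x+z)\,e^{-2i\,y\Theta^{-1}z}\,dy\,dz .$$ For a tempered distribution $T$ put $\langle T\star a,b\rangle=\langle T,a\star b\rangle$, $\langle a\star T,b\rangle=\langle T,b\star a\rangle$. Let $\mathcal M$ be the Moyal algebra, i.e. the space of tempered distributions $T$ with $a\star T\in\mathcal S$ and $T\star a\in\mathcal S$ for all $a\in\mathcal S$, with the product $\langle T\star S,a\rangle=\langle T,S\star a\rangle$. Write $[a,b]_\star=a\star b-b\star a$ and $\mathrm{Ad}_P(a)=[P,a]_\star$. Let $\mathcal G_2$ be the set of derivations $\mathrm{Ad}_P$ of $\mathcal M$ with $P$ a complex polynomial function of degree $\le 2$, and let $\eta(\mathrm{Ad}_P)=P-P(0)$. Put $\xi_\mu=-\sum_\nu\Theta^{-1}_{\mu\nu}x_\nu$,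 $\eta_\mu=i\xi_\mu$, $\eta_{(\mu\nu)}=i\,\xi_\mu\xi_\nu$ (commutative product), $\partial_\mu=\mathrm{Ad}_{\eta_\mu}$, $X_{(\mu\nu)}=\mathrm{Ad}_{\eta_{(\mu\nu)}}$. A connection (on the right module $\mathcal M$, for the calculus based on $\mathcal G_2$) assigns to each $X\in\mathcal G_2$, $\mathbb C$-linearly in $X$, a $\mathbb C$-linear map $\nabla_X:\mathcal M\to\mathcal M$ with $\nabla_X(m\star a)=m\star X(a)+\nabla_X(m)\star a$. Its curvature is $F(X,Y)=[\nabla_X,\nabla_Y]-\nabla_{[X,Y]}$. The canonical connection is $\nabla^{\rm inv}_X(a)=X(a)-\eta(X)\star a$, and the covariant coordinates of $\nabla$ are $\mathcal A(X)=\nabla_X(1)+\eta(X)$, with $\mathcal A_\mu=\mathcal A(\partial_\mu)$, $\mathcal A_{(\mu\nu)}=\mathcal A(X_{(\mu\nu)})$. An element of $\mathcal M$ in the place of an operator on $\mathcal M$ stands for left $\star$-multiplication by it. Then the following hold. 1. The product of two Schwartz functions is a Schwartz function, and $(\mathcal M,\star)$ is a well-defined associative algebra with unit $1$ that contains the polynomial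 functions of degree $\le2$. 2. $\mathcal G_2$ is the complex linear span of the $\partial_\mu$ and $X_{(\mu\nu)}$ and is closed under the bracket $[X,Y]=XY-YX$. The map $\eta$ is well defined, and $X=\mathrm{Ad}_{\eta(X)}$ for all $X\in\mathcal G_2$. 3. $\eta(\mathcal G_2)$ is the complex linear span of the $\eta_\mu,\eta_{(\mu\nu)}$. The real linear span of the $\eta_\mu,\eta_{(\mu\nu)}$, with the bracket $(P,Q)\mapsto\eta([\mathrm{Ad}_P,\mathrm{Ad}_Q])$ transported from $\mathcal G_2$ by $\eta$, is a Lie algebra isomorphic to $isp(2n,\mathbb R)=sp(2n,\mathbb R)\ltimes\mathbb R^{2n}$. 4. For every connection $\nabla$ one has $\nabla_X(a)=\nabla^{\rm inv}_X(a)+\mathcal A(X)\star a$, and for all indices $$F(\partial_\mu,\partial_\nu)=[\mathcal A_\mu,\mathcal A_\nu]_\star-i\Theta^{-1}_{\mu\nu},$$ $$F(\partial_\mu,X_{(\rho\sigma)})=[\mathcal A_\mu,\mathcal A_{(\rho\sigma)}]_\star-\Theta^{-1}_{\mu\rho}\mathcal A_\sigma-\Theta^{-1}_{\mu\sigma}\mathcal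 A_\rho,$$ $$F(X_{(\mu\nu)},X_{(\rho\sigma)})=[\mathcal A_{(\mu\nu)},\mathcal A_{(\rho\sigma)}]_\star+\Theta^{-1}_{\rho\nu}\mathcal A_{(\mu\sigma)}+\Theta^{-1}_{\sigma\nu}\mathcal A_{(\mu\rho)}+\Theta^{-1}_{\rho\mu}\mathcal A_{(\nu\sigma)}+\Theta^{-1}_{\sigma\mu}\mathcal A_{(\nu\rho)}.$$ 5. $\nabla^{\rm inv}$ is a connection, and its curvature satisfies $F^{\rm inv}(\partial_\mu,\partial_\nu)=-i\Theta^{-1}_{\mu\nu}$, $F^{\rm inv}(\partial_\mu,X_{(\rho\sigma)})=0$ and $F^{\rm inv}(X_{(\mu\nu)},X_{(\rho\sigma)})=0$. -/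

import Mathlib

open scoped SchwartzMap

namespace Moyal

/-- The index set of the coordinates of `ℝ^D`, with `D = 2 n` elements. The pair `(j, k)` is the
`j`-th coordinate of the `k`-th symplectic plane. -/
abbrev Idx (n : ℕ) : Type := Fin 2 × Fin n

/-- The space `ℝ^D`, `D = 2 n`. -/
abbrev Space (n : ℕ) : Type := EuclideanSpace ℝ (Idx n)

/-- The skew-symmetric matrix `Θ = θ diag(J, …, J)` with `n` blocks `J = (0, -1; 1, 0)`. -/
noncomputable def Theta (n : ℕ) (θ : ℝ) : Matrix (Idx n) (Idx n) ℝ :=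
  θ • Matrix.blockDiagonal (fun _ : Fin n => (!![0, -1; 1, 0] : Matrix (Fin 2) (Fin 2) ℝ))

/-- The bilinear form `y Θ⁻¹ z`. -/
noncomputable def thetaInvForm (n : ℕ) (θ : ℝ) (y z : Space n) : ℝ :=
  ∑ μ, ∑ ν, y μ * (Theta n θ)⁻¹ μ ν * z ν

/-- The integral defining the Moyal product:
`(a ⋆ b)(x) = (π θ)^{-D} ∫∫ a(x + y) b(x + z) exp(-2 i y Θ⁻¹ z) dy dz`. -/
noncomputable def starIntegral (n : ℕ) (θ : ℝ) (a b : 𝓢(Space n, ℂ)) (x : Space n) : ℂ :=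
  (((Real.pi * θ) ^ (2 * n) : ℝ) : ℂ)⁻¹ *
    ∫ y : Space n, ∫ z : Space n,
      a (x + y) * b (x + z) * Complex.exp (-2 * Complex.I * (thetaInvForm n θ y z : ℂ))

open Classical in
/-- The Moyal product `𝓢 × 𝓢 → 𝓢`: the Schwartz function given by `starIntegral`. -/
noncomputable def star (n : ℕ) (θ : ℝ) (a b : 𝓢(Space n, ℂ)) : 𝓢(Space n, ℂ) :=
  if h : ∃ c : 𝓢(Space n, ℂ), ∀ x, c x = starIntegral n θ a b x then h.choose else 0

/-- `T ⋆ a = c` as tempered distributions, where `⟨T ⋆ a, b⟩ = ⟨T, a ⋆ b⟩`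
and `⟨c, b⟩ = ∫ c b`. -/
def StarRightEq (n : ℕ) (θ : ℝ) (T : 𝓢'(Space n, ℂ)) (a c : 𝓢(Space n, ℂ)) : Prop :=
  ∀ b : 𝓢(Space n, ℂ), T (star n θ a b) = (c : 𝓢'(Space n, ℂ)) b

/-- `a ⋆ T = c` as tempered distributions, where `⟨a ⋆ T, b⟩ = ⟨T, b ⋆ a⟩`
and `⟨c, b⟩ = ∫ c b`. -/
def StarLeftEq (n : ℕ) (θ : ℝ) (a : 𝓢(Space n, ℂ)) (T : 𝓢'(Space n, ℂ)) (c : 𝓢(Space n, ℂ)) :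
    Prop :=
  ∀ b : 𝓢(Space n, ℂ), T (star n θ b a) = (c : 𝓢'(Space n, ℂ)) b

/-- `𝓜_L`, the tempered distributions `T` with `a ⋆ T ∈ 𝓢` for all `a ∈ 𝓢`. -/
def leftMultipliers (n : ℕ) (θ : ℝ) : Submodule ℂ 𝓢'(Space n, ℂ) where
  carrier := {T | ∀ a, ∃ c, StarLeftEq n θ a T c}
  add_mem' {T S} hT hS a := by
    obtain ⟨c, hc⟩ := hT a
    obtain ⟨d, hd⟩ := hS a
    refine ⟨c + d, fun b => ?_⟩
    have h1 := hc b
    have h2 := hd b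
    rw [map_add]
    change T _ + S _ = _ + _
    rw [h1, h2]
    rfl
  zero_mem' a := ⟨0, fun b => by rw [map_zero]; rfl⟩
  smul_mem' k T hT a := by
    obtain ⟨c, hc⟩ := hT a
    refine ⟨k • c, fun b => ?_⟩
    have h1 := hc b
    rw [map_smul]
    change k • T _ = k • _
    rw [h1]
    rfl

/-- `𝓜_R`, the tempered distributions `T` with `T ⋆ a ∈ 𝓢` for all `a ∈ 𝓢`. -/
def rightMultipliers (n : ℕ) (θ : ℝ) : Submodule ℂ 𝓢'(Space n, ℂ) where
  carrier := {T | ∀ a, ∃ c, StarRightEq n θ T a c}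
  add_mem' {T S} hT hS a := by
    obtain ⟨c, hc⟩ := hT a
    obtain ⟨d, hd⟩ := hS a
    refine ⟨c + d, fun b => ?_⟩
    have h1 := hc b
    have h2 := hd b
    rw [map_add]
    change T _ + S _ = _ + _
    rw [h1, h2]
    rfl
  zero_mem' a := ⟨0, fun b => by rw [map_zero]; rfl⟩
  smul_mem' k T hT a := by
    obtain ⟨c, hc⟩ := hT a
    refine ⟨k • c, fun b => ?_⟩
    have h1 := hc b
    rw [map_smul]
    change k • T _ = k • _
    rw [h1]
    rfl

/-- The Moyal algebra `𝓜 = 𝓜_L ∩ 𝓜_R`, as a space of tempered distributions. -/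
abbrev Alg (n : ℕ) (θ : ℝ) : Type :=
  ↥(leftMultipliers n θ ⊓ rightMultipliers n θ)

/-- `U = T ⋆ S`, in the sense that `⟨U, a⟩ = ⟨T, S ⋆ a⟩` for all `a ∈ 𝓢`. -/
def IsProduct {n : ℕ} {θ : ℝ} (T S U : Alg n θ) : Prop :=
  ∀ a c : 𝓢(Space n, ℂ), StarRightEq n θ (S : 𝓢'(Space n, ℂ)) a c →
    (U : 𝓢'(Space n, ℂ)) a = (T : 𝓢'(Space n, ℂ)) c

open Classical in
/-- The product `⋆` of the Moyal algebra. -/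
noncomputable instance instMulAlg {n : ℕ} {θ : ℝ} : Mul (Alg n θ) where
  mul T S := if h : ∃ U, IsProduct T S U then h.choose else 0

/-- The polynomial function on `ℝ^D` given by a polynomial with complex coefficients. -/
noncomputable def polyFun {n : ℕ} (p : MvPolynomial (Idx n) ℂ) (x : Space n) : ℂ :=
  MvPolynomial.eval (fun μ => (x μ : ℂ)) p

theorem polyFun_hasTemperateGrowth {n : ℕ} (p : MvPolynomial (Idx n) ℂ) :
    (polyFun p).HasTemperateGrowth := by
  induction p using MvPolynomial.induction_on with
  | C c =>
    have : (polyFun (MvPolynomial.C c) : Space n → ℂ) = fun _ => c := by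
      funext x; simp [polyFun]
    rw [this]
    exact Function.HasTemperateGrowth.const c
  | add p q hp hq =>
    have : (polyFun (p + q) : Space n → ℂ) = polyFun p + polyFun q := by
      funext x; simp [polyFun]
    rw [this]
    exact hp.add hq
  | mul_X p μ hp =>
    have : (polyFun (p * MvPolynomial.X μ) : Space n → ℂ) =
        polyFun p * fun x => ((EuclideanSpace.proj μ : Space n →L[ℝ] ℝ) x : ℂ) := by
      funext x; simp [polyFun]
    rw [this]
    refine hp.mul ?_
    exact (Complex.ofRealCLM.comp
      (EuclideanSpace.proj μ : Space n →L[ℝ] ℝ)).hasTemperateGrowth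

/-- A polynomial function as a tempered distribution, `a ↦ ∫ a(x) p(x) dx`. -/
noncomputable def polyDist {n : ℕ} (p : MvPolynomial (Idx n) ℂ) : 𝓢'(Space n, ℂ) :=
  (polyFun_hasTemperateGrowth p).toTemperedDistribution MeasureTheory.volume

open Classical in
/-- A polynomial function as an element of the Moyal algebra. -/
noncomputable def poly {n : ℕ} (θ : ℝ) (p : MvPolynomial (Idx n) ℂ) : Alg n θ :=
  if h : polyDist p ∈ leftMultipliers n θ ⊓ rightMultipliers n θ then ⟨polyDist p, h⟩ else 0

/-- The unit of the Moyal algebra, the constant function `1`. -/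
noncomputable instance instOneAlg {n : ℕ} {θ : ℝ} : One (Alg n θ) where
  one := poly θ 1

/-- The Moyal bracket `[a, b]⋆ = a ⋆ b - b ⋆ a`. -/
noncomputable def comm {n : ℕ} {θ : ℝ} (a b : Alg n θ) : Alg n θ := a * b - b * a

/-- `X` is a derivation of `𝓜`. -/
structure IsDerivation {n : ℕ} {θ : ℝ} (X : Alg n θ → Alg n θ) : Prop where
  map_add : ∀ a b, X (a + b) = X a + X b
  map_smul : ∀ (k : ℂ) (a), X (k • a) = k • X a
  leibniz : ∀ a b, X (a * b) = X a * b + a * X b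

/-- The bracket `[X, Y] a = X (Y a) - Y (X a)`. -/
noncomputable def bracket {n : ℕ} {θ : ℝ} (X Y : Alg n θ → Alg n θ) : Alg n θ → Alg n θ :=
  fun a => X (Y a) - Y (X a)

/-- `Ad_P : a ↦ [P, a]⋆`. -/
noncomputable def Ad {n : ℕ} {θ : ℝ} (P : Alg n θ) : Alg n θ → Alg n θ := fun a => comm P a

/-- `𝓖₂`, the derivations `Ad_P` with `P` a polynomial function of degree at most `2`. -/
def G2 (n : ℕ) (θ : ℝ) : Set (Alg n θ → Alg n θ) :=
  {X | IsDerivation X ∧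
    ∃ p : MvPolynomial (Idx n) ℂ, p.totalDegree ≤ 2 ∧ X = Ad (poly θ p)}

open Classical in
/-- The map `η : 𝓖₂ → 𝓜`, `η(Ad_P) = P - P(0)` (only its values on `𝓖₂` matter). -/
noncomputable def eta {n : ℕ} {θ : ℝ} (X : Alg n θ → Alg n θ) : Alg n θ :=
  if h : ∃ p : MvPolynomial (Idx n) ℂ, p.totalDegree ≤ 2 ∧ X = Ad (poly θ p) then
    poly θ (h.choose - MvPolynomial.C (MvPolynomial.eval 0 h.choose))
  else 0

/-- The polynomial `ξ_μ = - ∑_ν Θ⁻¹_{μν} x_ν`. -/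
noncomputable def xi (n : ℕ) (θ : ℝ) (μ : Idx n) : MvPolynomial (Idx n) ℂ :=
  - ∑ ν, MvPolynomial.C (((Theta n θ)⁻¹ μ ν : ℝ) : ℂ) * MvPolynomial.X ν

/-- `i ξ_μ ∈ 𝓜`. -/
noncomputable def eta1 (n : ℕ) (θ : ℝ) (μ : Idx n) : Alg n θ :=
  poly θ (MvPolynomial.C Complex.I * xi n θ μ)

/-- `i ξ_μ ξ_ν ∈ 𝓜` (commutative product of polynomials). -/
noncomputable def eta2 (n : ℕ) (θ : ℝ) (μ ν : Idx n) : Alg n θ :=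
  poly θ (MvPolynomial.C Complex.I * (xi n θ μ * xi n θ ν))

/-- The derivation `∂_μ = Ad_{i ξ_μ}`. -/
noncomputable def D1 (n : ℕ) (θ : ℝ) (μ : Idx n) : Alg n θ → Alg n θ := Ad (eta1 n θ μ)

/-- The derivation `X_{(μν)} = Ad_{i ξ_μ ξ_ν}`. -/
noncomputable def D2 (n : ℕ) (θ : ℝ) (μ ν : Idx n) : Alg n θ → Alg n θ := Ad (eta2 n θ μ ν)

/-- `∇` is a connection on the right module `𝓜` for the differential calculus based on `𝓖₂`
(only its values on `𝓖₂` matter; the center of `𝓜` is `ℂ`). -/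
structure IsConnection {n : ℕ} {θ : ℝ}
    (nabla : (Alg n θ → Alg n θ) → Alg n θ → Alg n θ) : Prop where
  map_add : ∀ X ∈ G2 n θ, ∀ m m', nabla X (m + m') = nabla X m + nabla X m'
  map_smul : ∀ X ∈ G2 n θ, ∀ (k : ℂ) (m), nabla X (k • m) = k • nabla X m
  leibniz : ∀ X ∈ G2 n θ, ∀ m a, nabla X (m * a) = m * X a + nabla X m * a
  add_left : ∀ X ∈ G2 n θ, ∀ Y ∈ G2 n θ, ∀ m, nabla (X + Y) m = nabla X m + nabla Y m
  smul_left : ∀ X ∈ G2 n θ, ∀ (k : ℂ) (m), nabla (k • X) m = k • nabla X m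

/-- The curvature `F(X, Y) m = [∇_X, ∇_Y] m - ∇_{[X, Y]} m`. -/
noncomputable def curvature {n : ℕ} {θ : ℝ} (nabla : (Alg n θ → Alg n θ) → Alg n θ → Alg n θ)
    (X Y : Alg n θ → Alg n θ) (m : Alg n θ) : Alg n θ :=
  nabla X (nabla Y m) - nabla Y (nabla X m) - nabla (bracket X Y) m

/-- The canonical connection `∇^inv_X a = X(a) - η(X) ⋆ a`. -/
noncomputable def canonical {n : ℕ} {θ : ℝ} (X : Alg n θ → Alg n θ) (a : Alg n θ) : Alg n θ :=
  X a - eta X * a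

/-- The covariant coordinates `𝒜(X) = A(X) + η(X)`, where `A(X) = ∇_X(1)`. -/
noncomputable def covCoord {n : ℕ} {θ : ℝ}
    (nabla : (Alg n θ → Alg n θ) → Alg n θ → Alg n θ) (X : Alg n θ → Alg n θ) : Alg n θ :=
  nabla X 1 + eta X

attribute [local instance 100] LieRing.ofAssociativeRing

/-- The Lie algebra `isp(2n, ℝ) = sp(2n, ℝ) ⋉ ℝ^{2n}` of affine symplectic transformations,
as the matrices `(A, v; 0, 0)` with `A ∈ sp(2n, ℝ)` and `v ∈ ℝ^{2n}` a column. -/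
def isp (n : ℕ) : LieSubalgebra ℝ (Matrix ((Fin n ⊕ Fin n) ⊕ Unit) ((Fin n ⊕ Fin n) ⊕ Unit) ℝ) where
  carrier := {M | ∃ A ∈ LieAlgebra.Symplectic.sp (Fin n) ℝ,
    ∃ v : Matrix (Fin n ⊕ Fin n) Unit ℝ, M = Matrix.fromBlocks A v 0 0}
  add_mem' := by
    rintro _ _ ⟨A, hA, v, rfl⟩ ⟨B, hB, w, rfl⟩
    exact ⟨A + B, add_mem hA hB, v + w, by simp [Matrix.fromBlocks_add]⟩
  zero_mem' := ⟨0, zero_mem _, 0, by simp⟩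
  smul_mem' := by
    rintro k _ ⟨A, hA, v, rfl⟩
    exact ⟨k • A, Submodule.smul_mem _ k hA, k • v, by simp [Matrix.fromBlocks_smul]⟩
  lie_mem' := by
    rintro _ _ ⟨A, hA, v, rfl⟩ ⟨B, hB, w, rfl⟩
    refine ⟨⁅A, B⁆, LieSubalgebra.lie_mem _ hA hB, A * w - B * v, ?_⟩
    simp [Ring.lie_def, Matrix.fromBlocks_multiply, sub_eq_add_neg, Matrix.fromBlocks_neg,
      Matrix.fromBlocks_add]

end Moyal

/-!
Substituting `y = -πΘw` turns the star product into a twisted product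
`∫ e^{2πi⟪w, x⟫} a(x - πΘw) 𝓕b(w) dw`. Derivatives and coordinate multiples of such integrals
are combinations of integrals of the same kind, so a single pointwise bound propagates to all
Schwartz seminorms; this gives Schwartz functions, continuity in each factor and approximate
units. Since `Θ` is skew, Fubini gives associativity and the trace property `∫ a ⋆ b = ∫ a b`.
Completeness of `𝓢` enters through the Banach–Steinhaus theorem, which makes `a ↦ ⟨T, S ⋆ a⟩` a
tempered distribution; by duality the multiplier space is then a unital algebra.

Star multiplication by a linear form is multiplication by it plus a first-order derivative. Hence
the linear forms, and with them all polynomials, are multipliers, and `[·, ξ_μ]_⋆` acts on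
polynomials as `i ∂_μ`. A polynomial is thus determined by its commutators with the `ξ_μ` up to a
constant, which is what makes `η` well defined. For symmetric `S` and `W = Θ⁻¹`, the Hamiltonian
`i (½ ∑ S_{μν} ξ_μ ξ_ν + ∑ c_μ ξ_μ)` acts on the `ξ_μ` through the affine map with linear part
`S W`, an arbitrary element of the symplectic Lie algebra.
-/

namespace Moyal

open Filter Topology LineDeriv MeasureTheory FourierTransform SchwartzMap
open scoped ContDiff

/-! ### Schwartz functions via stable families -/

section StableFamilies

variable {V F : Type*} [NormedAddCommGroup V] [InnerProductSpace ℝ V]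
  [NormedAddCommGroup F] [NormedSpace ℝ F]

/-- Multiplication of a Schwartz function by the linear form `⟪·, v⟫`. Together with the
directional derivatives these operators generate all Schwartz seminorms from the sup norm. -/
noncomputable def coordMul (v : V) : 𝓢(V, F) →L[ℝ] 𝓢(V, F) :=
  smulLeftCLM F fun x => inner ℝ x v

@[simp]
theorem coordMul_apply (v : V) (f : 𝓢(V, F)) (x : V) :
    coordMul v f x = (inner ℝ x v : ℝ) • f x :=
  smulLeftCLM_apply_apply (by fun_prop) f x

/-- A set of functions is *Schwartz stable* if it consists of bounded differentiable functions and
its linear span is closed under directional derivatives and multiplication by linear forms.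
It then consists of Schwartz functions, see `IsSchwartzStable.exists_coe_eq`. -/
structure IsSchwartzStable (G : Set (V → F)) : Prop where
  differentiable : ∀ g ∈ G, Differentiable ℝ g
  bounded : ∀ g ∈ G, ∃ C, ∀ x, ‖g x‖ ≤ C
  fderiv_apply_mem : ∀ g ∈ G, ∀ v, (fun x => fderiv ℝ g x v) ∈ Submodule.span ℝ G
  inner_smul_mem : ∀ g ∈ G, ∀ v : V, (fun x => (inner ℝ x v : ℝ) • g x) ∈ Submodule.span ℝ G

/-- The smooth functions with finite Schwartz seminorm of index `(k, n)`. -/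
def decaySubmodule (V F : Type*) [NormedAddCommGroup V] [InnerProductSpace ℝ V]
    [NormedAddCommGroup F] [NormedSpace ℝ F] (k n : ℕ) : Submodule ℝ (V → F) where
  carrier := {g | ContDiff ℝ ∞ g ∧ ∃ C, ∀ x, ‖x‖ ^ k * ‖iteratedFDeriv ℝ n g x‖ ≤ C}
  add_mem' := by
    rintro f g ⟨hf, C, hC⟩ ⟨hg, D, hD⟩
    refine ⟨hf.add hg, C + D, fun x => ?_⟩
    rw [iteratedFDeriv_add_apply (hf.contDiffAt.of_le (mod_cast le_top))
      (hg.contDiffAt.of_le (mod_cast le_top))]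
    calc ‖x‖ ^ k * ‖iteratedFDeriv ℝ n f x + iteratedFDeriv ℝ n g x‖
        ≤ ‖x‖ ^ k * (‖iteratedFDeriv ℝ n f x‖ + ‖iteratedFDeriv ℝ n g x‖) := by
          gcongr; exact norm_add_le _ _
      _ ≤ C + D := by rw [mul_add]; exact add_le_add (hC x) (hD x)
  zero_mem' := ⟨contDiff_const, 0, fun x => by simp [Pi.zero_def]⟩
  smul_mem' := by
    rintro c f ⟨hf, C, hC⟩
    refine ⟨hf.const_smul c, ‖c‖ * C, fun x => ?_⟩
    rw [iteratedFDeriv_const_smul_apply (hf.contDiffAt.of_le (mod_cast le_top)), norm_smul,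
      mul_left_comm]
    exact mul_le_mul_of_nonneg_left (hC x) (norm_nonneg c)

theorem contDiff_of_mem_span {G : Set (V → F)} {n : ℕ∞} (hG : ∀ g ∈ G, ContDiff ℝ n g) {g : V → F}
    (hg : g ∈ Submodule.span ℝ G) : ContDiff ℝ n g := by
  induction hg using Submodule.span_induction with
  | mem g hg => exact hG g hg
  | zero => exact contDiff_const
  | add f g _ _ hf hg => exact hf.add hg
  | smul c f _ hf => exact hf.const_smul c

variable [FiniteDimensional ℝ V]

theorem IsSchwartzStable.contDiff {G : Set (V → F)} (hG : IsSchwartzStable G) {g : V → F}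
    (hg : g ∈ G) : ContDiff ℝ ∞ g := by
  refine contDiff_infty.2 fun n => ?_
  induction n generalizing g with
  | zero => exact contDiff_zero.2 (hG.differentiable g hg).continuous
  | succ n ih =>
    push_cast
    refine contDiff_succ_iff_fderiv.2 ⟨hG.differentiable g hg, by simp, ?_⟩
    exact contDiff_clm_apply_iff.2 fun v =>
      contDiff_of_mem_span (n := n) (fun g hg => ih hg) (hG.fderiv_apply_mem g hg v)

/-- The map that takes `c` to the linear map `x ↦ ⟪v, x⟫ c`. -/
noncomputable def innerSmulRight (F : Type*) [NormedAddCommGroup F] [NormedSpace ℝ F] (v : V) :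
    F →L[ℝ] V →L[ℝ] F :=
  ContinuousLinearMap.smulRightL ℝ V F (innerSL ℝ v)

theorem clm_eq_sum_innerSmulRight (L : V →L[ℝ] F) :
    L = ∑ i, innerSmulRight F (stdOrthonormalBasis ℝ V i) (L (stdOrthonormalBasis ℝ V i)) := by
  ext v
  conv_lhs => rw [← (stdOrthonormalBasis ℝ V).sum_repr' v, map_sum]
  simp [innerSmulRight]

theorem norm_iteratedFDeriv_succ_le_sum {g : V → F} (hg : ContDiff ℝ ∞ g) (n : ℕ) (x : V) :
    ‖iteratedFDeriv ℝ (n + 1) g x‖ ≤ ∑ i, ‖innerSmulRight F (stdOrthonormalBasis ℝ V i)‖ *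
        ‖iteratedFDeriv ℝ n (fun y => fderiv ℝ g y (stdOrthonormalBasis ℝ V i)) x‖ := by
  have contDiff_fderiv : ∀ v, ContDiff ℝ n fun y => fderiv ℝ g y v := fun v =>
    ((contDiff_infty_iff_fderiv.1 hg).2.clm_apply contDiff_const).of_le (mod_cast le_top)
  have fderiv_eq_sum : fderiv ℝ g = fun y => ∑ i,
      (innerSmulRight F (stdOrthonormalBasis ℝ V i) ∘
        fun y => fderiv ℝ g y (stdOrthonormalBasis ℝ V i)) y :=
    funext fun y => clm_eq_sum_innerSmulRight (fderiv ℝ g y)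
  rw [← norm_iteratedFDeriv_fderiv]
  conv_lhs => rw [fderiv_eq_sum]
  rw [iteratedFDeriv_fun_sum_apply fun i _ =>
    ((innerSmulRight F _).contDiff.comp (contDiff_fderiv _)).contDiffAt]
  refine (norm_sum_le _ _).trans (Finset.sum_le_sum fun i _ => ?_)
  exact (innerSmulRight F _).norm_iteratedFDeriv_comp_left (contDiff_fderiv _).contDiffAt le_rfl

theorem pow_mul_norm_iteratedFDeriv_succ_le {g : V → F} (hg : ContDiff ℝ ∞ g) (k n : ℕ) (x : V) :
    ‖x‖ ^ k * ‖iteratedFDeriv ℝ (n + 1) g x‖ ≤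
      ∑ i, ‖innerSmulRight F (stdOrthonormalBasis ℝ V i)‖ * (‖x‖ ^ k *
        ‖iteratedFDeriv ℝ n (fun y => fderiv ℝ g y (stdOrthonormalBasis ℝ V i)) x‖) := by
  refine (mul_le_mul_of_nonneg_left (norm_iteratedFDeriv_succ_le_sum hg n x)
    (by positivity)).trans_eq ?_
  simp only [Finset.mul_sum, mul_left_comm]

theorem norm_le_sum_abs_inner (x : V) : ‖x‖ ≤ ∑ i, |inner ℝ x (stdOrthonormalBasis ℝ V i)| := by
  conv_lhs => rw [← (stdOrthonormalBasis ℝ V).sum_repr' x]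
  refine (norm_sum_le _ _).trans_eq (Finset.sum_congr rfl fun i _ => ?_)
  rw [norm_smul, (stdOrthonormalBasis ℝ V).orthonormal.1 i, mul_one, Real.norm_eq_abs,
    real_inner_comm]

theorem pow_succ_mul_norm_le (k : ℕ) (x : V) (c : F) :
    ‖x‖ ^ (k + 1) * ‖c‖ ≤
      ∑ i, ‖x‖ ^ k * ‖(inner ℝ x (stdOrthonormalBasis ℝ V i) : ℝ) • c‖ := by
  calc ‖x‖ ^ (k + 1) * ‖c‖ = ‖x‖ ^ k * ‖x‖ * ‖c‖ := by ring
    _ ≤ ‖x‖ ^ k * (∑ i, |inner ℝ x (stdOrthonormalBasis ℝ V i)|) * ‖c‖ := by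
        gcongr; exact norm_le_sum_abs_inner x
    _ = _ := by simp only [Finset.mul_sum, Finset.sum_mul, mul_assoc, norm_smul, Real.norm_eq_abs]

theorem IsSchwartzStable.subset_decaySubmodule {G : Set (V → F)} (hG : IsSchwartzStable G)
    (k n : ℕ) : G ⊆ decaySubmodule V F k n := by
  induction n generalizing k with
  | zero =>
    induction k with
    | zero => exact fun g hg => ⟨hG.contDiff hg, by simpa using hG.bounded g hg⟩
    | succ k ih =>
      intro g hg
      choose C hC using fun i =>
        (Submodule.span_le.2 ih (hG.inner_smul_mem g hg (stdOrthonormalBasis ℝ V i))).2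
      refine ⟨hG.contDiff hg, ∑ i, C i, fun x => ?_⟩
      simp only [norm_iteratedFDeriv_zero] at hC ⊢
      exact (pow_succ_mul_norm_le k x (g x)).trans (Finset.sum_le_sum fun i _ => hC i x)
  | succ n ih =>
    intro g hg
    choose C hC using fun i =>
      (Submodule.span_le.2 (ih k) (hG.fderiv_apply_mem g hg (stdOrthonormalBasis ℝ V i))).2
    refine ⟨hG.contDiff hg, ∑ i, ‖innerSmulRight F (stdOrthonormalBasis ℝ V i)‖ * C i,
      fun x => ?_⟩
    refine (pow_mul_norm_iteratedFDeriv_succ_le (hG.contDiff hg) k n x).trans ?_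
    gcongr with i
    exact hC i x

theorem IsSchwartzStable.exists_coe_eq {G : Set (V → F)} (hG : IsSchwartzStable G) {g : V → F}
    (hg : g ∈ G) : ∃ f : 𝓢(V, F), ⇑f = g :=
  ⟨⟨g, hG.contDiff hg, fun k n => (hG.subset_decaySubmodule k n hg).2⟩, rfl⟩

omit [FiniteDimensional ℝ V] in
theorem seminorm_zero_le_of_forall_norm_le {f : 𝓢(V, F)} {C : ℝ} (hC : 0 ≤ C)
    (h : ∀ x, ‖f x‖ ≤ C) : SchwartzMap.seminorm ℝ 0 0 f ≤ C :=
  seminorm_le_bound ℝ 0 0 f hC fun x => by simpa using h x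

theorem seminorm_derivative_succ_le (k n : ℕ) (f : 𝓢(V, F)) :
    SchwartzMap.seminorm ℝ k (n + 1) f ≤ ∑ i, ‖innerSmulRight F (stdOrthonormalBasis ℝ V i)‖ *
        SchwartzMap.seminorm ℝ k n (∂_{stdOrthonormalBasis ℝ V i} f) := by
  refine seminorm_le_bound ℝ k (n + 1) f (by positivity) fun x => ?_
  refine (pow_mul_norm_iteratedFDeriv_succ_le (f.smooth ⊤) k n x).trans ?_
  gcongr with i
  exact le_seminorm ℝ k n (∂_{stdOrthonormalBasis ℝ V i} f) x

theorem seminorm_weight_succ_le (k : ℕ) (f : 𝓢(V, F)) :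
    SchwartzMap.seminorm ℝ (k + 1) 0 f ≤
      ∑ i, SchwartzMap.seminorm ℝ k 0 (coordMul (stdOrthonormalBasis ℝ V i) f) := by
  refine seminorm_le_bound ℝ (k + 1) 0 f (by positivity) fun x => ?_
  rw [norm_iteratedFDeriv_zero]
  refine (pow_succ_mul_norm_le k x (f x)).trans (Finset.sum_le_sum fun i _ => ?_)
  simpa using norm_pow_mul_le_seminorm ℝ (coordMul (stdOrthonormalBasis ℝ V i) f) k x

/-- The families along which the seminorm `p` tends to zero. -/
def vanishingFamilies {E α : Type*} [AddCommGroup E] [Module ℝ E] (p : Seminorm ℝ E)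
    (l : Filter α) : Submodule ℝ (α → E) where
  carrier := {u | Tendsto (fun t => p (u t)) l (𝓝 0)}
  add_mem' {u v} hu hv := squeeze_zero (fun t => apply_nonneg p _)
    (fun t => map_add_le_add p (u t) (v t)) (by simpa using Tendsto.add hu hv)
  zero_mem' := by simp [tendsto_const_nhds]
  smul_mem' c u hu := by simpa [map_smul_eq_mul] using Tendsto.const_mul ‖c‖ hu

/-- A set of families of Schwartz functions is *vanishing stable* along `l` if its members tend to
zero uniformly and its linear span is closed under directional derivatives and multiplication by
linear forms. Its members then tend to zero in the Schwartz space, see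
`IsVanishingStable.tendsto`. -/
structure IsVanishingStable {α : Type*} (l : Filter α) (R : Set (α → 𝓢(V, F))) : Prop where
  tendsto_seminorm : ∀ u ∈ R, Tendsto (fun t => SchwartzMap.seminorm ℝ 0 0 (u t)) l (𝓝 0)
  lineDerivOp_mem : ∀ u ∈ R, ∀ v : V, (fun t => ∂_{v} (u t)) ∈ Submodule.span ℝ R
  coordMul_mem : ∀ u ∈ R, ∀ v : V, (fun t => coordMul v (u t)) ∈ Submodule.span ℝ R

theorem IsVanishingStable.subset_vanishingFamilies {α : Type*} {l : Filter α}
    {R : Set (α → 𝓢(V, F))} (hR : IsVanishingStable l R) (k n : ℕ) :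
    R ⊆ (vanishingFamilies (SchwartzMap.seminorm ℝ k n : Seminorm ℝ 𝓢(V, F)) l : Set _) := by
  induction n generalizing k with
  | zero =>
    induction k with
    | zero => exact hR.tendsto_seminorm
    | succ k ih =>
      refine fun u hu => squeeze_zero (fun t => apply_nonneg _ _)
        (fun t => seminorm_weight_succ_le k (u t)) ?_
      simpa only [Finset.sum_const_zero] using tendsto_finsetSum Finset.univ fun i _ =>
        Submodule.span_le.2 ih (hR.coordMul_mem u hu (stdOrthonormalBasis ℝ V i))
  | succ n ih =>
    refine fun u hu => squeeze_zero (fun t => apply_nonneg _ _)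
      (fun t => seminorm_derivative_succ_le k n (u t)) ?_
    simpa only [mul_zero, Finset.sum_const_zero] using tendsto_finsetSum Finset.univ fun i _ =>
      Tendsto.const_mul ‖innerSmulRight F (stdOrthonormalBasis ℝ V i)‖
        (Submodule.span_le.2 (ih k) (hR.lineDerivOp_mem u hu (stdOrthonormalBasis ℝ V i)))

theorem IsVanishingStable.tendsto {α : Type*} {l : Filter α} {R : Set (α → 𝓢(V, F))}
    (hR : IsVanishingStable l R) {u : α → 𝓢(V, F)} (hu : u ∈ R) : Tendsto u l (𝓝 0) := by
  rw [(schwartz_withSeminorms ℝ V F).tendsto_nhds u 0]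
  intro i ε hε
  simp only [sub_zero]
  exact (hR.subset_vanishingFamilies i.1 i.2 hu).eventually_lt_const hε

end StableFamilies

/-! ### Completeness of the Schwartz space -/

section Completeness

variable {V F : Type*} [NormedAddCommGroup V] [InnerProductSpace ℝ V]
  [NormedAddCommGroup F] [NormedSpace ℝ F]

theorem cauchySeq_apply {u : ℕ → 𝓢(V, F)} (hu : CauchySeq u) (x : V) :
    CauchySeq fun k => u k x :=
  hu.map ((BoundedContinuousFunction.evalCLM ℝ x).comp
    (toBoundedContinuousFunctionCLM ℝ V F)).uniformContinuous

theorem tendstoUniformly_of_cauchySeq {u : ℕ → 𝓢(V, F)} (hu : CauchySeq u) {g : V → F}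
    (hg : ∀ x, Tendsto (fun k => u k x) atTop (𝓝 (g x))) :
    TendstoUniformly (fun k => ⇑(u k)) g atTop := by
  have cauchySeq_sup : CauchySeq fun k => toBoundedContinuousFunctionCLM ℝ V F (u k) :=
    hu.map (toBoundedContinuousFunctionCLM ℝ V F).uniformContinuous
  rw [← tendstoUniformlyOn_univ]
  refine UniformCauchySeqOn.tendstoUniformlyOn_of_tendsto ?_ fun x _ => hg x
  rw [Metric.uniformCauchySeqOn_iff]
  intro ε hε
  obtain ⟨N, hN⟩ := Metric.cauchySeq_iff.1 cauchySeq_sup ε hε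
  exact ⟨N, fun m hm n hn x _ =>
    (BoundedContinuousFunction.dist_coe_le_dist x).trans_lt (hN m hm n hn)⟩

/-- The pointwise limits of Cauchy sequences of Schwartz functions. -/
def cauchyLimits (V F : Type*) [NormedAddCommGroup V] [InnerProductSpace ℝ V]
    [NormedAddCommGroup F] [NormedSpace ℝ F] : Set (V → F) :=
  {g | ∃ u : ℕ → 𝓢(V, F), CauchySeq u ∧ ∀ x, Tendsto (fun k => u k x) atTop (𝓝 (g x))}

theorem exists_forall_norm_le_of_cauchySeq {u : ℕ → 𝓢(V, F)} (hu : CauchySeq u) {g : V → F}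
    (hg : ∀ x, Tendsto (fun k => u k x) atTop (𝓝 (g x))) : ∃ C, ∀ x, ‖g x‖ ≤ C := by
  obtain ⟨k, hk⟩ := (Metric.tendstoUniformly_iff.1
    (tendstoUniformly_of_cauchySeq hu hg) 1 one_pos).exists
  refine ⟨1 + SchwartzMap.seminorm ℝ 0 0 (u k), fun x => ?_⟩
  have norm_sub_lt : ‖g x - u k x‖ < 1 := by simpa [dist_eq_norm] using hk x
  calc ‖g x‖ ≤ ‖g x - u k x‖ + ‖u k x‖ := norm_le_norm_sub_add _ _
    _ ≤ 1 + SchwartzMap.seminorm ℝ 0 0 (u k) :=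
        add_le_add norm_sub_lt.le (norm_le_seminorm ℝ (u k) x)

variable [CompleteSpace F]

theorem exists_hasFDerivAt_of_cauchySeq {u : ℕ → 𝓢(V, F)} (hu : CauchySeq u) {g : V → F}
    (hg : ∀ x, Tendsto (fun k => u k x) atTop (𝓝 (g x))) :
    ∃ g' : V → V →L[ℝ] F, (∀ x, HasFDerivAt g (g' x) x) ∧
      ∀ x, Tendsto (fun k => fderiv ℝ (u k) x) atTop (𝓝 (g' x)) := by
  have cauchySeq_fderiv : CauchySeq fun k => fderivCLM ℝ V F (u k) :=
    hu.map (fderivCLM ℝ V F).uniformContinuous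
  choose g' hg' using fun x => cauchySeq_tendsto_of_complete (cauchySeq_apply cauchySeq_fderiv x)
  exact ⟨g', hasFDerivAt_of_tendstoUniformly
    (tendstoUniformly_of_cauchySeq cauchySeq_fderiv hg') (fun k x => (u k).hasFDerivAt x) hg, hg'⟩

theorem isSchwartzStable_cauchyLimits : IsSchwartzStable (cauchyLimits V F) where
  differentiable := by
    rintro g ⟨u, hu, hg⟩ x
    obtain ⟨g', hasFDerivAt, -⟩ := exists_hasFDerivAt_of_cauchySeq hu hg
    exact (hasFDerivAt x).differentiableAt
  bounded := by
    rintro g ⟨u, hu, hg⟩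
    exact exists_forall_norm_le_of_cauchySeq hu hg
  fderiv_apply_mem := by
    rintro g ⟨u, hu, hg⟩ v
    obtain ⟨g', hasFDerivAt, tendsto_fderiv⟩ := exists_hasFDerivAt_of_cauchySeq hu hg
    refine Submodule.subset_span ⟨fun k => ∂_{v} (u k),
      hu.map (lineDerivOpCLM ℝ 𝓢(V, F) v).uniformContinuous, fun x => ?_⟩
    beta_reduce
    rw [(hasFDerivAt x).fderiv]
    exact ((ContinuousLinearMap.apply ℝ F v).continuous.tendsto _).comp (tendsto_fderiv x)
  inner_smul_mem := by
    rintro g ⟨u, hu, hg⟩ v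
    refine Submodule.subset_span ⟨fun k => coordMul v (u k),
      hu.map (coordMul v).uniformContinuous, fun x => ?_⟩
    simpa using (hg x).const_smul (inner ℝ x v : ℝ)

theorem isVanishingStable_cauchySeq_tendsto_zero :
    IsVanishingStable atTop
      {u : ℕ → 𝓢(V, F) | CauchySeq u ∧ ∀ x, Tendsto (fun k => u k x) atTop (𝓝 0)} where
  tendsto_seminorm := by
    rintro u ⟨hu, hu₀⟩
    refine tendsto_order.2 ⟨fun b hb => .of_forall fun k => hb.trans_le (apply_nonneg _ _),
      fun b hb => ?_⟩
    filter_upwards [Metric.tendstoUniformly_iff.1 (tendstoUniformly_of_cauchySeq hu hu₀) (b / 2)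
      (half_pos hb)] with k hk
    refine (seminorm_zero_le_of_forall_norm_le (half_pos hb).le fun x => ?_).trans_lt
      (half_lt_self hb)
    simpa using (hk x).le
  lineDerivOp_mem := by
    rintro u ⟨hu, hu₀⟩ v
    obtain ⟨g', hasFDerivAt, tendsto_fderiv⟩ := exists_hasFDerivAt_of_cauchySeq hu hu₀
    refine Submodule.subset_span
      ⟨hu.map (lineDerivOpCLM ℝ 𝓢(V, F) v).uniformContinuous, fun x => ?_⟩
    have tendsto_lineDeriv :=
      ((ContinuousLinearMap.apply ℝ F v).continuous.tendsto _).comp (tendsto_fderiv x)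
    rwa [(hasFDerivAt x).unique (hasFDerivAt_const 0 x), map_zero] at tendsto_lineDeriv
  coordMul_mem := by
    rintro u ⟨hu, hu₀⟩ v
    refine Submodule.subset_span ⟨hu.map (coordMul v).uniformContinuous, fun x => ?_⟩
    simpa using (hu₀ x).const_smul (inner ℝ x v : ℝ)

variable [FiniteDimensional ℝ V]

instance instCompleteSpaceSchwartzMap : CompleteSpace 𝓢(V, F) := by
  have : (uniformity 𝓢(V, F)).IsCountablyGenerated :=
    IsUniformAddGroup.uniformity_countably_generated
  refine UniformSpace.complete_of_cauchySeq_tendsto fun u hu => ?_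
  choose g hg using fun x => cauchySeq_tendsto_of_complete (cauchySeq_apply hu x)
  obtain ⟨f, rfl⟩ := isSchwartzStable_cauchyLimits.exists_coe_eq ⟨u, hu, hg⟩
  refine ⟨f, tendsto_sub_nhds_zero_iff.1 (isVanishingStable_cauchySeq_tendsto_zero.tendsto
    ⟨by simpa only [sub_eq_add_neg] using hu.add_const (x := -f), fun x => ?_⟩)⟩
  simpa [sub_eq_add_neg] using (hg x).sub_const (f x)

instance instBaireSpaceSchwartzMap : BaireSpace 𝓢(V, F) := by
  have : (uniformity 𝓢(V, F)).IsCountablyGenerated :=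
    IsUniformAddGroup.uniformity_countably_generated
  infer_instance

end Completeness

/-! ### Twist integrals -/

section PlaneWave

variable {V : Type*} [NormedAddCommGroup V] [InnerProductSpace ℝ V]

/-- The plane wave `exp (2 π i ⟪w, x⟫)` with frequency `w`. -/
noncomputable def planeWave (w x : V) : ℂ := Real.fourierChar (inner ℝ w x)

@[simp]
theorem norm_planeWave (w x : V) : ‖planeWave w x‖ = 1 := Circle.norm_coe _

@[simp]
theorem planeWave_zero_right (w : V) : planeWave w 0 = 1 := by simp [planeWave]

theorem planeWave_add_right (w x y : V) :
    planeWave w (x + y) = planeWave w x * planeWave w y := by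
  simp [planeWave, inner_add_right, AddChar.map_add_eq_mul]

theorem planeWave_comm (w x : V) : planeWave w x = planeWave x w := by
  rw [planeWave, planeWave, real_inner_comm]

@[fun_prop]
theorem continuous_planeWave {X : Type*} [TopologicalSpace X] {f g : X → V} (hf : Continuous f)
    (hg : Continuous g) : Continuous fun t => planeWave (f t) (g t) :=
  continuous_subtype_val.comp (Real.continuous_fourierChar.comp (hf.inner hg))

theorem norm_planeWave_sub_one_le (w x : V) :
    ‖planeWave w x - 1‖ ≤ 2 * Real.pi * (‖w‖ * ‖x‖) := by
  have norm_exp_sub_one_le :=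
    Real.norm_exp_I_mul_ofReal_sub_one_le (x := 2 * Real.pi * inner ℝ w x)
  rw [mul_comm, ← Real.fourierChar_apply, norm_mul,
    Real.norm_of_nonneg (by positivity)] at norm_exp_sub_one_le
  refine norm_exp_sub_one_le.trans ?_
  gcongr
  exact abs_real_inner_le_norm w x

theorem hasFDerivAt_planeWave (w x : V) :
    HasFDerivAt (planeWave w) ((planeWave w x * (2 * Real.pi * Complex.I)) •
      (Complex.ofRealCLM.comp (innerSL ℝ w))) x := by
  convert! (Real.hasDerivAt_fourierChar (inner ℝ w x)).hasFDerivAt.comp x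
    (innerSL ℝ w).hasFDerivAt using 1
  ext v
  simp [planeWave]
  ring

end PlaneWave

section Twist

variable {V : Type*} [NormedAddCommGroup V] [InnerProductSpace ℝ V]

theorem norm_fderiv_le_seminorm (a : 𝓢(V, ℂ)) (x : V) :
    ‖fderiv ℝ a x‖ ≤ SchwartzMap.seminorm ℝ 0 1 a := by
  simpa only [norm_iteratedFDeriv_one] using norm_iteratedFDeriv_le_seminorm ℝ a 1 x

theorem norm_apply_add_sub_apply_le (a : 𝓢(V, ℂ)) (x y : V) :
    ‖a (x + y) - a x‖ ≤ SchwartzMap.seminorm ℝ 0 1 a * ‖y‖ := by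
  simpa using Convex.norm_image_sub_le_of_norm_fderiv_le (fun z _ => a.differentiableAt)
    (fun z _ => norm_fderiv_le_seminorm a z) convex_univ (Set.mem_univ x) (Set.mem_univ (x + y))

/-- The integrand `exp (2 π i s ⟪w, x⟫) a(x + s B w) c(w)` of the twist integral. -/
noncomputable def twistKernel (B : V →L[ℝ] V) (s : ℝ) (c a : 𝓢(V, ℂ)) (x w : V) : ℂ :=
  planeWave w (s • x) * a (x + s • B w) * c w

/-- The derivative of the integrand of the twist integral with respect to `x`. -/
noncomputable def twistKernelFDeriv (B : V →L[ℝ] V) (s : ℝ) (c a : 𝓢(V, ℂ)) (x w : V) :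
    V →L[ℝ] ℂ :=
  (planeWave w (s • x) * c w) • fderiv ℝ a (x + s • B w) +
    (twistKernel B s c a x w * (2 * Real.pi * s * Complex.I)) •
      (Complex.ofRealCLM.comp (innerSL ℝ w))

theorem continuous_twistKernel (B : V →L[ℝ] V) (s : ℝ) (c a : 𝓢(V, ℂ)) (x : V) :
    Continuous (twistKernel B s c a x) := by
  unfold twistKernel
  fun_prop

theorem norm_twistKernel_le (B : V →L[ℝ] V) (s : ℝ) (c a : 𝓢(V, ℂ)) (x w : V) :
    ‖twistKernel B s c a x w‖ ≤ SchwartzMap.seminorm ℝ 0 0 a * ‖c w‖ := by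
  rw [twistKernel, norm_mul, norm_mul, norm_planeWave, one_mul]
  gcongr
  exact norm_le_seminorm ℝ a _

theorem norm_twistKernel_sub_le (B : V →L[ℝ] V) (s : ℝ) (c a : 𝓢(V, ℂ)) (x w : V) :
    ‖twistKernel B s c a x w - c w * a x‖ ≤ |s| * ((SchwartzMap.seminorm ℝ 0 1 a * ‖B‖ +
      2 * Real.pi * SchwartzMap.seminorm ℝ 1 0 a) * (‖w‖ ^ 1 * ‖c w‖)) := by
  have translation_bound : ‖planeWave w (s • x) * (a (x + s • B w) - a x)‖ ≤
      |s| * (SchwartzMap.seminorm ℝ 0 1 a * ‖B‖ * ‖w‖) := by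
    rw [norm_mul, norm_planeWave, one_mul]
    calc ‖a (x + s • B w) - a x‖ ≤ SchwartzMap.seminorm ℝ 0 1 a * ‖s • B w‖ :=
          norm_apply_add_sub_apply_le a x _
      _ ≤ SchwartzMap.seminorm ℝ 0 1 a * (|s| * (‖B‖ * ‖w‖)) := by
          rw [norm_smul, Real.norm_eq_abs]; gcongr; exact B.le_opNorm w
      _ = |s| * (SchwartzMap.seminorm ℝ 0 1 a * ‖B‖ * ‖w‖) := by ring
  have modulation_bound : ‖(planeWave w (s • x) - 1) * a x‖ ≤
      |s| * (2 * Real.pi * SchwartzMap.seminorm ℝ 1 0 a * ‖w‖) := by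
    have weighted_bound := norm_pow_mul_le_seminorm ℝ a 1 x
    rw [pow_one] at weighted_bound
    rw [norm_mul]
    calc ‖planeWave w (s • x) - 1‖ * ‖a x‖ ≤ 2 * Real.pi * (‖w‖ * ‖s • x‖) * ‖a x‖ := by
          gcongr; exact norm_planeWave_sub_one_le _ _
      _ = |s| * (2 * Real.pi * (‖x‖ * ‖a x‖) * ‖w‖) := by
          rw [norm_smul, Real.norm_eq_abs]; ring
      _ ≤ |s| * (2 * Real.pi * SchwartzMap.seminorm ℝ 1 0 a * ‖w‖) := by gcongr
  calc ‖twistKernel B s c a x w - c w * a x‖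
      = ‖planeWave w (s • x) * (a (x + s • B w) - a x) + (planeWave w (s • x) - 1) * a x‖ *
          ‖c w‖ := by rw [← norm_mul, twistKernel]; ring_nf
    _ ≤ (|s| * (SchwartzMap.seminorm ℝ 0 1 a * ‖B‖ * ‖w‖) +
          |s| * (2 * Real.pi * SchwartzMap.seminorm ℝ 1 0 a * ‖w‖)) * ‖c w‖ := by
        gcongr; exact (norm_add_le _ _).trans (add_le_add translation_bound modulation_bound)
    _ = _ := by ring

theorem continuous_twistKernelFDeriv (B : V →L[ℝ] V) (s : ℝ) (c a : 𝓢(V, ℂ)) (x : V) :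
    Continuous (twistKernelFDeriv B s c a x) := by
  have continuous_fderiv : Continuous (fderiv ℝ a) := (fderivCLM ℝ V ℂ a).continuous
  have continuous_kernel := continuous_twistKernel B s c a x
  have continuous_fderiv_comp : Continuous fun w => fderiv ℝ a (x + s • B w) :=
    continuous_fderiv.comp (by fun_prop)
  unfold twistKernelFDeriv
  fun_prop

theorem norm_twistKernelFDeriv_le (B : V →L[ℝ] V) (s : ℝ) (c a : 𝓢(V, ℂ)) (x w : V) :
    ‖twistKernelFDeriv B s c a x w‖ ≤ SchwartzMap.seminorm ℝ 0 1 a * ‖c w‖ +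
      SchwartzMap.seminorm ℝ 0 0 a * (2 * Real.pi * |s|) * (‖w‖ ^ 1 * ‖c w‖) := by
  refine (norm_add_le _ _).trans (add_le_add ?_ ?_)
  · rw [norm_smul, norm_mul, norm_planeWave, one_mul, mul_comm]
    gcongr
    exact norm_fderiv_le_seminorm a _
  · have norm_inner_le : ‖Complex.ofRealCLM.comp (innerSL ℝ w)‖ ≤ ‖w‖ :=
      (ContinuousLinearMap.opNorm_comp_le _ _).trans (by simp)
    have norm_const : ‖(2 * Real.pi * s * Complex.I : ℂ)‖ = 2 * Real.pi * |s| := by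
      simp [abs_of_pos Real.pi_pos]
    rw [norm_smul, norm_mul, norm_const, pow_one]
    calc ‖twistKernel B s c a x w‖ * (2 * Real.pi * |s|) * ‖Complex.ofRealCLM.comp (innerSL ℝ w)‖
        ≤ SchwartzMap.seminorm ℝ 0 0 a * ‖c w‖ * (2 * Real.pi * |s|) * ‖w‖ := by
          gcongr; exact norm_twistKernel_le B s c a x w
      _ = SchwartzMap.seminorm ℝ 0 0 a * (2 * Real.pi * |s|) * (‖w‖ * ‖c w‖) := by ring

theorem hasFDerivAt_twistKernel (B : V →L[ℝ] V) (s : ℝ) (c a : 𝓢(V, ℂ)) (x w : V) :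
    HasFDerivAt (fun x => twistKernel B s c a x w) (twistKernelFDeriv B s c a x w) x := by
  have hasFDerivAt_wave : HasFDerivAt (fun y => planeWave w (s • y))
      ((planeWave w (s • x) * (2 * Real.pi * Complex.I)) •
        (Complex.ofRealCLM.comp (innerSL ℝ w)) ∘L (s • ContinuousLinearMap.id ℝ V)) x :=
    (hasFDerivAt_planeWave w (s • x)).comp x ((hasFDerivAt_id x).const_smul s)
  have hasFDerivAt_translate :
      HasFDerivAt (fun y => a (y + s • B w)) (fderiv ℝ a (x + s • B w)) x :=
    (hasFDerivAt_comp_add_right (s • B w)).2 (a.hasFDerivAt (x + s • B w))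
  convert! (hasFDerivAt_wave.mul hasFDerivAt_translate).mul_const (c w) using 1
  ext v
  simp [twistKernelFDeriv, twistKernel]
  ring

variable [FiniteDimensional ℝ V] [MeasurableSpace V] [BorelSpace V]

/-- The twist integral `∫ exp (2 π i s ⟪w, x⟫) a(x + s B w) c(w) dw`: the translations of `a` by
`s B w`, each modulated by the plane wave of frequency `s w`, averaged with weight `c`. -/
noncomputable def twistIntegral (B : V →L[ℝ] V) (s : ℝ) (c a : 𝓢(V, ℂ)) (x : V) : ℂ :=
  ∫ w, twistKernel B s c a x w

theorem integrable_twistKernel (B : V →L[ℝ] V) (s : ℝ) (c a : 𝓢(V, ℂ)) (x : V) :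
    Integrable (twistKernel B s c a x) :=
  (c.integrable.norm.const_mul _).mono' (continuous_twistKernel B s c a x).aestronglyMeasurable
    (.of_forall (norm_twistKernel_le B s c a x))

theorem norm_twistIntegral_le (B : V →L[ℝ] V) (s : ℝ) (c a : 𝓢(V, ℂ)) (x : V) :
    ‖twistIntegral B s c a x‖ ≤ SchwartzMap.seminorm ℝ 0 0 a * ∫ w, ‖c w‖ := by
  rw [← integral_const_mul]
  exact norm_integral_le_of_norm_le (c.integrable.norm.const_mul _)
    (.of_forall (norm_twistKernel_le B s c a x))

theorem integrable_twistKernelFDeriv_bound (s : ℝ) (c a : 𝓢(V, ℂ)) :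
    Integrable fun w => SchwartzMap.seminorm ℝ 0 1 a * ‖c w‖ +
      SchwartzMap.seminorm ℝ 0 0 a * (2 * Real.pi * |s|) * (‖w‖ ^ 1 * ‖c w‖) :=
  (c.integrable.norm.const_mul _).add ((c.integrable_pow_mul volume 1).const_mul _)

theorem integrable_twistKernelFDeriv (B : V →L[ℝ] V) (s : ℝ) (c a : 𝓢(V, ℂ)) (x : V) :
    Integrable (twistKernelFDeriv B s c a x) :=
  (integrable_twistKernelFDeriv_bound s c a).mono'
    (continuous_twistKernelFDeriv B s c a x).aestronglyMeasurable
    (.of_forall (norm_twistKernelFDeriv_le B s c a x))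

theorem hasFDerivAt_twistIntegral (B : V →L[ℝ] V) (s : ℝ) (c a : 𝓢(V, ℂ)) (x : V) :
    HasFDerivAt (twistIntegral B s c a) (∫ w, twistKernelFDeriv B s c a x w) x :=
  hasFDerivAt_integral_of_dominated_of_fderiv_le (s := Set.univ) univ_mem
    (.of_forall fun y => (integrable_twistKernel B s c a y).aestronglyMeasurable)
    (integrable_twistKernel B s c a x) (integrable_twistKernelFDeriv B s c a x).aestronglyMeasurable
    (.of_forall fun w y _ => norm_twistKernelFDeriv_le B s c a y w)
    (integrable_twistKernelFDeriv_bound s c a)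
    (.of_forall fun w y _ => hasFDerivAt_twistKernel B s c a y w)

theorem fderiv_twistIntegral (B : V →L[ℝ] V) (s : ℝ) (c a : 𝓢(V, ℂ)) (v x : V) :
    fderiv ℝ (twistIntegral B s c a) x v =
      s • twistIntegral B s ((2 * Real.pi * Complex.I) • coordMul v c) a x +
        twistIntegral B s c (∂_{v} a) x := by
  rw [(hasFDerivAt_twistIntegral B s c a x).fderiv,
    ContinuousLinearMap.integral_apply (integrable_twistKernelFDeriv B s c a x)]
  simp only [twistIntegral]
  rw [← integral_smul, ← integral_add ((integrable_twistKernel B s _ a x).fun_smul s)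
    (integrable_twistKernel B s c _ x)]
  refine integral_congr_ae (.of_forall fun w => ?_)
  simp [twistKernelFDeriv, twistKernel, lineDerivOp_apply_eq_fderiv]
  ring

theorem inner_smul_twistIntegral (B : V →L[ℝ] V) (s : ℝ) (c a : 𝓢(V, ℂ)) (v x : V) :
    (inner ℝ x v : ℝ) • twistIntegral B s c a x = twistIntegral B s c (coordMul v a) x -
      s • twistIntegral B s (coordMul (ContinuousLinearMap.adjoint B v) c) a x := by
  simp only [twistIntegral]
  rw [← integral_smul, ← integral_smul, ← integral_sub (integrable_twistKernel B s c _ x)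
    ((integrable_twistKernel B s _ a x).fun_smul s)]
  refine integral_congr_ae (.of_forall fun w => ?_)
  simp only [twistKernel, coordMul_apply, ContinuousLinearMap.adjoint_inner_right, inner_add_left,
    real_inner_smul_left, Complex.real_smul]
  push_cast
  ring

theorem isSchwartzStable_range_twistIntegral (B : V →L[ℝ] V) (s : ℝ) :
    IsSchwartzStable (Set.range fun p : 𝓢(V, ℂ) × 𝓢(V, ℂ) => twistIntegral B s p.1 p.2) := by
  have mem_span : ∀ c a, twistIntegral B s c a ∈ Submodule.span ℝ
      (Set.range fun p : 𝓢(V, ℂ) × 𝓢(V, ℂ) => twistIntegral B s p.1 p.2) :=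
    fun c a => Submodule.subset_span ⟨(c, a), rfl⟩
  constructor
  · rintro _ ⟨⟨c, a⟩, rfl⟩ x
    exact (hasFDerivAt_twistIntegral B s c a x).differentiableAt
  · rintro _ ⟨⟨c, a⟩, rfl⟩
    exact ⟨_, norm_twistIntegral_le B s c a⟩
  · rintro _ ⟨⟨c, a⟩, rfl⟩ v
    simp only [fderiv_twistIntegral]
    exact add_mem (Submodule.smul_mem _ s (mem_span _ _)) (mem_span _ _)
  · rintro _ ⟨⟨c, a⟩, rfl⟩ v
    simp only [inner_smul_twistIntegral]
    exact sub_mem (mem_span _ _) (Submodule.smul_mem _ s (mem_span _ _))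

theorem exists_coe_eq_twistIntegral (B : V →L[ℝ] V) (s : ℝ) (c a : 𝓢(V, ℂ)) :
    ∃ f : 𝓢(V, ℂ), ⇑f = twistIntegral B s c a :=
  (isSchwartzStable_range_twistIntegral B s).exists_coe_eq ⟨(c, a), rfl⟩

/-- The twist integral as a Schwartz function. -/
noncomputable def twist (B : V →L[ℝ] V) (s : ℝ) (c a : 𝓢(V, ℂ)) : 𝓢(V, ℂ) :=
  (exists_coe_eq_twistIntegral B s c a).choose

theorem coe_twist (B : V →L[ℝ] V) (s : ℝ) (c a : 𝓢(V, ℂ)) :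
    ⇑(twist B s c a) = twistIntegral B s c a :=
  (exists_coe_eq_twistIntegral B s c a).choose_spec

theorem twist_smul_left (B : V →L[ℝ] V) (s : ℝ) (k : ℂ) (c a : 𝓢(V, ℂ)) :
    twist B s (k • c) a = k • twist B s c a := by
  ext x
  simp only [smul_apply, coe_twist, twistIntegral, ← integral_smul]
  refine integral_congr_ae (.of_forall fun w => ?_)
  simp only [twistKernel, smul_apply, smul_eq_mul]
  ring

theorem twist_smul_right (B : V →L[ℝ] V) (s : ℝ) (k : ℂ) (c a : 𝓢(V, ℂ)) :
    twist B s c (k • a) = k • twist B s c a := by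
  ext x
  simp only [smul_apply, coe_twist, twistIntegral, ← integral_smul]
  refine integral_congr_ae (.of_forall fun w => ?_)
  simp only [twistKernel, smul_apply, smul_eq_mul]
  ring

theorem twist_add_right (B : V →L[ℝ] V) (s : ℝ) (c a b : 𝓢(V, ℂ)) :
    twist B s c (a + b) = twist B s c a + twist B s c b := by
  ext x
  simp only [add_apply, coe_twist, twistIntegral]
  rw [← integral_add (integrable_twistKernel B s c a x) (integrable_twistKernel B s c b x)]
  simp only [twistKernel, add_apply, mul_add, add_mul]

theorem lineDerivOp_twist (B : V →L[ℝ] V) (s : ℝ) (c a : 𝓢(V, ℂ)) (v : V) :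
    ∂_{v} (twist B s c a) =
      s • twist B s ((2 * Real.pi * Complex.I) • coordMul v c) a + twist B s c (∂_{v} a) := by
  ext x
  rw [lineDerivOp_apply_eq_fderiv, coe_twist, fderiv_twistIntegral]
  simp only [add_apply, smul_apply, coe_twist]

theorem coordMul_twist (B : V →L[ℝ] V) (s : ℝ) (c a : 𝓢(V, ℂ)) (v : V) :
    coordMul v (twist B s c a) = twist B s c (coordMul v a) -
      s • twist B s (coordMul (ContinuousLinearMap.adjoint B v) c) a := by
  ext x
  rw [coordMul_apply, coe_twist, inner_smul_twistIntegral]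
  simp only [sub_apply, smul_apply, coe_twist]

theorem seminorm_twist_le (B : V →L[ℝ] V) (s : ℝ) (c a : 𝓢(V, ℂ)) :
    SchwartzMap.seminorm ℝ 0 0 (twist B s c a) ≤ SchwartzMap.seminorm ℝ 0 0 a * ∫ w, ‖c w‖ :=
  seminorm_zero_le_of_forall_norm_le (by positivity) fun x => by
    rw [coe_twist]
    exact norm_twistIntegral_le B s c a x

theorem isVanishingStable_twist_clm (B : V →L[ℝ] V) (s : ℝ) :
    IsVanishingStable (𝓝 0) (Set.range fun p : 𝓢(V, ℂ) × (𝓢(V, ℂ) →L[ℝ] 𝓢(V, ℂ)) =>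
      fun a => twist B s p.1 (p.2 a)) := by
  have mem_span : ∀ c (L : 𝓢(V, ℂ) →L[ℝ] 𝓢(V, ℂ)), (fun a => twist B s c (L a)) ∈
      Submodule.span ℝ (Set.range fun p : 𝓢(V, ℂ) × (𝓢(V, ℂ) →L[ℝ] 𝓢(V, ℂ)) =>
        fun a => twist B s p.1 (p.2 a)) :=
    fun c L => Submodule.subset_span ⟨(c, L), rfl⟩
  constructor
  · rintro _ ⟨⟨c, L⟩, rfl⟩
    have continuous_seminorm : Continuous fun a => SchwartzMap.seminorm ℝ 0 0 (L a) :=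
      ((schwartz_withSeminorms ℝ V ℂ).continuous_seminorm (0, 0)).comp L.continuous
    refine squeeze_zero (fun t => apply_nonneg _ _) (fun t => seminorm_twist_le B s c (L t)) ?_
    simpa using (continuous_seminorm.tendsto 0).mul_const (∫ w, ‖c w‖)
  · rintro _ ⟨⟨c, L⟩, rfl⟩ v
    simp only [lineDerivOp_twist]
    exact add_mem (Submodule.smul_mem _ s (mem_span _ L))
      (mem_span c ((lineDerivOpCLM ℝ 𝓢(V, ℂ) v).comp L))
  · rintro _ ⟨⟨c, L⟩, rfl⟩ v
    simp only [coordMul_twist]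
    exact sub_mem (mem_span c ((coordMul v).comp L)) (Submodule.smul_mem _ s (mem_span _ L))

theorem continuous_twist_right (B : V →L[ℝ] V) (s : ℝ) (c : 𝓢(V, ℂ)) :
    Continuous (twist B s c) := by
  refine continuous_of_continuousAt_zero (AddMonoidHom.mk' (twist B s c) (twist_add_right B s c)) ?_
  rw [ContinuousAt, map_zero]
  exact (isVanishingStable_twist_clm B s).tendsto ⟨(c, .id ℝ _), rfl⟩

theorem exists_seminorm_twist_sub_le (B : V →L[ℝ] V) (c a : 𝓢(V, ℂ)) :
    ∃ C, ∀ s, SchwartzMap.seminorm ℝ 0 0 (twist B s c a - (∫ w, c w) • a) ≤ |s| * C := by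
  refine ⟨∫ w, (SchwartzMap.seminorm ℝ 0 1 a * ‖B‖ +
    2 * Real.pi * SchwartzMap.seminorm ℝ 1 0 a) * (‖w‖ ^ 1 * ‖c w‖), fun s =>
    seminorm_zero_le_of_forall_norm_le (by positivity) fun x => ?_⟩
  rw [sub_apply, smul_apply, coe_twist, twistIntegral, smul_eq_mul, ← integral_mul_const,
    ← integral_sub (integrable_twistKernel B s c a x) (c.integrable.mul_const _),
    ← integral_const_mul]
  exact norm_integral_le_of_norm_le
    (((c.integrable_pow_mul volume 1).const_mul _).const_mul _)
    (.of_forall (norm_twistKernel_sub_le B s c a x))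

/-- The difference between `κ s • twist B s c a` and its limit at `s = 0`. The coefficient `κ`
absorbs the powers of `s` created by differentiation and multiplication by linear forms, which
makes these families vanishing stable. -/
noncomputable def twistError (B : V →L[ℝ] V) (κ : ℝ → ℝ) (c a : 𝓢(V, ℂ)) (s : ℝ) : 𝓢(V, ℂ) :=
  κ s • twist B s c a - κ 0 • (∫ w, c w) • a

theorem lineDerivOp_twistError (B : V →L[ℝ] V) (κ : ℝ → ℝ) (c a : 𝓢(V, ℂ)) (v : V) (s : ℝ) :
    ∂_{v} (twistError B κ c a s) =
      twistError B (fun s => κ s * s) ((2 * Real.pi * Complex.I) • coordMul v c) a s +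
        twistError B κ c (∂_{v} a) s := by
  simp only [twistError]
  rw [sub_eq_add_neg, lineDerivOp_add, lineDerivOp_neg, lineDerivOp_smul, lineDerivOp_smul,
    lineDerivOp_smul, lineDerivOp_twist]
  module

theorem coordMul_twistError (B : V →L[ℝ] V) (κ : ℝ → ℝ) (c a : 𝓢(V, ℂ)) (v : V) (s : ℝ) :
    coordMul v (twistError B κ c a s) = twistError B κ c (coordMul v a) s -
      twistError B (fun s => κ s * s) (coordMul (ContinuousLinearMap.adjoint B v) c) a s := by
  have coordMul_smul : coordMul v ((∫ w, c w) • a) = (∫ w, c w) • coordMul v a := by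
    ext x
    simp [mul_left_comm]
  simp only [twistError, map_sub, map_smul, coordMul_smul, coordMul_twist]
  module

theorem tendsto_seminorm_twistError (B : V →L[ℝ] V) {κ : ℝ → ℝ} (hκ : Continuous κ)
    (c a : 𝓢(V, ℂ)) :
    Tendsto (fun s => SchwartzMap.seminorm ℝ 0 0 (twistError B κ c a s)) (𝓝 0) (𝓝 0) := by
  obtain ⟨C, hC⟩ := exists_seminorm_twist_sub_le B c a
  refine squeeze_zero (g := fun s => |κ s| * (|s| * C) +
    |κ s - κ 0| * SchwartzMap.seminorm ℝ 0 0 ((∫ w, c w) • a)) (fun s => apply_nonneg _ _)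
    (fun s => ?_) ?_
  · have twistError_eq : twistError B κ c a s =
        κ s • (twist B s c a - (∫ w, c w) • a) + (κ s - κ 0) • (∫ w, c w) • a := by
      rw [twistError]; module
    rw [twistError_eq]
    refine (map_add_le_add _ _ _).trans ?_
    rw [map_smul_eq_mul, map_smul_eq_mul, Real.norm_eq_abs, Real.norm_eq_abs]
    gcongr
    exact hC s
  · have continuous_bound : Continuous fun s => |κ s| * (|s| * C) +
        |κ s - κ 0| * SchwartzMap.seminorm ℝ 0 0 ((∫ w, c w) • a) := by fun_prop
    simpa using continuous_bound.tendsto 0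

theorem isVanishingStable_twistError (B : V →L[ℝ] V) : IsVanishingStable (𝓝 0)
    {u : ℝ → 𝓢(V, ℂ) | ∃ κ c a, Continuous κ ∧ u = twistError B κ c a} where
  tendsto_seminorm := by
    rintro _ ⟨κ, c, a, hκ, rfl⟩
    exact tendsto_seminorm_twistError B hκ c a
  lineDerivOp_mem := by
    rintro _ ⟨κ, c, a, hκ, rfl⟩ v
    simp only [lineDerivOp_twistError]
    exact add_mem (Submodule.subset_span ⟨_, _, _, hκ.mul continuous_id, rfl⟩)
      (Submodule.subset_span ⟨_, _, _, hκ, rfl⟩)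
  coordMul_mem := by
    rintro _ ⟨κ, c, a, hκ, rfl⟩ v
    simp only [coordMul_twistError]
    exact sub_mem (Submodule.subset_span ⟨_, _, _, hκ, rfl⟩)
      (Submodule.subset_span ⟨_, _, _, hκ.mul continuous_id, rfl⟩)

theorem tendsto_twist_zero (B : V →L[ℝ] V) (c a : 𝓢(V, ℂ)) :
    Tendsto (fun s : ℝ => twist B s c a) (𝓝 0) (𝓝 ((∫ w, c w) • a)) := by
  have tendsto_twistError : Tendsto (fun s => twistError B (fun _ => 1) c a s) (𝓝 0) (𝓝 0) :=
    (isVanishingStable_twistError B).tendsto ⟨_, c, a, continuous_const, rfl⟩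
  rw [← tendsto_sub_nhds_zero_iff]
  simpa only [twistError, one_smul] using tendsto_twistError

end Twist

/-! ### The twisted product of a skew-adjoint operator -/

section SkewAdjoint

variable {V : Type*} [NormedAddCommGroup V] [InnerProductSpace ℝ V] [FiniteDimensional ℝ V]
  {B : V →L[ℝ] V}

theorem adjoint_eq_neg_of_mem_skewAdjoint (hB : B ∈ skewAdjoint (V →L[ℝ] V)) :
    ContinuousLinearMap.adjoint B = -B :=
  skewAdjoint.mem_iff.1 hB

theorem inner_apply_left_of_mem_skewAdjoint (hB : B ∈ skewAdjoint (V →L[ℝ] V)) (x y : V) :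
    inner ℝ (B x) y = -inner ℝ x (B y) := by
  rw [← ContinuousLinearMap.adjoint_inner_right, adjoint_eq_neg_of_mem_skewAdjoint hB,
    neg_apply, inner_neg_right]

theorem inner_self_apply_of_mem_skewAdjoint (hB : B ∈ skewAdjoint (V →L[ℝ] V)) (x : V) :
    inner ℝ x (B x) = 0 := by
  have inner_eq_neg := inner_apply_left_of_mem_skewAdjoint hB x x
  rw [real_inner_comm] at inner_eq_neg
  exact self_eq_neg.1 inner_eq_neg

theorem planeWave_apply_of_mem_skewAdjoint (hB : B ∈ skewAdjoint (V →L[ℝ] V)) (v w : V) :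
    planeWave w (B v) = planeWave v (-B w) := by
  rw [planeWave, planeWave, inner_neg_right, ← inner_apply_left_of_mem_skewAdjoint hB,
    real_inner_comm]

end SkewAdjoint

section Fourier

variable {V : Type*} [NormedAddCommGroup V] [InnerProductSpace ℝ V]

/-- The dilation `x ↦ e(s x)` of a Schwartz function by a nonzero real number. -/
noncomputable def dilate (s : ℝˣ) (e : 𝓢(V, ℂ)) : 𝓢(V, ℂ) :=
  compCLMOfContinuousLinearEquiv ℂ (ContinuousLinearEquiv.smulLeft s : V ≃L[ℝ] V) e

theorem dilate_apply (s : ℝˣ) (e : 𝓢(V, ℂ)) (x : V) : dilate s e x = e ((s : ℝ) • x) := rfl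

variable [FiniteDimensional ℝ V]

variable (V) in
theorem exists_schwartz_apply_zero_eq_one : ∃ e : 𝓢(V, ℂ), e 0 = 1 := by
  let f : ContDiffBump (0 : V) := ⟨1, 2, one_pos, one_lt_two⟩
  have hasCompactSupport : HasCompactSupport (Complex.ofRealCLM ∘ f) :=
    f.hasCompactSupport.comp_left rfl
  have contDiff : ContDiff ℝ ∞ (Complex.ofRealCLM ∘ f) :=
    Complex.ofRealCLM.contDiff.comp f.contDiff
  have apply_zero : f 0 = 1 := f.one_of_mem_closedBall (by simp [f])
  exact ⟨hasCompactSupport.toSchwartzMap contDiff, by simp [apply_zero]⟩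

variable [MeasurableSpace V] [BorelSpace V]

theorem apply_eq_integral_planeWave_mul_fourier (a : 𝓢(V, ℂ)) (x : V) :
    a x = ∫ w, planeWave w x * 𝓕 a w := by
  have fourierInv_fourier : (𝓕⁻ (𝓕 a) : 𝓢(V, ℂ)) x = a x := by rw [fourierInv_fourier_eq]
  rw [← fourierInv_fourier, fourierInv_coe, Real.fourierInv_eq]
  rfl

theorem fourier_apply_eq_integral_planeWave (a : 𝓢(V, ℂ)) (w : V) :
    𝓕 a w = ∫ x, planeWave w (-x) * a x := by
  rw [fourier_coe, Real.fourier_eq]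
  refine integral_congr_ae (.of_forall fun x => ?_)
  simp only [planeWave, inner_neg_right, real_inner_comm, Circle.smul_def, smul_eq_mul]

theorem fourier_lineDerivOp_eq_coordMul (b : 𝓢(V, ℂ)) (v : V) :
    𝓕 (∂_{v} b) = (2 * Real.pi * Complex.I) • coordMul v (𝓕 b) := by
  have hasTemperateGrowth_inner : (inner ℝ · v : V → ℝ).HasTemperateGrowth := by fun_prop
  ext x
  rw [fourier_lineDerivOp_eq]
  simp [smulLeftCLM_apply_apply hasTemperateGrowth_inner]

theorem coordMul_fourier (b : 𝓢(V, ℂ)) (v : V) :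
    coordMul v (𝓕 b) = -(Complex.I / (2 * Real.pi)) • 𝓕 (∂_{v} b) := by
  have const_mul_const : -(Complex.I / (2 * Real.pi)) * (2 * Real.pi * Complex.I) = 1 := by
    field_simp
    simp
  rw [fourier_lineDerivOp_eq_coordMul, smul_smul, const_mul_const, one_smul]

theorem fourier_dilate_smul (s : ℝˣ) (e : 𝓢(V, ℂ)) (w : V) :
    𝓕 (dilate s e) ((s : ℝ) • w) = |((s : ℝ) ^ Module.finrank ℝ V)⁻¹| • 𝓕 e w := by
  rw [fourier_apply_eq_integral_planeWave, fourier_apply_eq_integral_planeWave,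
    ← Measure.integral_comp_smul volume (fun x => planeWave w (-x) * e x) s]
  refine integral_congr_ae (.of_forall fun x => ?_)
  simp only [dilate_apply, planeWave, inner_neg_right, real_inner_smul_left, real_inner_smul_right]

end Fourier

section TwistedProduct

variable {V : Type*} [NormedAddCommGroup V] [InnerProductSpace ℝ V] [FiniteDimensional ℝ V]
  [MeasurableSpace V] [BorelSpace V]

/-- The twisted product `(a, b) ↦ (x ↦ ∫ exp (2 π i ⟪w, x⟫) a(x - B w) (𝓕 b)(w) dw)` of Schwartz
functions. For `B = π Θ` it is the Moyal product. -/
noncomputable def twistedMul (B : V →L[ℝ] V) (a b : 𝓢(V, ℂ)) : 𝓢(V, ℂ) := twist (-B) 1 (𝓕 b) a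

theorem twistedMul_apply (B : V →L[ℝ] V) (a b : 𝓢(V, ℂ)) (x : V) :
    twistedMul B a b x = ∫ w, planeWave w x * a (x - B w) * 𝓕 b w := by
  simp only [twistedMul, coe_twist, twistIntegral, twistKernel, one_smul, neg_apply,
    ← sub_eq_add_neg]

theorem twistedMul_add_left (B : V →L[ℝ] V) (a b c : 𝓢(V, ℂ)) :
    twistedMul B (a + b) c = twistedMul B a c + twistedMul B b c :=
  twist_add_right _ _ _ _ _

theorem twistedMul_smul_left (B : V →L[ℝ] V) (k : ℂ) (a b : 𝓢(V, ℂ)) :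
    twistedMul B (k • a) b = k • twistedMul B a b :=
  twist_smul_right _ _ _ _ _

theorem continuous_twistedMul_left (B : V →L[ℝ] V) (b : 𝓢(V, ℂ)) :
    Continuous fun a => twistedMul B a b :=
  continuous_twist_right _ _ _

theorem integral_kernel_swap {k : V → V → ℂ} (hk : Continuous (Function.uncurry k)) {C : ℝ}
    (hC : ∀ v w, ‖k v w‖ ≤ C) (f g : 𝓢(V, ℂ)) :
    ∫ v, (∫ w, k v w * g w) * f v = ∫ w, (∫ v, k v w * f v) * g w := by
  have integrable_kernel : Integrable (Function.uncurry fun v w => k v w * (f v * g w))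
      (volume.prod volume) :=
    (f.integrable.mul_prod g.integrable).bdd_mul (c := C) hk.aestronglyMeasurable
      (.of_forall fun p => hC p.1 p.2)
  simp only [← integral_mul_const]
  calc ∫ v, ∫ w, k v w * g w * f v = ∫ v, ∫ w, k v w * (f v * g w) := by
        simp only [mul_assoc, mul_comm (g _)]
    _ = ∫ w, ∫ v, k v w * (f v * g w) := integral_integral_swap integrable_kernel
    _ = ∫ w, ∫ v, k v w * f v * g w := by simp only [mul_assoc]

theorem twistedMul_eq_twist {B : V →L[ℝ] V} (hB : B ∈ skewAdjoint (V →L[ℝ] V))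
    (a b : 𝓢(V, ℂ)) : twistedMul B a b = twist B 1 (𝓕 a) b := by
  have expand_left (x w : V) : planeWave w x * a (x - B w) =
      ∫ v, planeWave w x * planeWave v (x - B w) * 𝓕 a v := by
    rw [apply_eq_integral_planeWave_mul_fourier a (x - B w), ← integral_const_mul]
    simp only [mul_assoc]
  have expand_right (x v : V) : planeWave v x * b (x + B v) =
      ∫ w, planeWave w x * planeWave v (x - B w) * 𝓕 b w := by
    rw [apply_eq_integral_planeWave_mul_fourier b (x + B v), ← integral_const_mul]
    refine integral_congr_ae (.of_forall fun w => ?_)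
    simp only [sub_eq_add_neg, planeWave_add_right, planeWave_apply_of_mem_skewAdjoint hB v w]
    ring
  ext x
  simp only [twistedMul_apply, coe_twist, twistIntegral, twistKernel, one_smul, expand_left,
    expand_right]
  refine integral_kernel_swap (k := fun w v => planeWave w x * planeWave v (x - B w)) (C := 1)
    ?_ (fun v w => by simp) _ _
  simp only [Function.uncurry_def]
  fun_prop

theorem twistedMul_apply_of_mem_skewAdjoint {B : V →L[ℝ] V} (hB : B ∈ skewAdjoint (V →L[ℝ] V))
    (a b : 𝓢(V, ℂ)) (x : V) :
    twistedMul B a b x = ∫ w, planeWave w x * b (x + B w) * 𝓕 a w := by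
  simp only [twistedMul_eq_twist hB, coe_twist, twistIntegral, twistKernel, one_smul]

theorem twistedMul_assoc {B : V →L[ℝ] V} (hB : B ∈ skewAdjoint (V →L[ℝ] V)) (a b c : 𝓢(V, ℂ)) :
    twistedMul B (twistedMul B a b) c = twistedMul B a (twistedMul B b c) := by
  have expand_left (x v : V) : planeWave v x * twistedMul B a b (x - B v) =
      ∫ w, planeWave v x * planeWave w (x - B v) * b (x - B v + B w) * 𝓕 a w := by
    rw [twistedMul_apply_of_mem_skewAdjoint hB, ← integral_const_mul]
    simp only [mul_assoc]
  have expand_right (x w : V) : planeWave w x * twistedMul B b c (x + B w) =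
      ∫ v, planeWave v x * planeWave w (x - B v) * b (x - B v + B w) * 𝓕 c v := by
    rw [twistedMul_apply, ← integral_const_mul]
    refine integral_congr_ae (.of_forall fun v => ?_)
    simp only [sub_eq_add_neg, planeWave_add_right, planeWave_apply_of_mem_skewAdjoint hB w v,
      add_right_comm x (B w)]
    ring
  ext x
  rw [twistedMul_apply, twistedMul_apply_of_mem_skewAdjoint hB]
  simp only [expand_left, expand_right]
  refine integral_kernel_swap
    (k := fun v w => planeWave v x * planeWave w (x - B v) * b (x - B v + B w))
    (C := SchwartzMap.seminorm ℝ 0 0 b) ?_ (fun v w => ?_) _ _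
  · simp only [Function.uncurry_def]
    fun_prop
  · simpa using norm_le_seminorm ℝ b _

theorem integrable_uncurry_planeWave_mul_translate (B : V →L[ℝ] V) (a c : 𝓢(V, ℂ)) :
    Integrable (Function.uncurry fun x w => planeWave w x * a (x - B w) * c w)
      (volume.prod volume) := by
  have continuous_kernel :
      Continuous (Function.uncurry fun x w => planeWave w x * a (x - B w) * c w) := by
    simp only [Function.uncurry_def]
    fun_prop
  refine (integrable_prod_iff' continuous_kernel.aestronglyMeasurable).2
    ⟨.of_forall fun w => ?_, ?_⟩
  · exact ((a.integrable.comp_sub_right (B w)).bdd_mul (c := 1) (by fun_prop)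
      (.of_forall fun x => (norm_planeWave w x).le)).mul_const (c w)
  · have integral_translate (w : V) : ∫ x, ‖a (x - B w)‖ = ∫ x, ‖a x‖ :=
      integral_sub_right_eq_self (fun x => ‖a x‖) (B w)
    simp only [Function.uncurry_apply_pair, norm_mul, norm_planeWave, one_mul, integral_mul_const,
      integral_translate]
    exact c.integrable.norm.const_mul _

theorem integral_planeWave_mul_translate {B : V →L[ℝ] V} (hB : B ∈ skewAdjoint (V →L[ℝ] V))
    (a : 𝓢(V, ℂ)) (w : V) : ∫ x, planeWave w x * a (x - B w) = 𝓕⁻ a w := by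
  have planeWave_apply_self : planeWave w (B w) = 1 := by
    simp [planeWave, inner_self_apply_of_mem_skewAdjoint hB]
  rw [← integral_add_right_eq_self _ (B w), fourierInv_coe, Real.fourierInv_eq]
  refine integral_congr_ae (.of_forall fun x => ?_)
  simp only [add_sub_cancel_right, planeWave_add_right, planeWave_apply_self, mul_one,
    planeWave_comm w x]
  rfl

theorem integral_twistedMul {B : V →L[ℝ] V} (hB : B ∈ skewAdjoint (V →L[ℝ] V)) (a b : 𝓢(V, ℂ)) :
    ∫ x, twistedMul B a b x = ∫ x, a x * b x := by
  simp only [twistedMul_apply]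
  rw [integral_integral_swap (integrable_uncurry_planeWave_mul_translate B a (𝓕 b))]
  simp only [integral_mul_const, integral_planeWave_mul_translate hB]
  rw [integral_fourierInv_mul_eq a (𝓕 b), fourierInv_fourier_eq]

theorem coordMul_twistedMul_left {B : V →L[ℝ] V} (hB : B ∈ skewAdjoint (V →L[ℝ] V))
    (a b : 𝓢(V, ℂ)) (v : V) :
    coordMul v (twistedMul B a b) = twistedMul B (coordMul v a) b +
      (Complex.I / (2 * Real.pi)) • twistedMul B a (∂_{B v} b) := by
  rw [twistedMul, coordMul_twist, adjoint_eq_neg_of_mem_skewAdjoint (neg_mem hB), neg_neg,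
    coordMul_fourier, twist_smul_left, one_smul, neg_smul, sub_neg_eq_add]
  rfl

theorem coordMul_twistedMul_right {B : V →L[ℝ] V} (hB : B ∈ skewAdjoint (V →L[ℝ] V))
    (a b : 𝓢(V, ℂ)) (v : V) :
    coordMul v (twistedMul B a b) = twistedMul B a (coordMul v b) -
      (Complex.I / (2 * Real.pi)) • twistedMul B (∂_{B v} a) b := by
  have coordMul_adjoint : coordMul (ContinuousLinearMap.adjoint B v) (𝓕 a) =
      (Complex.I / (2 * Real.pi)) • 𝓕 (∂_{B v} a) := by
    rw [adjoint_eq_neg_of_mem_skewAdjoint hB, coordMul_fourier, neg_apply, lineDerivOp_left_neg,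
      FourierTransform.fourier_neg, smul_neg, neg_smul, neg_neg]
  simp only [twistedMul_eq_twist hB, coordMul_twist, coordMul_adjoint, twist_smul_left, one_smul]

theorem twistedMul_dilate (B : V →L[ℝ] V) (a e : 𝓢(V, ℂ)) (s : ℝˣ) :
    twistedMul B a (dilate s e) = twist (-B) s (𝓕 e) a := by
  have jacobian_ne_zero : |((s : ℝ) ^ Module.finrank ℝ V)⁻¹| ≠ 0 := by simp
  ext x
  rw [twistedMul_apply, coe_twist, twistIntegral]
  refine smul_right_injective ℂ jacobian_ne_zero ?_
  simp only
  rw [← Measure.integral_comp_smul, ← integral_smul]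
  refine integral_congr_ae (.of_forall fun w => ?_)
  have planeWave_smul : planeWave ((s : ℝ) • w) x = planeWave w ((s : ℝ) • x) := by
    simp only [planeWave, real_inner_smul_left, real_inner_smul_right]
  simp only [twistKernel, fourier_dilate_smul, planeWave_smul, map_smul, neg_apply, smul_neg,
    ← sub_eq_add_neg, Complex.real_smul]
  ring

/-- The twisted product has a sequential approximate right unit: the dilations `e(s ·)` of a
Schwartz function `e` with `e(0) = 1`, as `s` tends to `0`. -/
theorem exists_tendsto_twistedMul (B : V →L[ℝ] V) :
    ∃ e : ℕ → 𝓢(V, ℂ), ∀ a, Tendsto (fun k => twistedMul B a (e k)) atTop (𝓝 a) := by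
  obtain ⟨e, he⟩ := exists_schwartz_apply_zero_eq_one V
  have scale_ne_zero (k : ℕ) : 1 / ((k : ℝ) + 1) ≠ 0 := by positivity
  refine ⟨fun k => dilate (Units.mk0 _ (scale_ne_zero k)) e, fun a => ?_⟩
  have integral_fourier : ∫ w, 𝓕 e w = 1 := by
    rw [← he, apply_eq_integral_planeWave_mul_fourier e 0]
    simp
  simpa only [twistedMul_dilate, Units.val_mk0, integral_fourier, one_smul, Function.comp_def] using
    (tendsto_twist_zero (-B) (𝓕 e) a).comp tendsto_one_div_add_atTop_nhds_zero_nat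

end TwistedProduct

/-! ### The Moyal product of Schwartz functions -/

section Theta

theorem Theta_transpose (n : ℕ) (θ : ℝ) : (Theta n θ).transpose = -Theta n θ := by
  ext ⟨i, k⟩ ⟨j, l⟩
  fin_cases i <;> fin_cases j <;>
    simp [Theta, Matrix.blockDiagonal_apply, eq_comm (a := k) (b := l)] <;> split_ifs <;> simp

theorem Theta_det (n : ℕ) (θ : ℝ) : (Theta n θ).det = θ ^ (2 * n) := by
  rw [Theta, Matrix.det_smul, Matrix.det_blockDiagonal]
  simp [Matrix.det_fin_two]

theorem isUnit_Theta_det (n : ℕ) {θ : ℝ} (hθ : θ ≠ 0) : IsUnit (Theta n θ).det := by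
  rw [Theta_det]
  exact (pow_ne_zero _ hθ).isUnit

theorem Theta_inv_transpose (n : ℕ) {θ : ℝ} (hθ : θ ≠ 0) :
    (Theta n θ)⁻¹.transpose = -(Theta n θ)⁻¹ := by
  rw [Matrix.transpose_nonsing_inv, Theta_transpose]
  refine Matrix.inv_eq_right_inv ?_
  rw [neg_mul_neg, Matrix.mul_nonsing_inv _ (isUnit_Theta_det n hθ)]

theorem Theta_inv_apply_swap (n : ℕ) {θ : ℝ} (hθ : θ ≠ 0) (μ ν : Idx n) :
    (Theta n θ)⁻¹ ν μ = -(Theta n θ)⁻¹ μ ν :=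
  congrFun (congrFun (Theta_inv_transpose n hθ) μ) ν

/-- The linear map `π Θ`, through which the Moyal product is a twisted product. -/
noncomputable def piTheta (n : ℕ) (θ : ℝ) : Space n →L[ℝ] Space n :=
  Real.pi • Matrix.toEuclideanCLM (𝕜 := ℝ) (Theta n θ)

theorem piTheta_mem_skewAdjoint (n : ℕ) (θ : ℝ) :
    piTheta n θ ∈ skewAdjoint (Space n →L[ℝ] Space n) := by
  rw [skewAdjoint.mem_iff, piTheta, star_smul, ← map_star, Matrix.star_eq_conjTranspose,
    Matrix.conjTranspose_eq_transpose_of_trivial, Theta_transpose, map_neg, smul_neg, star_trivial]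

theorem thetaInvForm_piTheta (n : ℕ) {θ : ℝ} (hθ : θ ≠ 0) (w z : Space n) :
    thetaInvForm n θ (piTheta n θ w) z = -(Real.pi * inner ℝ w z) := by
  have thetaInvForm_eq_inner (y : Space n) : thetaInvForm n θ y z =
      inner ℝ y (Matrix.toEuclideanCLM (𝕜 := ℝ) (Theta n θ)⁻¹ z) := by
    rw [Matrix.inner_toEuclideanCLM]
    simp only [thetaInvForm, dotProduct, Matrix.mulVec, Finset.mul_sum, mul_assoc]
  rw [thetaInvForm_eq_inner,
    inner_apply_left_of_mem_skewAdjoint (piTheta_mem_skewAdjoint n θ), piTheta, smul_apply,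
    inner_smul_right, ← mul_apply_eq_comp, ← map_mul,
    Matrix.mul_nonsing_inv _ (isUnit_Theta_det n hθ), map_one, one_apply_eq_self]

theorem abs_det_neg_piTheta (n : ℕ) (θ : ℝ) : |(-piTheta n θ).det| = (Real.pi * θ) ^ (2 * n) := by
  have neg_piTheta_eq : ((-piTheta n θ : Space n →L[ℝ] Space n) : Space n →ₗ[ℝ] Space n) =
      (-Real.pi) • Matrix.toEuclideanLin (Theta n θ) := by
    ext x : 1
    simp [piTheta, ← Matrix.coe_toEuclideanCLM_eq_toEuclideanLin]
  rw [ContinuousLinearMap.det, neg_piTheta_eq, LinearMap.det_smul,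
    Matrix.toEuclideanLin_eq_toLin_orthonormal, LinearMap.det_toLin, Theta_det,
    finrank_euclideanSpace, Fintype.card_prod, Fintype.card_fin, Fintype.card_fin, ← mul_pow,
    abs_of_nonneg ((even_two_mul n).pow_nonneg _), neg_mul, (even_two_mul n).neg_pow]

end Theta

section Star

theorem integral_eq_abs_det_smul_integral_comp {E F : Type*} [NormedAddCommGroup E]
    [NormedSpace ℝ E] [FiniteDimensional ℝ E] [MeasurableSpace E] [BorelSpace E]
    [NormedAddCommGroup F] [NormedSpace ℝ F] (μ : Measure E) [μ.IsAddHaarMeasure] {f : E →L[ℝ] E}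
    (hf : f.det ≠ 0) (g : E → F) : ∫ y, g y ∂μ = |f.det| • ∫ x, g (f x) ∂μ := by
  have bijective : Function.Bijective f :=
    ((LinearMap.isUnit_iff_isUnit_det (f : E →ₗ[ℝ] E)).2 hf.isUnit |>
      (Module.End.isUnit_iff _).1)
  simpa only [Set.image_univ, bijective.2.range_eq, Measure.restrict_univ, integral_smul] using
    integral_image_eq_integral_abs_det_fderiv_smul μ MeasurableSet.univ
      (fun x _ => f.hasFDerivAt.hasFDerivWithinAt) bijective.1.injOn g

/-- The substitution `y = -π Θ w` turns the integral over `z` into a Fourier transform. -/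
theorem starIntegral_eq_twistedMul (n : ℕ) {θ : ℝ} (hθ : θ ≠ 0) (a b : 𝓢(Space n, ℂ))
    (x : Space n) : starIntegral n θ a b x = twistedMul (piTheta n θ) a b x := by
  have jacobian_ne_zero : (Real.pi * θ) ^ (2 * n) ≠ 0 :=
    pow_ne_zero _ (mul_ne_zero Real.pi_ne_zero hθ)
  have det_ne_zero : (-piTheta n θ).det ≠ 0 := by
    rwa [← abs_ne_zero, abs_det_neg_piTheta]
  have exp_eq_planeWave (w z : Space n) :
      Complex.exp (-2 * Complex.I * (thetaInvForm n θ (-piTheta n θ w) z : ℂ)) =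
        planeWave w (-z) := by
    rw [← map_neg, thetaInvForm_piTheta n hθ, planeWave, Real.fourierChar_apply, inner_neg_left,
      inner_neg_right]
    push_cast
    ring_nf
  have planeWave_mul_fourier (w : Space n) :
      planeWave w x * 𝓕 b w = ∫ z, b (x + z) * planeWave w (-z) := by
    rw [fourier_apply_eq_integral_planeWave,
      ← integral_add_left_eq_self (fun z => planeWave w (-z) * b z) x, ← integral_const_mul]
    refine integral_congr_ae (.of_forall fun z => ?_)
    simp only
    rw [mul_comm (b _), ← mul_assoc, ← planeWave_add_right, neg_add, add_neg_cancel_left]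
  rw [starIntegral, integral_eq_abs_det_smul_integral_comp volume det_ne_zero, abs_det_neg_piTheta,
    Complex.real_smul, inv_mul_cancel_left₀ (by exact_mod_cast jacobian_ne_zero), twistedMul_apply]
  refine integral_congr_ae (.of_forall fun w => ?_)
  simp only [neg_apply, ← sub_eq_add_neg, exp_eq_planeWave]
  simp only [mul_assoc, integral_const_mul, ← planeWave_mul_fourier]
  ring

theorem star_eq_twistedMul (n : ℕ) {θ : ℝ} (hθ : θ ≠ 0) (a b : 𝓢(Space n, ℂ)) :
    star n θ a b = twistedMul (piTheta n θ) a b := by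
  have exists_schwartz : ∃ c : 𝓢(Space n, ℂ), ∀ x, c x = starIntegral n θ a b x :=
    ⟨_, fun x => (starIntegral_eq_twistedMul n hθ a b x).symm⟩
  ext x
  rw [star, dif_pos exists_schwartz, exists_schwartz.choose_spec, starIntegral_eq_twistedMul n hθ]

theorem star_apply (n : ℕ) {θ : ℝ} (hθ : θ ≠ 0) (a b : 𝓢(Space n, ℂ)) (x : Space n) :
    star n θ a b x = starIntegral n θ a b x := by
  rw [star_eq_twistedMul n hθ, starIntegral_eq_twistedMul n hθ]

end Star

theorem eq_zero_of_forall_integral_schwartz_smul {E F : Type*} [NormedAddCommGroup E]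
    [NormedSpace ℝ E] [FiniteDimensional ℝ E] [MeasurableSpace E] [BorelSpace E]
    [NormedAddCommGroup F] [NormedSpace ℂ F] [CompleteSpace F] {μ : Measure E} [μ.IsOpenPosMeasure]
    [IsLocallyFiniteMeasure μ] {f : E → F} (hf : Continuous f)
    (h : ∀ φ : 𝓢(E, ℂ), ∫ x, φ x • f x ∂μ = 0) : f = 0 := by
  refine Measure.eq_of_ae_eq (μ := μ) ?_ hf continuous_zero
  refine ae_eq_zero_of_integral_contDiff_smul_eq_zero hf.locallyIntegrable fun g hg hc => ?_
  have hasCompactSupport : HasCompactSupport (Complex.ofRealCLM ∘ g) := hc.comp_left rfl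
  have contDiff : ContDiff ℝ ∞ (Complex.ofRealCLM ∘ g) := Complex.ofRealCLM.contDiff.comp hg
  simpa using h (hasCompactSupport.toSchwartzMap contDiff)

section Pairing

variable {E : Type*} [NormedAddCommGroup E] [NormedSpace ℝ E] [MeasureSpace E]
  [BorelSpace E] [SecondCountableTopology E]
  [(volume : Measure E).HasTemperateGrowth]

theorem coe_schwartz_apply (c b : 𝓢(E, ℂ)) : (c : 𝓢'(E, ℂ)) b = ∫ x, c x * b x := by
  simp only [coe_apply, smul_eq_mul, mul_comm]

theorem coe_schwartz_apply_comm (a b : 𝓢(E, ℂ)) : (a : 𝓢'(E, ℂ)) b = (b : 𝓢'(E, ℂ)) a := by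
  simp only [coe_schwartz_apply, mul_comm]

theorem coe_schwartz_injective [FiniteDimensional ℝ E] [(volume : Measure E).IsOpenPosMeasure]
    [IsLocallyFiniteMeasure (volume : Measure E)] :
    Function.Injective ((↑) : 𝓢(E, ℂ) → 𝓢'(E, ℂ)) := by
  intro c d h
  have coe_sub_eq_zero : ⇑(c - d) = 0 := by
    refine eq_zero_of_forall_integral_schwartz_smul (μ := volume) (c - d).continuous fun φ => ?_
    rw [← coe_apply, map_sub, h, sub_self]
    rfl
  exact sub_eq_zero.1 (DFunLike.coe_injective coe_sub_eq_zero)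

end Pairing

section Star

variable {n : ℕ} {θ : ℝ} [hθ : NeZero θ]

theorem star_add_left (a b c : 𝓢(Space n, ℂ)) :
    star n θ (a + b) c = star n θ a c + star n θ b c := by
  simp only [star_eq_twistedMul n hθ.out, twistedMul_add_left]

theorem star_smul_left (k : ℂ) (a b : 𝓢(Space n, ℂ)) :
    star n θ (k • a) b = k • star n θ a b := by
  simp only [star_eq_twistedMul n hθ.out, twistedMul_smul_left]

theorem star_assoc (a b c : 𝓢(Space n, ℂ)) :
    star n θ (star n θ a b) c = star n θ a (star n θ b c) := by
  simp only [star_eq_twistedMul n hθ.out]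
  exact twistedMul_assoc (piTheta_mem_skewAdjoint n θ) a b c

theorem integral_star (a b : 𝓢(Space n, ℂ)) : ∫ x, star n θ a b x = ∫ x, a x * b x := by
  simp only [star_eq_twistedMul n hθ.out]
  exact integral_twistedMul (piTheta_mem_skewAdjoint n θ) a b

/-- Right multiplication `a ↦ a ⋆ b` as a continuous linear map, for composing it with tempered
distributions. -/
noncomputable def starRightCLM (n : ℕ) (θ : ℝ) [hθ : NeZero θ] (b : 𝓢(Space n, ℂ)) :
    𝓢(Space n, ℂ) →L[ℂ] 𝓢(Space n, ℂ) where
  toFun a := star n θ a b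
  map_add' a c := star_add_left a c b
  map_smul' k a := star_smul_left k a b
  cont := by
    simp only [star_eq_twistedMul n hθ.out]
    exact continuous_twistedMul_left (piTheta n θ) b

variable (n θ) in
theorem exists_tendsto_star :
    ∃ e : ℕ → 𝓢(Space n, ℂ), ∀ a, Tendsto (fun k => star n θ a (e k)) atTop (𝓝 a) := by
  simp only [star_eq_twistedMul n hθ.out]
  exact exists_tendsto_twistedMul (piTheta n θ)

theorem coe_star_apply_left (a b c : 𝓢(Space n, ℂ)) :
    (star n θ a b : 𝓢'(Space n, ℂ)) c = (a : 𝓢'(Space n, ℂ)) (star n θ b c) := by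
  rw [coe_schwartz_apply, coe_schwartz_apply, ← integral_star (θ := θ) (star n θ a b),
    ← integral_star (θ := θ) a, star_assoc]

theorem coe_star_apply_right (a b c : 𝓢(Space n, ℂ)) :
    (star n θ a b : 𝓢'(Space n, ℂ)) c = (b : 𝓢'(Space n, ℂ)) (star n θ c a) := by
  rw [coe_schwartz_apply_comm, ← coe_star_apply_left, coe_schwartz_apply_comm]

end Star

/-! ### The Moyal algebra -/

section Multipliers

variable {n : ℕ} {θ : ℝ}

/-- The Schwartz function `T ⋆ a`. -/
noncomputable def rightAct (T : Alg n θ) (a : 𝓢(Space n, ℂ)) : 𝓢(Space n, ℂ) :=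
  (T.2.2 a).choose

/-- The Schwartz function `a ⋆ T`. -/
noncomputable def leftAct (a : 𝓢(Space n, ℂ)) (T : Alg n θ) : 𝓢(Space n, ℂ) :=
  (T.2.1 a).choose

theorem starRightEq_rightAct (T : Alg n θ) (a : 𝓢(Space n, ℂ)) :
    StarRightEq n θ (T : 𝓢'(Space n, ℂ)) a (rightAct T a) :=
  (T.2.2 a).choose_spec

theorem starLeftEq_leftAct (a : 𝓢(Space n, ℂ)) (T : Alg n θ) :
    StarLeftEq n θ a (T : 𝓢'(Space n, ℂ)) (leftAct a T) :=
  (T.2.1 a).choose_spec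

theorem rightAct_eq {T : Alg n θ} {a c : 𝓢(Space n, ℂ)}
    (h : StarRightEq n θ (T : 𝓢'(Space n, ℂ)) a c) : rightAct T a = c :=
  coe_schwartz_injective (DFunLike.ext _ _ fun b =>
    (starRightEq_rightAct T a b).symm.trans (h b))

theorem rightAct_zero_left (a : 𝓢(Space n, ℂ)) : rightAct (0 : Alg n θ) a = 0 :=
  rightAct_eq fun c => by
    rw [map_zero]
    rfl

theorem rightAct_add_left (T S : Alg n θ) (a : 𝓢(Space n, ℂ)) :
    rightAct (T + S) a = rightAct T a + rightAct S a :=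
  rightAct_eq fun c => by
    rw [map_add]
    exact congrArg₂ (· + ·) (starRightEq_rightAct T a c) (starRightEq_rightAct S a c)

theorem rightAct_smul_left (k : ℂ) (T : Alg n θ) (a : 𝓢(Space n, ℂ)) :
    rightAct (k • T) a = k • rightAct T a :=
  rightAct_eq fun c => by
    rw [map_smul]
    exact congrArg (k • ·) (starRightEq_rightAct T a c)

theorem alg_ext {T S : Alg n θ}
    (h : ∀ a, (T : 𝓢'(Space n, ℂ)) a = (S : 𝓢'(Space n, ℂ)) a) : T = S :=
  Subtype.ext (DFunLike.ext _ _ h)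

theorem polyDist_one_apply (a : 𝓢(Space n, ℂ)) :
    polyDist (1 : MvPolynomial (Idx n) ℂ) a = ∫ x, a x := by
  simp [polyDist, polyFun]

variable [hθ : NeZero θ]

theorem rightAct_star (T : Alg n θ) (a b : 𝓢(Space n, ℂ)) :
    rightAct T (star n θ a b) = star n θ (rightAct T a) b :=
  rightAct_eq fun c => by
    rw [star_assoc, starRightEq_rightAct, coe_star_apply_left]

/-- With an approximate right unit `e`, the functional is the pointwise limit of the tempered
distributions `a ↦ ⟨S, a ⋆ (e k ⋆ T)⟩`, so it is continuous by the Banach–Steinhaus theorem. -/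
theorem exists_temperedDistribution_apply_eq (T S : Alg n θ) :
    ∃ U : 𝓢'(Space n, ℂ), ∀ a, U a = (T : 𝓢'(Space n, ℂ)) (rightAct S a) := by
  obtain ⟨e, he⟩ := exists_tendsto_star n θ
  let approx (k : ℕ) : 𝓢(Space n, ℂ) →L[ℂ] ℂ :=
    ContinuousLinearMap.comp (S : 𝓢'(Space n, ℂ)) (starRightCLM n θ (leftAct (e k) T))
  have approx_apply (k : ℕ) (a : 𝓢(Space n, ℂ)) :
      approx k a = (T : 𝓢'(Space n, ℂ)) (star n θ (rightAct S a) (e k)) := by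
    rw [starLeftEq_leftAct, coe_schwartz_apply_comm]
    exact starRightEq_rightAct S a (leftAct (e k) T)
  have tendsto_approx : Tendsto (fun k a => approx k a) atTop
      (𝓝 fun a => (T : 𝓢'(Space n, ℂ)) (rightAct S a)) := by
    simp only [tendsto_pi_nhds, approx_apply]
    exact fun a => ((T : 𝓢'(Space n, ℂ)).continuous.tendsto _).comp (he _)
  exact ⟨ContinuousLinearMap.toPointwiseConvergenceCLM _ _ _ _
    (continuousLinearMapOfTendsto approx tendsto_approx), fun a => rfl⟩

theorem exists_isProduct (T S : Alg n θ) : ∃ U, IsProduct T S U := by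
  obtain ⟨U, hU⟩ := exists_temperedDistribution_apply_eq T S
  refine ⟨⟨U, fun a => ⟨leftAct (leftAct a T) S, fun b => ?_⟩,
    fun a => ⟨rightAct T (rightAct S a), fun b => ?_⟩⟩, fun a c hc => ?_⟩
  · rw [hU, rightAct_star, starLeftEq_leftAct, coe_schwartz_apply_comm, ← starRightEq_rightAct,
      starLeftEq_leftAct]
  · rw [hU, rightAct_star, starRightEq_rightAct]
  · rw [← rightAct_eq hc]
    exact hU a

theorem isProduct_mul (T S : Alg n θ) : IsProduct T S (T * S) := by
  have mul_eq_choose : T * S = (exists_isProduct T S).choose := dif_pos (exists_isProduct T S)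
  rw [mul_eq_choose]
  exact (exists_isProduct T S).choose_spec

theorem mul_apply_schwartz (T S : Alg n θ) (a : 𝓢(Space n, ℂ)) :
    ((T * S : Alg n θ) : 𝓢'(Space n, ℂ)) a = (T : 𝓢'(Space n, ℂ)) (rightAct S a) :=
  isProduct_mul T S a _ (starRightEq_rightAct S a)

theorem rightAct_mul (T S : Alg n θ) (a : 𝓢(Space n, ℂ)) :
    rightAct (T * S) a = rightAct T (rightAct S a) :=
  rightAct_eq fun b => by
    rw [mul_apply_schwartz, rightAct_star, starRightEq_rightAct]

theorem polyDist_one_mem :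
    polyDist (1 : MvPolynomial (Idx n) ℂ) ∈ leftMultipliers n θ ⊓ rightMultipliers n θ := by
  refine ⟨fun a => ⟨a, fun b => ?_⟩, fun a => ⟨a, fun b => ?_⟩⟩
  · rw [polyDist_one_apply, integral_star, coe_schwartz_apply_comm, coe_schwartz_apply]
  · rw [polyDist_one_apply, integral_star, coe_schwartz_apply]

theorem coe_one : ((1 : Alg n θ) : 𝓢'(Space n, ℂ)) = polyDist 1 :=
  congrArg Subtype.val (dif_pos polyDist_one_mem : (1 : Alg n θ) = ⟨polyDist 1, polyDist_one_mem⟩)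

theorem rightAct_one (a : 𝓢(Space n, ℂ)) : rightAct (1 : Alg n θ) a = a :=
  rightAct_eq fun b => by
    rw [coe_one, polyDist_one_apply, integral_star, coe_schwartz_apply]

theorem one_mul_alg (T : Alg n θ) : 1 * T = T := by
  refine alg_ext fun a => ?_
  obtain ⟨e, he⟩ := exists_tendsto_star n θ
  rw [mul_apply_schwartz, coe_one, polyDist_one_apply]
  have tendsto_apply : Tendsto (fun k => (T : 𝓢'(Space n, ℂ)) (star n θ a (e k))) atTop
      (𝓝 ((T : 𝓢'(Space n, ℂ)) a)) :=
    ((T : 𝓢'(Space n, ℂ)).continuous.tendsto _).comp (he _)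
  have tendsto_integral : Tendsto (fun k => ∫ x, star n θ (rightAct T a) (e k) x) atTop
      (𝓝 (∫ x, rightAct T a x)) :=
    ((integralCLM ℂ (volume : Measure (Space n))).continuous.tendsto _).comp (he (rightAct T a))
  refine tendsto_nhds_unique tendsto_integral (tendsto_apply.congr fun k => ?_)
  rw [starRightEq_rightAct, coe_schwartz_apply, integral_star]

noncomputable instance instRingAlg : Ring (Alg n θ) where
  __ := (inferInstance : AddCommGroup (Alg n θ))
  __ := instMulAlg
  __ := instOneAlg
  left_distrib T S U := alg_ext fun a => by
    change _ = ((T * S : Alg n θ) : 𝓢'(Space n, ℂ)) a + ((T * U : Alg n θ) : 𝓢'(Space n, ℂ)) a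
    simp only [mul_apply_schwartz, rightAct_add_left, map_add]
  right_distrib T S U := alg_ext fun a => by
    change _ = ((T * U : Alg n θ) : 𝓢'(Space n, ℂ)) a + ((S * U : Alg n θ) : 𝓢'(Space n, ℂ)) a
    simp only [mul_apply_schwartz]
    rfl
  zero_mul T := alg_ext fun a => by
    rw [mul_apply_schwartz]
    rfl
  mul_zero T := alg_ext fun a => by
    rw [mul_apply_schwartz, rightAct_zero_left, map_zero]
    rfl
  mul_assoc T S U := alg_ext fun a => by
    simp only [mul_apply_schwartz, rightAct_mul]
  one_mul := one_mul_alg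
  mul_one T := alg_ext fun a => by
    rw [mul_apply_schwartz, rightAct_one]

noncomputable instance instAlgebraAlg : Algebra ℂ (Alg n θ) :=
  Algebra.ofModule
    (fun k T S => alg_ext fun a => by
      change _ = k • ((T * S : Alg n θ) : 𝓢'(Space n, ℂ)) a
      simp only [mul_apply_schwartz]
      rfl)
    (fun k T S => alg_ext fun a => by
      change _ = k • ((T * S : Alg n θ) : 𝓢'(Space n, ℂ)) a
      simp only [mul_apply_schwartz, rightAct_smul_left, map_smul])

end Multipliers

/-! ### Polynomials as tempered distributions -/

theorem integral_lineDerivOp_eq_zero {V : Type*} [NormedAddCommGroup V] [InnerProductSpace ℝ V]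
    [FiniteDimensional ℝ V] [MeasurableSpace V] [BorelSpace V] (f : 𝓢(V, ℂ)) (v : V) :
    ∫ x, ∂_{v} f x = 0 := by
  have fourier_zero : ∀ g : 𝓢(V, ℂ), 𝓕 g 0 = ∫ x, g x := fun g => by
    simp [fourier_apply_eq_integral_planeWave, planeWave]
  simp [← fourier_zero, fourier_lineDerivOp_eq_coordMul]

section Polynomials

variable {n : ℕ}

/-- The linear form `⟪·, v⟫` as a polynomial. -/
noncomputable def linForm (v : Space n) : MvPolynomial (Idx n) ℂ :=
  ∑ μ, MvPolynomial.C (v μ : ℂ) * MvPolynomial.X μ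

theorem linForm_single (μ : Idx n) :
    linForm (EuclideanSpace.single μ (1 : ℝ)) = MvPolynomial.X μ := by
  rw [linForm, Finset.sum_eq_single μ (fun ν _ hν => by simp [hν]) (by simp)]
  simp

/-- The derivative of a polynomial in the direction `v`. -/
noncomputable def dirDeriv (v : Space n) :
    Derivation ℂ (MvPolynomial (Idx n) ℂ) (MvPolynomial (Idx n) ℂ) :=
  MvPolynomial.mkDerivation ℂ fun μ => MvPolynomial.C (v μ : ℂ)

theorem dirDeriv_X (v : Space n) (μ : Idx n) :
    dirDeriv v (MvPolynomial.X μ) = MvPolynomial.C (v μ : ℂ) :=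
  MvPolynomial.mkDerivation_X _ _ _

theorem dirDeriv_single (μ : Idx n) :
    dirDeriv (EuclideanSpace.single μ (1 : ℝ)) = MvPolynomial.pderiv (R := ℂ) μ := by
  refine MvPolynomial.derivation_ext fun ν => ?_
  rw [dirDeriv_X, MvPolynomial.pderiv_X, PiLp.single_apply, Pi.single_apply]
  split_ifs <;> simp

theorem dirDeriv_smul (r : ℝ) (v : Space n) : dirDeriv (r • v) = (r : ℂ) • dirDeriv v := by
  refine MvPolynomial.derivation_ext fun μ => ?_
  simp [dirDeriv_X, MvPolynomial.smul_eq_C_mul]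

theorem dirDeriv_linForm (v w : Space n) :
    dirDeriv v (linForm w) = MvPolynomial.C ((inner ℝ v w : ℝ) : ℂ) := by
  have dirDeriv_C : ∀ c : ℂ, dirDeriv v (MvPolynomial.C c) = 0 := (dirDeriv v).map_algebraMap
  simp only [linForm, map_sum, Derivation.leibniz, dirDeriv_X, dirDeriv_C, smul_eq_mul, ← map_mul,
    PiLp.inner_apply]
  rw [Complex.ofReal_sum, map_sum]
  simp

@[simp]
theorem polyFun_add (p q : MvPolynomial (Idx n) ℂ) (x : Space n) :
    polyFun (p + q) x = polyFun p x + polyFun q x := by simp [polyFun]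

@[simp]
theorem polyFun_smul (k : ℂ) (p : MvPolynomial (Idx n) ℂ) (x : Space n) :
    polyFun (k • p) x = k * polyFun p x := by simp [polyFun]

@[simp]
theorem polyFun_mul (p q : MvPolynomial (Idx n) ℂ) (x : Space n) :
    polyFun (p * q) x = polyFun p x * polyFun q x := by simp [polyFun]

theorem polyFun_linForm (v x : Space n) : polyFun (linForm v) x = ((inner ℝ x v : ℝ) : ℂ) := by
  simp [polyFun, linForm, PiLp.inner_apply]

theorem exists_hasFDerivAt_polyFun (p : MvPolynomial (Idx n) ℂ) (x : Space n) :
    ∃ f' : Space n →L[ℝ] ℂ, HasFDerivAt (polyFun p) f' x ∧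
      ∀ v, f' v = polyFun (dirDeriv v p) x := by
  induction p using MvPolynomial.induction_on with
  | C c =>
    have eq_const : (polyFun (MvPolynomial.C c) : Space n → ℂ) = fun _ => c := by
      funext x; simp [polyFun]
    exact ⟨0, eq_const ▸ hasFDerivAt_const c x, fun v => by simp [polyFun]⟩
  | add p q hp hq =>
    obtain ⟨f', hf, hf'⟩ := hp
    obtain ⟨g', hg, hg'⟩ := hq
    have eq_add : (polyFun (p + q) : Space n → ℂ) = polyFun p + polyFun q := by
      funext x; simp
    exact ⟨f' + g', eq_add ▸ hf.add hg, fun v => by simp [hf', hg']⟩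
  | mul_X p μ hp =>
    obtain ⟨f', hf, hf'⟩ := hp
    let coord : Space n →L[ℝ] ℂ := Complex.ofRealCLM.comp (EuclideanSpace.proj μ)
    have eq_mul : (polyFun (p * MvPolynomial.X μ) : Space n → ℂ) = polyFun p * coord := by
      funext x; simp [polyFun, coord]
    refine ⟨_, eq_mul ▸ hf.mul coord.hasFDerivAt, fun v => ?_⟩
    rw [Derivation.leibniz, dirDeriv_X]
    simp [hf', coord, polyFun]

/-- Multiplication of Schwartz functions by the polynomial function `p`. -/
noncomputable def polyMul (p : MvPolynomial (Idx n) ℂ) : 𝓢(Space n, ℂ) →L[ℂ] 𝓢(Space n, ℂ) :=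
  smulLeftCLM ℂ (polyFun p)

@[simp]
theorem polyMul_apply (p : MvPolynomial (Idx n) ℂ) (a : 𝓢(Space n, ℂ)) (x : Space n) :
    polyMul p a x = polyFun p x * a x := by
  rw [polyMul, smulLeftCLM_apply_apply (polyFun_hasTemperateGrowth p), smul_eq_mul]

theorem coordMul_eq_polyMul (v : Space n) (a : 𝓢(Space n, ℂ)) :
    coordMul v a = polyMul (linForm v) a := by
  ext x
  rw [coordMul_apply, polyMul_apply, polyFun_linForm, Complex.real_smul]

theorem lineDerivOp_polyMul (p : MvPolynomial (Idx n) ℂ) (a : 𝓢(Space n, ℂ)) (v : Space n) :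
    ∂_{v} (polyMul p a) = polyMul (dirDeriv v p) a + polyMul p (∂_{v} a) := by
  ext x
  obtain ⟨f', hf, hf'⟩ := exists_hasFDerivAt_polyFun p x
  have eq_mul : ⇑(polyMul p a) = polyFun p * ⇑a := by
    funext x; simp
  rw [lineDerivOp_apply_eq_fderiv, eq_mul, (hf.mul (a.hasFDerivAt x)).fderiv]
  simp only [add_apply, smul_apply, smul_eq_mul, polyMul_apply, lineDerivOp_apply_eq_fderiv, hf']
  ring

theorem polyDist_apply (p : MvPolynomial (Idx n) ℂ) (a : 𝓢(Space n, ℂ)) :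
    polyDist p a = ∫ x, polyMul p a x := by
  simp [polyDist, mul_comm]

theorem polyDist_polyMul (p q : MvPolynomial (Idx n) ℂ) (a : 𝓢(Space n, ℂ)) :
    polyDist p (polyMul q a) = polyDist (q * p) a := by
  simp only [polyDist_apply, polyMul_apply, polyFun_mul]
  congr 1 with x
  ring

theorem polyDist_lineDerivOp (p : MvPolynomial (Idx n) ℂ) (a : 𝓢(Space n, ℂ)) (v : Space n) :
    polyDist p (∂_{v} a) = -polyDist (dirDeriv v p) a := by
  have integral_eq_zero := integral_lineDerivOp_eq_zero (polyMul p a) v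
  simp only [lineDerivOp_polyMul, add_apply] at integral_eq_zero
  rw [integral_add (integrable _) (integrable _), ← polyDist_apply, ← polyDist_apply]
    at integral_eq_zero
  exact eq_neg_of_add_eq_zero_right integral_eq_zero

/-- The linear map `p ↦ polyDist p`. -/
noncomputable def polyDistₗ (n : ℕ) : MvPolynomial (Idx n) ℂ →ₗ[ℂ] 𝓢'(Space n, ℂ) where
  toFun := polyDist
  map_add' p q := by
    refine DFunLike.ext _ _ fun a => ?_
    change _ = polyDist p a + polyDist q a
    simp only [polyDist_apply]
    rw [← integral_add (integrable _) (integrable _)]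
    simp [add_mul]
  map_smul' k p := by
    refine DFunLike.ext _ _ fun a => ?_
    change _ = k • polyDist p a
    simp only [polyDist_apply]
    rw [← integral_smul]
    simp [mul_assoc]

theorem polyDistₗ_apply (p : MvPolynomial (Idx n) ℂ) : polyDistₗ n p = polyDist p := rfl

theorem eq_zero_of_polyFun_eq_zero {p : MvPolynomial (Idx n) ℂ}
    (h : (polyFun p : Space n → ℂ) = 0) : p = 0 := by
  refine MvPolynomial.funext_set (fun _ => Set.range ((↑) : ℝ → ℂ))
    (fun _ => Set.infinite_range_of_injective Complex.ofReal_injective) fun x hx => ?_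
  choose y hy using fun μ => hx μ (Set.mem_univ μ)
  simpa [polyFun, hy] using congrFun h (WithLp.toLp 2 y)

theorem polyDist_injective : Function.Injective (polyDist (n := n)) := by
  refine (injective_iff_map_eq_zero (polyDistₗ n)).2 fun p hp => eq_zero_of_polyFun_eq_zero ?_
  exact eq_zero_of_forall_integral_schwartz_smul (μ := volume)
    (polyFun_hasTemperateGrowth p).1.continuous fun φ => DFunLike.congr_fun hp φ

end Polynomials

theorem coe_schwartz_apply_lineDerivOp {n : ℕ} (a b : 𝓢(Space n, ℂ)) (v : Space n) :
    (a : 𝓢'(Space n, ℂ)) (∂_{v} b) = -((∂_{v} a : 𝓢(Space n, ℂ)) : 𝓢'(Space n, ℂ)) b := by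
  rw [coe_schwartz_apply, coe_schwartz_apply]
  exact integral_mul_lineDerivOp_right_eq_neg_left a b v

/-! ### Polynomials in the Moyal algebra -/

section LinearForms

variable {n : ℕ} {θ : ℝ}

variable (n θ) in
/-- The operator `a ↦ ⟪·, v⟫ ⋆ a` on Schwartz functions. -/
noncomputable def linRight (v : Space n) : 𝓢(Space n, ℂ) →L[ℂ] 𝓢(Space n, ℂ) :=
  polyMul (linForm v) - (Complex.I / (2 * Real.pi)) • lineDerivOpCLM ℂ _ (piTheta n θ v)

variable (n θ) in
/-- The operator `a ↦ a ⋆ ⟪·, v⟫` on Schwartz functions. -/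
noncomputable def linLeft (v : Space n) : 𝓢(Space n, ℂ) →L[ℂ] 𝓢(Space n, ℂ) :=
  polyMul (linForm v) + (Complex.I / (2 * Real.pi)) • lineDerivOpCLM ℂ _ (piTheta n θ v)

theorem linRight_apply (v : Space n) (a : 𝓢(Space n, ℂ)) : linRight n θ v a =
    polyMul (linForm v) a - (Complex.I / (2 * Real.pi)) • ∂_{piTheta n θ v} a := rfl

theorem linLeft_apply (v : Space n) (a : 𝓢(Space n, ℂ)) : linLeft n θ v a =
    polyMul (linForm v) a + (Complex.I / (2 * Real.pi)) • ∂_{piTheta n θ v} a := rfl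

theorem polyDist_linRight (p : MvPolynomial (Idx n) ℂ) (v : Space n) (a : 𝓢(Space n, ℂ)) :
    polyDist p (linRight n θ v a) = polyDist (linForm v * p +
      (Complex.I / (2 * Real.pi)) • dirDeriv (piTheta n θ v) p) a := by
  rw [linRight_apply, map_sub, map_smul, polyDist_lineDerivOp, polyDist_polyMul,
    ← polyDistₗ_apply (_ + _), map_add, map_smul, smul_neg, sub_neg_eq_add]
  rfl

theorem polyDist_linLeft (p : MvPolynomial (Idx n) ℂ) (v : Space n) (a : 𝓢(Space n, ℂ)) :
    polyDist p (linLeft n θ v a) = polyDist (linForm v * p -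
      (Complex.I / (2 * Real.pi)) • dirDeriv (piTheta n θ v) p) a := by
  rw [linLeft_apply, map_add, map_smul, polyDist_lineDerivOp, polyDist_polyMul,
    ← polyDistₗ_apply (_ - _), map_sub, map_smul, smul_neg, ← sub_eq_add_neg]
  rfl

theorem polyDist_linForm (v : Space n) (a : 𝓢(Space n, ℂ)) :
    polyDist (linForm v) a = polyDist 1 (coordMul v a) := by
  rw [coordMul_eq_polyMul, polyDist_polyMul, mul_one]

variable [hθ : NeZero θ]

theorem polyDist_one_star (a b : 𝓢(Space n, ℂ)) :
    polyDist 1 (star n θ a b) = (a : 𝓢'(Space n, ℂ)) b := by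
  rw [polyDist_one_apply, integral_star, coe_schwartz_apply]

theorem starRightEq_linForm (v : Space n) (a : 𝓢(Space n, ℂ)) :
    StarRightEq n θ (polyDist (linForm v)) a (linRight n θ v a) := by
  intro b
  have coordMul_star := coordMul_twistedMul_left (piTheta_mem_skewAdjoint n θ) a b v
  simp only [← star_eq_twistedMul n hθ.out] at coordMul_star
  rw [polyDist_linForm, coordMul_star, map_add, map_smul, polyDist_one_star, polyDist_one_star,
    coe_schwartz_apply_lineDerivOp, linRight_apply, coordMul_eq_polyMul, smul_neg, ← sub_eq_add_neg]
  rw [coe_schwartz_apply_comm (_ - _), map_sub, map_smul, coe_schwartz_apply_comm b,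
    coe_schwartz_apply_comm b]

theorem starLeftEq_linForm (v : Space n) (a : 𝓢(Space n, ℂ)) :
    StarLeftEq n θ a (polyDist (linForm v)) (linLeft n θ v a) := by
  intro b
  have coordMul_star := coordMul_twistedMul_right (piTheta_mem_skewAdjoint n θ) b a v
  simp only [← star_eq_twistedMul n hθ.out] at coordMul_star
  rw [polyDist_linForm, coordMul_star, map_sub, map_smul, polyDist_one_star, polyDist_one_star,
    coe_schwartz_apply_comm _ a, coe_schwartz_apply_lineDerivOp, linLeft_apply,
    coordMul_eq_polyMul, smul_neg, sub_neg_eq_add]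
  rw [coe_schwartz_apply_comm (_ + _), map_add, map_smul, coe_schwartz_apply_comm (∂_{_} a)]

variable (n θ) in
/-- The linear form `⟪·, v⟫` as an element of the Moyal algebra. -/
noncomputable def lin (v : Space n) : Alg n θ :=
  ⟨polyDist (linForm v), fun a => ⟨_, starLeftEq_linForm v a⟩,
    fun a => ⟨_, starRightEq_linForm v a⟩⟩

theorem mul_lin_apply (T : Alg n θ) (v : Space n) (a : 𝓢(Space n, ℂ)) :
    ((T * lin n θ v : Alg n θ) : 𝓢'(Space n, ℂ)) a =
      (T : 𝓢'(Space n, ℂ)) (linRight n θ v a) := by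
  rw [mul_apply_schwartz, rightAct_eq (starRightEq_linForm v a)]

theorem linLeft_star (v : Space n) (a b : 𝓢(Space n, ℂ)) :
    linLeft n θ v (star n θ a b) = star n θ a (linLeft n θ v b) := by
  refine coe_schwartz_injective (DFunLike.ext _ _ fun c => ?_)
  rw [← starLeftEq_linForm (θ := θ) v (star n θ a b) c, ← star_assoc,
    starLeftEq_linForm (θ := θ) v b, coe_star_apply_right]

theorem lin_mul_apply_star (T : Alg n θ) (v : Space n) (a b : 𝓢(Space n, ℂ)) :
    ((lin n θ v * T : Alg n θ) : 𝓢'(Space n, ℂ)) (star n θ a b) =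
      (T : 𝓢'(Space n, ℂ)) (linLeft n θ v (star n θ a b)) := by
  rw [mul_apply_schwartz, rightAct_star, linLeft_star, starRightEq_rightAct T,
    coe_schwartz_apply_comm _ (linLeft n θ v b)]
  exact starLeftEq_linForm (θ := θ) v b (rightAct T a)

theorem lin_mul_apply (T : Alg n θ) (v : Space n) (a : 𝓢(Space n, ℂ)) :
    ((lin n θ v * T : Alg n θ) : 𝓢'(Space n, ℂ)) a =
      (T : 𝓢'(Space n, ℂ)) (linLeft n θ v a) := by
  obtain ⟨e, he⟩ := exists_tendsto_star n θ
  have tendsto_left := ((lin n θ v * T : Alg n θ) : 𝓢'(Space n, ℂ)).continuous.tendsto a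
  have tendsto_right :=
    ((T : 𝓢'(Space n, ℂ)).continuous.comp (linLeft n θ v).continuous).tendsto a
  exact tendsto_nhds_unique (tendsto_left.comp (he a))
    ((tendsto_right.comp (he a)).congr fun k => (lin_mul_apply_star T v a (e k)).symm)

end LinearForms

section Multipliers

variable {n : ℕ} {θ : ℝ}

theorem poly_one : poly θ (1 : MvPolynomial (Idx n) ℂ) = 1 := rfl

variable [hθ : NeZero θ]

theorem polyDist_linForm_mul_mem {p : MvPolynomial (Idx n) ℂ}
    (hp : polyDist p ∈ leftMultipliers n θ ⊓ rightMultipliers n θ) (v : Space n) :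
    polyDist (linForm v * p) ∈ leftMultipliers n θ ⊓ rightMultipliers n θ := by
  let T : Alg n θ := ⟨polyDist p, hp⟩
  let q := (Complex.I / (2 * Real.pi)) • dirDeriv (piTheta n θ v) p
  have mul_lin : ((T * lin n θ v : Alg n θ) : 𝓢'(Space n, ℂ)) = polyDistₗ n (linForm v * p + q) :=
    DFunLike.ext _ _ fun a => (mul_lin_apply T v a).trans (polyDist_linRight p v a)
  have lin_mul : ((lin n θ v * T : Alg n θ) : 𝓢'(Space n, ℂ)) = polyDistₗ n (linForm v * p - q) :=
    DFunLike.ext _ _ fun a => (lin_mul_apply T v a).trans (polyDist_linLeft p v a)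
  have average : polyDist (linForm v * p) =
      (1 / 2 : ℂ) • (((T * lin n θ v : Alg n θ) : 𝓢'(Space n, ℂ)) + (lin n θ v * T : Alg n θ)) := by
    rw [mul_lin, lin_mul, ← map_add, ← map_smul, ← polyDistₗ_apply]
    congr 1
    module
  rw [average]
  exact Submodule.smul_mem _ _ (add_mem (T * lin n θ v).2 (lin n θ v * T).2)

variable (θ) in
theorem polyDist_mem (p : MvPolynomial (Idx n) ℂ) :
    polyDist p ∈ leftMultipliers n θ ⊓ rightMultipliers n θ := by
  induction p using MvPolynomial.induction_on with
  | C c =>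
    have eq_smul : polyDist (MvPolynomial.C c) = c • ((1 : Alg n θ) : 𝓢'(Space n, ℂ)) := by
      rw [coe_one, ← polyDistₗ_apply 1, ← map_smul, MvPolynomial.smul_eq_C_mul, mul_one,
        polyDistₗ_apply]
    rw [eq_smul]
    exact Submodule.smul_mem _ c (1 : Alg n θ).2
  | add p q hp hq =>
    rw [← polyDistₗ_apply, map_add]
    exact add_mem hp hq
  | mul_X p μ hp =>
    rw [mul_comm, ← linForm_single]
    exact polyDist_linForm_mul_mem hp _

theorem coe_poly (p : MvPolynomial (Idx n) ℂ) :
    ((poly θ p : Alg n θ) : 𝓢'(Space n, ℂ)) = polyDist p := by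
  rw [poly, dif_pos (polyDist_mem θ p)]

variable (n θ) in
/-- The linear map `p ↦ poly θ p`. -/
noncomputable def polyₗ : MvPolynomial (Idx n) ℂ →ₗ[ℂ] Alg n θ where
  toFun := poly θ
  map_add' p q := Subtype.ext <| by
    simp only [Submodule.coe_add, coe_poly, ← polyDistₗ_apply, map_add]
  map_smul' k p := Subtype.ext <| by
    simp only [Submodule.coe_smul, coe_poly, ← polyDistₗ_apply, map_smul, RingHom.id_apply]

theorem polyₗ_apply (p : MvPolynomial (Idx n) ℂ) : polyₗ n θ p = poly θ p := rfl

theorem poly_add (p q : MvPolynomial (Idx n) ℂ) : poly θ (p + q) = poly θ p + poly θ q :=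
  map_add (polyₗ n θ) p q

theorem poly_sub (p q : MvPolynomial (Idx n) ℂ) : poly θ (p - q) = poly θ p - poly θ q :=
  map_sub (polyₗ n θ) p q

theorem poly_smul (k : ℂ) (p : MvPolynomial (Idx n) ℂ) : poly θ (k • p) = k • poly θ p :=
  map_smul (polyₗ n θ) k p

theorem poly_C (c : ℂ) : poly θ (MvPolynomial.C c : MvPolynomial (Idx n) ℂ) = c • 1 := by
  rw [← poly_one, ← poly_smul, MvPolynomial.smul_eq_C_mul, mul_one]

theorem poly_C_mul (c : ℂ) (p : MvPolynomial (Idx n) ℂ) :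
    poly θ (MvPolynomial.C c * p) = c • poly θ p := by
  rw [← MvPolynomial.smul_eq_C_mul, poly_smul]

theorem poly_injective : Function.Injective (poly (n := n) θ) := fun p q hpq =>
  polyDist_injective (by rw [← coe_poly (θ := θ), hpq, coe_poly])

theorem poly_linForm (v : Space n) : poly θ (linForm v) = lin n θ v :=
  Subtype.ext (coe_poly _)

theorem poly_mul_linForm (p : MvPolynomial (Idx n) ℂ) (v : Space n) :
    poly θ p * poly θ (linForm v) = poly θ (linForm v * p +
      (Complex.I / (2 * Real.pi)) • dirDeriv (piTheta n θ v) p) :=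
  alg_ext fun a => by
    rw [poly_linForm, mul_lin_apply, coe_poly, coe_poly, polyDist_linRight]

theorem linForm_mul_poly (p : MvPolynomial (Idx n) ℂ) (v : Space n) :
    poly θ (linForm v) * poly θ p = poly θ (linForm v * p -
      (Complex.I / (2 * Real.pi)) • dirDeriv (piTheta n θ v) p) :=
  alg_ext fun a => by
    rw [poly_linForm, lin_mul_apply, coe_poly, coe_poly, polyDist_linLeft]

end Multipliers

section Xi

variable {n : ℕ} {θ : ℝ}

variable (n θ) in
/-- The vector `v` with `ξ_μ = ⟪·, v⟫`, that is, minus the `μ`-th row of `Θ⁻¹`. -/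
noncomputable def xiVec (μ : Idx n) : Space n := WithLp.toLp 2 fun ν => -(Theta n θ)⁻¹ μ ν

theorem linForm_xiVec (μ : Idx n) : linForm (xiVec n θ μ) = xi n θ μ := by
  simp [linForm, xi, xiVec]

theorem pderiv_xi (μ ν : Idx n) : MvPolynomial.pderiv μ (xi n θ ν) =
    MvPolynomial.C (-((Theta n θ)⁻¹ ν μ : ℝ) : ℂ) := by
  rw [← linForm_xiVec, ← dirDeriv_single, dirDeriv_linForm, EuclideanSpace.inner_single_left]
  simp [xiVec]

theorem eval_zero_xi (μ : Idx n) : MvPolynomial.eval 0 (xi n θ μ) = 0 := by simp [xi]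

variable (θ) in
theorem totalDegree_xi_le (μ : Idx n) : (xi n θ μ).totalDegree ≤ 1 := by
  rw [xi, MvPolynomial.totalDegree_neg]
  refine MvPolynomial.totalDegree_finsetSum_le fun ν _ => ?_
  rw [← MvPolynomial.smul_eq_C_mul]
  exact (MvPolynomial.totalDegree_smul_le _ _).trans (MvPolynomial.totalDegree_X ν).le

theorem eta2_symm (μ ν : Idx n) : eta2 n θ μ ν = eta2 n θ ν μ := by
  rw [eta2, eta2, mul_comm (xi n θ μ)]

variable [hθ : NeZero θ]

theorem piTheta_xiVec (μ : Idx n) :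
    piTheta n θ (xiVec n θ μ) = Real.pi • EuclideanSpace.single μ (1 : ℝ) := by
  rw [piTheta, smul_apply]
  congr 1
  ext ν
  have mul_inv := congrFun (congrFun (Matrix.mul_nonsing_inv _ (isUnit_Theta_det n hθ.out)) ν) μ
  simp only [Matrix.mul_apply, Theta_inv_apply_swap n hθ.out μ, Matrix.one_apply] at mul_inv
  simpa [xiVec, Matrix.mulVec, dotProduct] using mul_inv

theorem smul_dirDeriv_piTheta_xiVec (μ : Idx n) (p : MvPolynomial (Idx n) ℂ) :
    (Complex.I / (2 * Real.pi)) • dirDeriv (piTheta n θ (xiVec n θ μ)) p =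
      (Complex.I / 2) • MvPolynomial.pderiv μ p := by
  have pi_ne_zero : (Real.pi : ℂ) ≠ 0 := Complex.ofReal_ne_zero.2 Real.pi_ne_zero
  rw [piTheta_xiVec, dirDeriv_smul, dirDeriv_single, Derivation.smul_apply, smul_smul,
    div_mul_eq_mul_div, mul_div_mul_right _ _ pi_ne_zero]

theorem poly_mul_xi (p : MvPolynomial (Idx n) ℂ) (μ : Idx n) :
    poly θ p * poly θ (xi n θ μ) =
      poly θ (xi n θ μ * p + (Complex.I / 2) • MvPolynomial.pderiv μ p) := by
  rw [← linForm_xiVec, poly_mul_linForm, smul_dirDeriv_piTheta_xiVec]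

theorem xi_mul_poly (p : MvPolynomial (Idx n) ℂ) (μ : Idx n) :
    poly θ (xi n θ μ) * poly θ p =
      poly θ (xi n θ μ * p - (Complex.I / 2) • MvPolynomial.pderiv μ p) := by
  rw [← linForm_xiVec, linForm_mul_poly, smul_dirDeriv_piTheta_xiVec]

theorem eta1_eq (μ : Idx n) : eta1 n θ μ = Complex.I • poly θ (xi n θ μ) := poly_C_mul _ _

theorem eta2_eq (μ ν : Idx n) : eta2 n θ μ ν =
    Complex.I • (poly θ (xi n θ μ) * poly θ (xi n θ ν)) -
      (((Theta n θ)⁻¹ μ ν : ℝ) / 2 : ℂ) • 1 := by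
  rw [eta2, poly_C_mul, xi_mul_poly, pderiv_xi, Theta_inv_apply_swap n hθ.out μ ν, poly_sub,
    poly_smul _ (MvPolynomial.C _), poly_C]
  match_scalars
  · ring
  · linear_combination (((Theta n θ)⁻¹ μ ν : ℝ) / 2 : ℂ) * Complex.I_sq

end Xi

/-! ### The derivations of degree at most two -/

theorem eq_C_of_forall_pderiv_eq_zero {σ R : Type*} [CommRing R] [IsDomain R] [CharZero R]
    {p : MvPolynomial σ R} (h : ∀ i, MvPolynomial.pderiv i p = 0) :
    p = MvPolynomial.C (MvPolynomial.eval 0 p) := by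
  classical
  ext m
  rw [MvPolynomial.coeff_C]
  split_ifs with hm
  · subst hm
    simp [MvPolynomial.eval_zero, MvPolynomial.constantCoeff_eq]
  · obtain ⟨i, hi⟩ := Finsupp.ne_iff.1 (Ne.symm hm)
    have sub_add : m - Finsupp.single i 1 + Finsupp.single i 1 = m :=
      tsub_add_cancel_of_le (Finsupp.single_le_iff.2 (Nat.one_le_iff_ne_zero.2 hi))
    have coeff_eq_zero := congrArg (MvPolynomial.coeff (m - Finsupp.single i 1)) (h i)
    rw [MvPolynomial.coeff_pderiv, sub_add, MvPolynomial.coeff_zero] at coeff_eq_zero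
    exact (mul_eq_zero.1 coeff_eq_zero).resolve_right (Nat.cast_add_one_ne_zero _)

theorem mem_of_totalDegree_le_two {σ R : Type*} [CommSemiring R]
    {S : Submodule R (MvPolynomial σ R)} (one_mem : 1 ∈ S) (X_mem : ∀ i, MvPolynomial.X i ∈ S)
    (X_mul_X_mem : ∀ i j, MvPolynomial.X i * MvPolynomial.X j ∈ S) {p : MvPolynomial σ R}
    (hp : p.totalDegree ≤ 2) : p ∈ S := by
  have eq_add_single : ∀ m : σ →₀ ℕ, m ≠ 0 → ∃ i m', m = m' + Finsupp.single i 1 := by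
    intro m hm
    obtain ⟨i, hi⟩ := Finsupp.ne_iff.1 hm
    exact ⟨i, m - Finsupp.single i 1, (tsub_add_cancel_of_le
      (Finsupp.single_le_iff.2 (Nat.one_le_iff_ne_zero.2 hi))).symm⟩
  rw [p.as_sum]
  refine sum_mem fun m hm => ?_
  have degree_le : m.degree ≤ 2 := (MvPolynomial.le_totalDegree hm).trans hp
  rw [← mul_one (MvPolynomial.coeff m p), ← smul_eq_mul, ← MvPolynomial.smul_monomial]
  refine Submodule.smul_mem _ _ ?_
  obtain rfl | hm0 := eq_or_ne m 0
  · exact one_mem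
  obtain ⟨i, m', rfl⟩ := eq_add_single m hm0
  rw [← mul_one (1 : R), ← MvPolynomial.monomial_mul]
  obtain rfl | hm' := eq_or_ne m' 0
  · rw [← MvPolynomial.one_def, one_mul]
    exact X_mem i
  obtain ⟨j, m'', rfl⟩ := eq_add_single m' hm'
  simp only [map_add, Finsupp.degree_single] at degree_le
  have m''_eq_zero : m'' = 0 := (Finsupp.degree_eq_zero_iff m'').1 (by lia)
  rw [m''_eq_zero, zero_add]
  exact X_mul_X_mem j i

section Bracket

variable {n : ℕ} {θ : ℝ}

theorem comm_swap (a b : Alg n θ) : comm b a = -comm a b := by simp [comm]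

variable [hθ : NeZero θ]

variable (n θ) in
/-- The Moyal bracket as a bilinear map. -/
noncomputable def commₗ : Alg n θ →ₗ[ℂ] Alg n θ →ₗ[ℂ] Alg n θ :=
  LinearMap.mul ℂ (Alg n θ) - (LinearMap.mul ℂ (Alg n θ)).flip

theorem comm_add_left (a b c : Alg n θ) : comm (a + b) c = comm a c + comm b c :=
  (commₗ n θ).map_add₂ a b c

theorem comm_sub_left (a b c : Alg n θ) : comm (a - b) c = comm a c - comm b c :=
  (commₗ n θ).map_sub₂ a b c

theorem comm_smul_left (k : ℂ) (a b : Alg n θ) : comm (k • a) b = k • comm a b :=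
  (commₗ n θ).map_smul₂ k a b

theorem comm_add_right (a b c : Alg n θ) : comm a (b + c) = comm a b + comm a c :=
  map_add (commₗ n θ a) b c

theorem comm_sub_right (a b c : Alg n θ) : comm a (b - c) = comm a b - comm a c :=
  map_sub (commₗ n θ a) b c

theorem comm_smul_right (k : ℂ) (a b : Alg n θ) : comm a (k • b) = k • comm a b :=
  map_smul (commₗ n θ a) k b

theorem comm_one_left (a : Alg n θ) : comm 1 a = 0 := by simp [comm]

theorem comm_one_right (a : Alg n θ) : comm a 1 = 0 := by simp [comm]

theorem comm_mul_right (a b c : Alg n θ) : comm a (b * c) = comm a b * c + b * comm a c := by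
  simp only [comm]; noncomm_ring

theorem comm_jacobi (a b c : Alg n θ) :
    comm (comm a b) c = comm a (comm b c) - comm b (comm a c) := by
  simp only [comm]; noncomm_ring

theorem bracket_Ad (P Q : Alg n θ) : bracket (Ad P) (Ad Q) = Ad (comm P Q) := by
  funext a
  exact (comm_jacobi P Q a).symm

theorem isDerivation_Ad (P : Alg n θ) : IsDerivation (Ad P) where
  map_add := comm_add_right P
  map_smul k a := comm_smul_right k P a
  leibniz := comm_mul_right P

theorem comm_poly_xi (p : MvPolynomial (Idx n) ℂ) (μ : Idx n) :
    comm (poly θ p) (poly θ (xi n θ μ)) = Complex.I • poly θ (MvPolynomial.pderiv μ p) := by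
  rw [comm, poly_mul_xi, xi_mul_poly, ← poly_sub, ← poly_smul, add_sub_sub_cancel, ← add_smul,
    add_halves]

theorem comm_xi_xi (μ ν : Idx n) : comm (poly θ (xi n θ μ)) (poly θ (xi n θ ν)) =
    (-(Complex.I * ((Theta n θ)⁻¹ μ ν : ℝ))) • 1 := by
  rw [comm_poly_xi, pderiv_xi, poly_C, smul_smul, mul_neg]

theorem comm_eta1_eta1 (μ ν : Idx n) : comm (eta1 n θ μ) (eta1 n θ ν) =
    (Complex.I * (((Theta n θ)⁻¹ μ ν : ℝ) : ℂ)) • 1 := by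
  rw [eta1_eq, eta1_eq, comm_smul_left, comm_smul_right, comm_xi_xi, smul_smul, smul_smul]
  congr 1
  linear_combination -Complex.I * ((Theta n θ)⁻¹ μ ν : ℝ) * Complex.I_sq

theorem comm_eta2_xi (μ ν ρ : Idx n) : comm (eta2 n θ μ ν) (poly θ (xi n θ ρ)) =
    (((Theta n θ)⁻¹ ν ρ : ℝ) : ℂ) • poly θ (xi n θ μ) +
      (((Theta n θ)⁻¹ μ ρ : ℝ) : ℂ) • poly θ (xi n θ ν) := by
  rw [eta2, comm_poly_xi, MvPolynomial.pderiv_C_mul, Derivation.leibniz, pderiv_xi, pderiv_xi,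
    smul_eq_mul, smul_eq_mul, mul_comm (xi n θ μ), mul_comm (xi n θ ν), poly_C_mul, poly_add,
    poly_C_mul, poly_C_mul]
  match_scalars <;> linear_combination -(((Theta n θ)⁻¹ _ ρ : ℝ) : ℂ) * Complex.I_sq

theorem comm_eta1_eta2 (μ ρ σ : Idx n) : comm (eta1 n θ μ) (eta2 n θ ρ σ) =
    (((Theta n θ)⁻¹ μ ρ : ℝ) : ℂ) • eta1 n θ σ + (((Theta n θ)⁻¹ μ σ : ℝ) : ℂ) • eta1 n θ ρ := by
  simp only [comm_swap (eta2 n θ ρ σ), eta1_eq, comm_smul_right, comm_eta2_xi,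
    Theta_inv_apply_swap n hθ.out μ, Complex.ofReal_neg]
  module

theorem comm_eta2_eta2 (μ ν ρ σ : Idx n) : comm (eta2 n θ μ ν) (eta2 n θ ρ σ) =
    -((((Theta n θ)⁻¹ ρ ν : ℝ) : ℂ) • eta2 n θ μ σ + (((Theta n θ)⁻¹ σ ν : ℝ) : ℂ) • eta2 n θ μ ρ +
      (((Theta n θ)⁻¹ ρ μ : ℝ) : ℂ) • eta2 n θ ν σ +
      (((Theta n θ)⁻¹ σ μ : ℝ) : ℂ) • eta2 n θ ν ρ) := by
  rw [eta2_eq ρ σ, comm_sub_right, comm_smul_right, comm_smul_right, comm_one_right, smul_zero,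
    sub_zero, comm_mul_right, comm_eta2_xi, comm_eta2_xi, eta2_symm μ ρ, eta2_symm ν ρ]
  simp only [eta2_eq, Theta_inv_apply_swap n hθ.out ν, Theta_inv_apply_swap n hθ.out μ,
    add_mul, mul_add, smul_mul_assoc, mul_smul_comm, Complex.ofReal_neg]
  module

end Bracket

section Derivations

variable {n : ℕ} {θ : ℝ} [hθ : NeZero θ]

theorem mem_G2_iff {X : Alg n θ → Alg n θ} : X ∈ G2 n θ ↔
    ∃ p : MvPolynomial (Idx n) ℂ, p.totalDegree ≤ 2 ∧ X = Ad (poly θ p) := by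
  refine ⟨fun h => h.2, fun h => ⟨?_, h⟩⟩
  obtain ⟨p, -, rfl⟩ := h
  exact isDerivation_Ad _

theorem Ad_poly_sub_C (p : MvPolynomial (Idx n) ℂ) (c : ℂ) :
    Ad (poly θ (p - MvPolynomial.C c)) = Ad (poly θ p) := by
  funext a
  rw [Ad, Ad, poly_sub, poly_C, comm_sub_left, comm_smul_left, comm_one_left, smul_zero, sub_zero]

theorem sub_C_eq_of_comm_eq {p q : MvPolynomial (Idx n) ℂ}
    (h : ∀ μ, comm (poly θ p) (poly θ (xi n θ μ)) = comm (poly θ q) (poly θ (xi n θ μ))) :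
    p - MvPolynomial.C (MvPolynomial.eval 0 p) = q - MvPolynomial.C (MvPolynomial.eval 0 q) := by
  have pderiv_eq : ∀ μ, MvPolynomial.pderiv μ p = MvPolynomial.pderiv μ q := fun μ => by
    have comm_eq := h μ
    rw [comm_poly_xi, comm_poly_xi] at comm_eq
    exact poly_injective (smul_right_injective (Alg n θ) Complex.I_ne_zero comm_eq)
  have sub_eq_C := eq_C_of_forall_pderiv_eq_zero (p := p - q) fun μ => by
    rw [map_sub, pderiv_eq μ, sub_self]
  rw [map_sub, map_sub] at sub_eq_C
  linear_combination sub_eq_C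

theorem eta_Ad_poly {p : MvPolynomial (Idx n) ℂ} (hp : p.totalDegree ≤ 2) :
    eta (Ad (poly θ p)) = poly θ (p - MvPolynomial.C (MvPolynomial.eval 0 p)) := by
  have exists_poly : ∃ q : MvPolynomial (Idx n) ℂ, q.totalDegree ≤ 2 ∧
      Ad (poly θ p) = Ad (poly θ q) := ⟨p, hp, rfl⟩
  rw [eta, dif_pos exists_poly]
  exact congrArg (poly θ) (sub_C_eq_of_comm_eq fun μ =>
    congrFun exists_poly.choose_spec.2.symm _)

theorem Ad_eta {X : Alg n θ → Alg n θ} (hX : X ∈ G2 n θ) : Ad (eta X) = X := by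
  obtain ⟨p, hp, rfl⟩ := mem_G2_iff.1 hX
  rw [eta_Ad_poly hp, Ad_poly_sub_C]

variable (n θ) in
/-- The linear map `p ↦ Ad_p` on polynomials. -/
noncomputable def adPolyₗ : MvPolynomial (Idx n) ℂ →ₗ[ℂ] (Alg n θ → Alg n θ) where
  toFun p := Ad (poly θ p)
  map_add' p q := by
    funext a
    rw [poly_add]
    exact comm_add_left _ _ _
  map_smul' k p := by
    funext a
    rw [poly_smul]
    exact comm_smul_left _ _ _

theorem adPolyₗ_apply (p : MvPolynomial (Idx n) ℂ) : adPolyₗ n θ p = Ad (poly θ p) := rfl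

variable (n θ) in
/-- The linear map `p ↦ p - p(0)` from polynomials to the Moyal algebra, which `η` induces on
`𝓖₂`. -/
noncomputable def etaPolyₗ : MvPolynomial (Idx n) ℂ →ₗ[ℂ] Alg n θ :=
  polyₗ n θ ∘ₗ (LinearMap.id -
    Algebra.linearMap ℂ (MvPolynomial (Idx n) ℂ) ∘ₗ (MvPolynomial.aeval 0).toLinearMap)

theorem etaPolyₗ_apply (p : MvPolynomial (Idx n) ℂ) :
    etaPolyₗ n θ p = poly θ (p - MvPolynomial.C (MvPolynomial.eval 0 p)) := rfl

theorem eta_adPolyₗ {p : MvPolynomial (Idx n) ℂ} (hp : p.totalDegree ≤ 2) :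
    eta (adPolyₗ n θ p) = etaPolyₗ n θ p := eta_Ad_poly hp

theorem eta_add {X Y : Alg n θ → Alg n θ} (hX : X ∈ G2 n θ) (hY : Y ∈ G2 n θ) :
    eta (X + Y) = eta X + eta Y := by
  obtain ⟨p, hp, rfl⟩ := mem_G2_iff.1 hX
  obtain ⟨q, hq, rfl⟩ := mem_G2_iff.1 hY
  rw [← adPolyₗ_apply, ← adPolyₗ_apply, ← map_add, eta_adPolyₗ hp, eta_adPolyₗ hq,
    eta_adPolyₗ ((MvPolynomial.totalDegree_add p q).trans (max_le hp hq)), map_add]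

theorem eta_smul (k : ℂ) {X : Alg n θ → Alg n θ} (hX : X ∈ G2 n θ) :
    eta (k • X) = k • eta X := by
  obtain ⟨p, hp, rfl⟩ := mem_G2_iff.1 hX
  rw [← adPolyₗ_apply, ← map_smul, eta_adPolyₗ hp,
    eta_adPolyₗ ((MvPolynomial.totalDegree_smul_le k p).trans hp), map_smul]

end Derivations

section Span

variable {n : ℕ} {θ : ℝ}

theorem totalDegree_C_mul_xi_le (c : ℂ) (μ : Idx n) :
    (MvPolynomial.C c * xi n θ μ).totalDegree ≤ 2 := by
  rw [← MvPolynomial.smul_eq_C_mul]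
  exact (MvPolynomial.totalDegree_smul_le _ _).trans ((totalDegree_xi_le θ μ).trans one_le_two)

theorem totalDegree_C_mul_xi_mul_xi_le (c : ℂ) (μ ν : Idx n) :
    (MvPolynomial.C c * (xi n θ μ * xi n θ ν)).totalDegree ≤ 2 := by
  rw [← MvPolynomial.smul_eq_C_mul]
  exact (MvPolynomial.totalDegree_smul_le _ _).trans ((MvPolynomial.totalDegree_mul _ _).trans
    (add_le_add (totalDegree_xi_le θ μ) (totalDegree_xi_le θ ν)))

variable [hθ : NeZero θ]

variable (θ) in
theorem X_mem_span_xi (μ : Idx n) :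
    (MvPolynomial.X μ : MvPolynomial (Idx n) ℂ) ∈ Submodule.span ℂ (Set.range (xi n θ)) := by
  have coeff_eq (κ : Idx n) : ∑ ν, ((Theta n θ μ ν : ℝ) : ℂ) * (((Theta n θ)⁻¹ ν κ : ℝ) : ℂ) =
      (((1 : Matrix (Idx n) (Idx n) ℝ) μ κ : ℝ) : ℂ) := by
    rw [← Matrix.mul_nonsing_inv _ (isUnit_Theta_det n hθ.out), Matrix.mul_apply]
    push_cast
    rfl
  have X_eq : (MvPolynomial.X μ : MvPolynomial (Idx n) ℂ) =
      ∑ ν, (-(Theta n θ μ ν : ℝ) : ℂ) • xi n θ ν := by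
    simp only [xi, ← MvPolynomial.smul_eq_C_mul, smul_neg, Finset.sum_neg_distrib,
      Finset.smul_sum, smul_smul]
    rw [Finset.sum_comm]
    simp [← Finset.sum_smul, coeff_eq, Matrix.one_apply, ite_smul]
  rw [X_eq]
  exact sum_mem fun ν _ => Submodule.smul_mem _ _ (Submodule.subset_span ⟨ν, rfl⟩)

variable (n θ) in
theorem restrictTotalDegree_two_eq_span : MvPolynomial.restrictTotalDegree (Idx n) ℂ 2 =
    Submodule.span ℂ (insert 1 (Set.range (fun μ => MvPolynomial.C Complex.I * xi n θ μ) ∪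
      Set.range (fun q : Idx n × Idx n =>
        MvPolynomial.C Complex.I * (xi n θ q.1 * xi n θ q.2)))) := by
  apply le_antisymm
  · intro p hp
    refine mem_of_totalDegree_le_two (Submodule.subset_span (Or.inl rfl)) (fun μ => ?_)
      (fun μ ν => ?_) ((MvPolynomial.mem_restrictTotalDegree _ _ _).1 hp)
    · refine Submodule.span_le.2 ?_ (X_mem_span_xi θ μ)
      rintro _ ⟨ρ, rfl⟩
      rw [SetLike.mem_coe, ← Submodule.smul_mem_iff _ Complex.I_ne_zero,
        MvPolynomial.smul_eq_C_mul]
      exact Submodule.subset_span (Or.inr (Or.inl ⟨ρ, rfl⟩))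
    · have X_mul_X_mem := Submodule.mul_mem_mul (X_mem_span_xi θ μ) (X_mem_span_xi θ ν)
      rw [Submodule.span_mul_span] at X_mul_X_mem
      refine Submodule.span_le.2 ?_ X_mul_X_mem
      rintro _ ⟨_, ⟨ρ, rfl⟩, _, ⟨σ, rfl⟩, rfl⟩
      rw [SetLike.mem_coe, ← Submodule.smul_mem_iff _ Complex.I_ne_zero,
        MvPolynomial.smul_eq_C_mul]
      exact Submodule.subset_span (Or.inr (Or.inr ⟨(ρ, σ), rfl⟩))
  · rw [Submodule.span_le]
    rintro _ (rfl | ⟨μ, rfl⟩ | ⟨q, rfl⟩) <;>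
      rw [SetLike.mem_coe, MvPolynomial.mem_restrictTotalDegree]
    · exact MvPolynomial.totalDegree_one.trans_le zero_le_two
    · exact totalDegree_C_mul_xi_le _ μ
    · exact totalDegree_C_mul_xi_mul_xi_le _ q.1 q.2

theorem map_restrictTotalDegree_two {M : Type*} [AddCommGroup M] [Module ℂ M]
    (L : MvPolynomial (Idx n) ℂ →ₗ[ℂ] M) (map_one_eq_zero : L 1 = 0) :
    (MvPolynomial.restrictTotalDegree (Idx n) ℂ 2).map L =
      Submodule.span ℂ (Set.range (fun μ => L (MvPolynomial.C Complex.I * xi n θ μ)) ∪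
        Set.range (fun q : Idx n × Idx n =>
          L (MvPolynomial.C Complex.I * (xi n θ q.1 * xi n θ q.2)))) := by
  rw [restrictTotalDegree_two_eq_span n θ, Submodule.map_span, Set.image_insert_eq,
    map_one_eq_zero, Submodule.span_insert_zero, Set.image_union, ← Set.range_comp,
    ← Set.range_comp]
  rfl

theorem coe_map_restrictTotalDegree {σ R M : Type*} [CommSemiring R] [AddCommMonoid M]
    [Module R M] (L : MvPolynomial σ R →ₗ[R] M) (d : ℕ) :
    ((MvPolynomial.restrictTotalDegree σ R d).map L : Set M) =
      {y | ∃ p : MvPolynomial σ R, p.totalDegree ≤ d ∧ L p = y} := by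
  ext y
  simp only [Submodule.map_coe, Set.mem_image, SetLike.mem_coe,
    MvPolynomial.mem_restrictTotalDegree, Set.mem_ofPred_eq]

variable (n θ) in
theorem G2_eq_span : G2 n θ = (Submodule.span ℂ (Set.range (D1 n θ) ∪
    Set.range (fun q : Idx n × Idx n => D2 n θ q.1 q.2)) : Set (Alg n θ → Alg n θ)) := by
  have adPolyₗ_one : adPolyₗ n θ 1 = 0 := by
    funext a
    exact comm_one_left a
  refine Eq.trans ?_ (SetLike.coe_set_eq.2
    (map_restrictTotalDegree_two (θ := θ) (adPolyₗ n θ) adPolyₗ_one))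
  rw [coe_map_restrictTotalDegree]
  ext X
  rw [mem_G2_iff]
  exact exists_congr fun p => and_congr_right fun _ => eq_comm

theorem etaPolyₗ_C_mul_xi (c : ℂ) (μ : Idx n) :
    etaPolyₗ n θ (MvPolynomial.C c * xi n θ μ) = poly θ (MvPolynomial.C c * xi n θ μ) := by
  rw [etaPolyₗ_apply, map_mul, eval_zero_xi, mul_zero, map_zero, sub_zero]

theorem etaPolyₗ_C_mul_xi_mul_xi (c : ℂ) (μ ν : Idx n) :
    etaPolyₗ n θ (MvPolynomial.C c * (xi n θ μ * xi n θ ν)) =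
      poly θ (MvPolynomial.C c * (xi n θ μ * xi n θ ν)) := by
  rw [etaPolyₗ_apply, map_mul, map_mul (MvPolynomial.eval 0), eval_zero_xi, zero_mul, mul_zero,
    map_zero, sub_zero]

variable (n θ) in
theorem eta_image_G2_eq_span : eta '' G2 n θ = (Submodule.span ℂ (Set.range (eta1 n θ) ∪
    Set.range (fun q : Idx n × Idx n => eta2 n θ q.1 q.2)) : Set (Alg n θ)) := by
  have etaPolyₗ_one : etaPolyₗ n θ 1 = 0 := by
    rw [etaPolyₗ_apply, map_one, map_one, sub_self, ← polyₗ_apply, map_zero]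
  have map_eq_span := map_restrictTotalDegree_two (θ := θ) (etaPolyₗ n θ) etaPolyₗ_one
  simp only [etaPolyₗ_C_mul_xi, etaPolyₗ_C_mul_xi_mul_xi] at map_eq_span
  refine Eq.trans ?_ (SetLike.coe_set_eq.2 map_eq_span)
  rw [coe_map_restrictTotalDegree]
  ext T
  constructor
  · rintro ⟨X, hX, rfl⟩
    obtain ⟨p, hp, rfl⟩ := mem_G2_iff.1 hX
    exact ⟨p, hp, (eta_Ad_poly hp).symm⟩
  · rintro ⟨p, hp, rfl⟩
    exact ⟨_, mem_G2_iff.2 ⟨p, hp, rfl⟩, eta_Ad_poly hp⟩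

variable (n θ) in
/-- The polynomial functions of degree at most `2`, as a subspace of the Moyal algebra. -/
noncomputable def quadratic : Submodule ℂ (Alg n θ) :=
  (MvPolynomial.restrictTotalDegree (Idx n) ℂ 2).map (polyₗ n θ)

theorem mem_quadratic_iff {a : Alg n θ} : a ∈ quadratic n θ ↔
    ∃ p : MvPolynomial (Idx n) ℂ, p.totalDegree ≤ 2 ∧ poly θ p = a := by
  rw [quadratic, ← SetLike.mem_coe, coe_map_restrictTotalDegree]
  rfl

variable (n θ) in
theorem quadratic_eq_span : quadratic n θ = Submodule.span ℂ (insert 1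
    (Set.range (eta1 n θ) ∪ Set.range (fun q : Idx n × Idx n => eta2 n θ q.1 q.2))) := by
  rw [quadratic, restrictTotalDegree_two_eq_span n θ, Submodule.map_span, Set.image_insert_eq,
    Set.image_union, ← Set.range_comp, ← Set.range_comp]
  rfl

variable (n θ) in
theorem one_mem_quadratic : 1 ∈ quadratic n θ :=
  mem_quadratic_iff.2 ⟨1, MvPolynomial.totalDegree_one.trans_le zero_le_two, poly_one⟩

theorem eta1_mem_quadratic (μ : Idx n) : eta1 n θ μ ∈ quadratic n θ :=
  mem_quadratic_iff.2 ⟨_, totalDegree_C_mul_xi_le _ μ, rfl⟩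

theorem eta2_mem_quadratic (μ ν : Idx n) : eta2 n θ μ ν ∈ quadratic n θ :=
  mem_quadratic_iff.2 ⟨_, totalDegree_C_mul_xi_mul_xi_le _ μ ν, rfl⟩

theorem comm_eta1_eta2_mem_quadratic (μ ρ σ : Idx n) :
    comm (eta1 n θ μ) (eta2 n θ ρ σ) ∈ quadratic n θ := by
  rw [comm_eta1_eta2]
  exact add_mem (Submodule.smul_mem _ _ (eta1_mem_quadratic σ))
    (Submodule.smul_mem _ _ (eta1_mem_quadratic ρ))

theorem comm_eta2_eta2_mem_quadratic (μ ν ρ σ : Idx n) :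
    comm (eta2 n θ μ ν) (eta2 n θ ρ σ) ∈ quadratic n θ := by
  rw [comm_eta2_eta2]
  exact neg_mem (add_mem (add_mem (add_mem (Submodule.smul_mem _ _ (eta2_mem_quadratic _ _))
    (Submodule.smul_mem _ _ (eta2_mem_quadratic _ _)))
    (Submodule.smul_mem _ _ (eta2_mem_quadratic _ _)))
    (Submodule.smul_mem _ _ (eta2_mem_quadratic _ _)))

theorem comm_mem_quadratic {a b : Alg n θ} (ha : a ∈ quadratic n θ) (hb : b ∈ quadratic n θ) :
    comm a b ∈ quadratic n θ := by
  suffices map₂_le : Submodule.map₂ (commₗ n θ) (quadratic n θ) (quadratic n θ) ≤ quadratic n θ from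
    map₂_le (Submodule.apply_mem_map₂ (commₗ n θ) ha hb)
  nth_rewrite 1 [quadratic_eq_span]
  nth_rewrite 1 [quadratic_eq_span]
  rw [Submodule.map₂_span_span, Submodule.span_le]
  rintro _ ⟨a, ha, b, hb, rfl⟩
  change comm a b ∈ quadratic n θ
  obtain rfl | ha := ha
  · rw [comm_one_left]
    exact zero_mem _
  obtain rfl | hb := hb
  · rw [comm_one_right]
    exact zero_mem _
  obtain ⟨μ, rfl⟩ | ⟨q, rfl⟩ := ha <;> obtain ⟨ν, rfl⟩ | ⟨r, rfl⟩ := hb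
  · rw [comm_eta1_eta1]
    exact Submodule.smul_mem _ _ (one_mem_quadratic n θ)
  · exact comm_eta1_eta2_mem_quadratic μ r.1 r.2
  · rw [comm_swap]
    exact neg_mem (comm_eta1_eta2_mem_quadratic ν q.1 q.2)
  · exact comm_eta2_eta2_mem_quadratic q.1 q.2 r.1 r.2

theorem bracket_mem_G2 {X Y : Alg n θ → Alg n θ} (hX : X ∈ G2 n θ) (hY : Y ∈ G2 n θ) :
    bracket X Y ∈ G2 n θ := by
  obtain ⟨p, hp, rfl⟩ := mem_G2_iff.1 hX
  obtain ⟨q, hq, rfl⟩ := mem_G2_iff.1 hY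
  obtain ⟨r, hr, poly_eq⟩ := mem_quadratic_iff.1 (comm_mem_quadratic (θ := θ)
    (mem_quadratic_iff.2 ⟨p, hp, rfl⟩) (mem_quadratic_iff.2 ⟨q, hq, rfl⟩))
  exact mem_G2_iff.2 ⟨r, hr, by rw [bracket_Ad, poly_eq]⟩

theorem D1_mem_G2 (μ : Idx n) : D1 n θ μ ∈ G2 n θ :=
  mem_G2_iff.2 ⟨_, totalDegree_C_mul_xi_le _ μ, rfl⟩

theorem D2_mem_G2 (μ ν : Idx n) : D2 n θ μ ν ∈ G2 n θ :=
  mem_G2_iff.2 ⟨_, totalDegree_C_mul_xi_mul_xi_le _ μ ν, rfl⟩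

variable (n θ) in
theorem zero_mem_G2 : (0 : Alg n θ → Alg n θ) ∈ G2 n θ := by
  rw [G2_eq_span]
  exact Submodule.zero_mem _

theorem smul_mem_G2 (k : ℂ) {X : Alg n θ → Alg n θ} (hX : X ∈ G2 n θ) : k • X ∈ G2 n θ := by
  rw [G2_eq_span] at hX ⊢
  exact Submodule.smul_mem _ k hX

theorem add_mem_G2 {X Y : Alg n θ → Alg n θ} (hX : X ∈ G2 n θ) (hY : Y ∈ G2 n θ) :
    X + Y ∈ G2 n θ := by
  rw [G2_eq_span] at hX hY ⊢
  exact Submodule.add_mem _ hX hY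

theorem eta_D1 (μ : Idx n) : eta (D1 n θ μ) = eta1 n θ μ :=
  (eta_Ad_poly (totalDegree_C_mul_xi_le _ μ)).trans (etaPolyₗ_C_mul_xi _ μ)

theorem eta_D2 (μ ν : Idx n) : eta (D2 n θ μ ν) = eta2 n θ μ ν :=
  (eta_Ad_poly (totalDegree_C_mul_xi_mul_xi_le _ μ ν)).trans (etaPolyₗ_C_mul_xi_mul_xi _ μ ν)

variable (n θ) in
theorem eta_zero : eta (0 : Alg n θ → Alg n θ) = 0 := by
  simpa using eta_smul 0 (zero_mem_G2 n θ)

theorem bracket_D1_D1 (μ ν : Idx n) : bracket (D1 n θ μ) (D1 n θ ν) = 0 := by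
  funext a
  rw [D1, D1, bracket_Ad, comm_eta1_eta1, Ad, comm_smul_left, comm_one_left, smul_zero]
  rfl

theorem bracket_D1_D2 (μ ρ σ : Idx n) : bracket (D1 n θ μ) (D2 n θ ρ σ) =
    (((Theta n θ)⁻¹ μ ρ : ℝ) : ℂ) • D1 n θ σ + (((Theta n θ)⁻¹ μ σ : ℝ) : ℂ) • D1 n θ ρ := by
  funext a
  rw [D1, D2, bracket_Ad, comm_eta1_eta2, Ad, comm_add_left, comm_smul_left, comm_smul_left]
  rfl

theorem bracket_D2_D2 (μ ν ρ σ : Idx n) : bracket (D2 n θ μ ν) (D2 n θ ρ σ) =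
    (-1 : ℂ) • ((((Theta n θ)⁻¹ ρ ν : ℝ) : ℂ) • D2 n θ μ σ +
      (((Theta n θ)⁻¹ σ ν : ℝ) : ℂ) • D2 n θ μ ρ + (((Theta n θ)⁻¹ ρ μ : ℝ) : ℂ) • D2 n θ ν σ +
      (((Theta n θ)⁻¹ σ μ : ℝ) : ℂ) • D2 n θ ν ρ) := by
  funext a
  rw [D2, D2, bracket_Ad, comm_eta2_eta2, Ad, ← neg_one_smul ℂ, comm_smul_left]
  simp only [comm_add_left, comm_smul_left]
  rfl

end Span

section Connections

variable {n : ℕ} {θ : ℝ} [hθ : NeZero θ]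

theorem canonical_eq {X : Alg n θ → Alg n θ} (hX : X ∈ G2 n θ) (m : Alg n θ) :
    canonical X m = -(m * eta X) := by
  rw [canonical, ← congrFun (Ad_eta hX) m, Ad, comm]
  abel

theorem covCoord_canonical {X : Alg n θ → Alg n θ} (hX : X ∈ G2 n θ) :
    covCoord canonical X = 0 := by
  rw [covCoord, canonical_eq hX, one_mul, neg_add_cancel]

variable (n θ) in
theorem isConnection_canonical : IsConnection (canonical (n := n) (θ := θ)) where
  map_add X hX m m' := by
    rw [canonical_eq hX, canonical_eq hX, canonical_eq hX, add_mul, neg_add]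
  map_smul X hX k m := by
    rw [canonical_eq hX, canonical_eq hX, smul_mul_assoc, smul_neg]
  leibniz X hX m a := by
    rw [canonical_eq hX, canonical_eq hX, ← congrFun (Ad_eta hX) a, Ad, comm]
    noncomm_ring
  add_left X hX Y hY m := by
    rw [canonical_eq hX, canonical_eq hY, canonical_eq (add_mem_G2 hX hY), eta_add hX hY, mul_add,
      neg_add]
  smul_left X hX k m := by
    rw [canonical_eq hX, canonical_eq (smul_mem_G2 k hX), eta_smul k hX, mul_smul_comm, smul_neg]

variable {nabla : (Alg n θ → Alg n θ) → Alg n θ → Alg n θ}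

theorem IsConnection.apply_eq (h : IsConnection nabla) {X : Alg n θ → Alg n θ} (hX : X ∈ G2 n θ)
    (m : Alg n θ) : nabla X m = canonical X m + covCoord nabla X * m := by
  have nabla_one_mul := h.leibniz X hX 1 m
  rw [one_mul, one_mul] at nabla_one_mul
  rw [nabla_one_mul, canonical, covCoord]
  noncomm_ring

theorem IsConnection.covCoord_add (h : IsConnection nabla) {X Y : Alg n θ → Alg n θ}
    (hX : X ∈ G2 n θ) (hY : Y ∈ G2 n θ) :
    covCoord nabla (X + Y) = covCoord nabla X + covCoord nabla Y := by
  rw [covCoord, h.add_left X hX Y hY, eta_add hX hY, covCoord, covCoord]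
  abel

theorem IsConnection.covCoord_smul (h : IsConnection nabla) (k : ℂ) {X : Alg n θ → Alg n θ}
    (hX : X ∈ G2 n θ) : covCoord nabla (k • X) = k • covCoord nabla X := by
  rw [covCoord, h.smul_left X hX, eta_smul k hX, covCoord, smul_add]

theorem IsConnection.covCoord_zero (h : IsConnection nabla) : covCoord nabla 0 = 0 := by
  simpa using h.covCoord_smul 0 (zero_mem_G2 n θ)

theorem IsConnection.curvature_eq (h : IsConnection nabla) {X Y : Alg n θ → Alg n θ}
    (hX : X ∈ G2 n θ) (hY : Y ∈ G2 n θ) (m : Alg n θ) :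
    curvature nabla X Y m = (comm (covCoord nabla X) (covCoord nabla Y) -
      covCoord nabla (bracket X Y)) * m + m * (eta (bracket X Y) - comm (eta X) (eta Y)) := by
  have hXY := bracket_mem_G2 hX hY
  simp only [curvature, h.apply_eq hX, h.apply_eq hY, h.apply_eq hXY, canonical_eq hX,
    canonical_eq hY, canonical_eq hXY, comm]
  noncomm_ring

theorem IsConnection.curvature_D1_D1 (h : IsConnection nabla) (μ ν : Idx n) (m : Alg n θ) :
    curvature nabla (D1 n θ μ) (D1 n θ ν) m =
      (comm (covCoord nabla (D1 n θ μ)) (covCoord nabla (D1 n θ ν)) -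
        (Complex.I * (((Theta n θ)⁻¹ μ ν : ℝ) : ℂ)) • 1) * m := by
  rw [h.curvature_eq (D1_mem_G2 μ) (D1_mem_G2 ν), bracket_D1_D1, h.covCoord_zero, eta_zero, eta_D1,
    eta_D1, comm_eta1_eta1, sub_zero, zero_sub, mul_neg, mul_smul_comm, mul_one, sub_mul,
    smul_mul_assoc, one_mul, sub_eq_add_neg]

theorem IsConnection.curvature_D1_D2 (h : IsConnection nabla) (μ ρ σ : Idx n) (m : Alg n θ) :
    curvature nabla (D1 n θ μ) (D2 n θ ρ σ) m =
      (comm (covCoord nabla (D1 n θ μ)) (covCoord nabla (D2 n θ ρ σ)) -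
        (((Theta n θ)⁻¹ μ ρ : ℝ) : ℂ) • covCoord nabla (D1 n θ σ) -
        (((Theta n θ)⁻¹ μ σ : ℝ) : ℂ) • covCoord nabla (D1 n θ ρ)) * m := by
  rw [h.curvature_eq (D1_mem_G2 μ) (D2_mem_G2 ρ σ), bracket_D1_D2]
  simp only [h.covCoord_add, h.covCoord_smul, eta_add, eta_smul, smul_mem_G2, D1_mem_G2, eta_D1,
    eta_D2, comm_eta1_eta2, sub_self, mul_zero, add_zero, sub_sub]

theorem IsConnection.curvature_D2_D2 (h : IsConnection nabla) (μ ν ρ σ : Idx n) (m : Alg n θ) :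
    curvature nabla (D2 n θ μ ν) (D2 n θ ρ σ) m =
      (comm (covCoord nabla (D2 n θ μ ν)) (covCoord nabla (D2 n θ ρ σ)) +
        (((Theta n θ)⁻¹ ρ ν : ℝ) : ℂ) • covCoord nabla (D2 n θ μ σ) +
        (((Theta n θ)⁻¹ σ ν : ℝ) : ℂ) • covCoord nabla (D2 n θ μ ρ) +
        (((Theta n θ)⁻¹ ρ μ : ℝ) : ℂ) • covCoord nabla (D2 n θ ν σ) +
        (((Theta n θ)⁻¹ σ μ : ℝ) : ℂ) • covCoord nabla (D2 n θ ν ρ)) * m := by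
  rw [h.curvature_eq (D2_mem_G2 μ ν) (D2_mem_G2 ρ σ), bracket_D2_D2]
  simp (maxDischargeDepth := 5) only [h.covCoord_add, h.covCoord_smul, eta_add, eta_smul,
    add_mem_G2, smul_mem_G2, D2_mem_G2, eta_D2]
  simp only [comm_eta2_eta2, neg_one_smul, sub_self, mul_zero, add_zero, sub_neg_eq_add,
    ← add_assoc]

theorem curvature_canonical_D1_D1 (μ ν : Idx n) (m : Alg n θ) :
    curvature canonical (D1 n θ μ) (D1 n θ ν) m =
      (-(Complex.I * (((Theta n θ)⁻¹ μ ν : ℝ) : ℂ))) • m := by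
  rw [(isConnection_canonical n θ).curvature_D1_D1, covCoord_canonical (D1_mem_G2 μ),
    covCoord_canonical (D1_mem_G2 ν), comm, sub_self, zero_sub, ← neg_smul, smul_mul_assoc,
    one_mul]

theorem curvature_canonical_D1_D2 (μ ρ σ : Idx n) (m : Alg n θ) :
    curvature canonical (D1 n θ μ) (D2 n θ ρ σ) m = 0 := by
  simp only [(isConnection_canonical n θ).curvature_D1_D2, covCoord_canonical, D1_mem_G2,
    D2_mem_G2, comm, mul_zero, zero_mul, smul_zero, sub_zero]

theorem curvature_canonical_D2_D2 (μ ν ρ σ : Idx n) (m : Alg n θ) :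
    curvature canonical (D2 n θ μ ν) (D2 n θ ρ σ) m = 0 := by
  simp only [(isConnection_canonical n θ).curvature_D2_D2, covCoord_canonical, D2_mem_G2, comm,
    mul_zero, zero_mul, smul_zero, add_zero, sub_zero]

end Connections

/-! ### The affine symplectic Lie algebra -/

open scoped Matrix

section Hamiltonian

variable {n : ℕ} {θ : ℝ}

variable (θ) in
/-- The quadratic Hamiltonian `i (½ ∑ S_{μν} ξ_μ ξ_ν + ∑ c_μ ξ_μ)`. -/
noncomputable def hamiltonian (S : Matrix (Idx n) (Idx n) ℝ) (c : Idx n → ℝ) : Alg n θ :=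
  ∑ μ, ∑ ν, ((S μ ν / 2 : ℝ) : ℂ) • eta2 n θ μ ν + ∑ μ, (c μ : ℂ) • eta1 n θ μ

theorem hamiltonian_add (S T : Matrix (Idx n) (Idx n) ℝ) (c d : Idx n → ℝ) :
    hamiltonian θ (S + T) (c + d) = hamiltonian θ S c + hamiltonian θ T d := by
  simp only [hamiltonian, Matrix.add_apply, Pi.add_apply, add_div, Complex.ofReal_add, add_smul,
    Finset.sum_add_distrib]
  abel

theorem hamiltonian_smul (r : ℝ) (S : Matrix (Idx n) (Idx n) ℝ) (c : Idx n → ℝ) :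
    hamiltonian θ (r • S) (r • c) = (r : ℂ) • hamiltonian θ S c := by
  simp only [hamiltonian, Matrix.smul_apply, Pi.smul_apply, smul_eq_mul, mul_div_assoc,
    Complex.ofReal_mul, mul_smul, smul_add, Finset.smul_sum]

theorem hamiltonian_zero_single (μ : Idx n) : hamiltonian θ 0 (Pi.single μ 1) = eta1 n θ μ := by
  simp [hamiltonian, Pi.single_apply, ite_smul]

theorem hamiltonian_single_add_single (μ ν : Idx n) :
    hamiltonian θ (Matrix.single μ ν 1 + Matrix.single ν μ 1) 0 = eta2 n θ μ ν := by
  have sum_single (μ ν : Idx n) : ∑ ρ, ∑ σ, ((Matrix.single μ ν (1 : ℝ) ρ σ / 2 : ℝ) : ℂ) •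
      eta2 n θ ρ σ = (1 / 2 : ℂ) • eta2 n θ μ ν := by
    simp [Matrix.single_apply, ite_and, ite_smul, ite_div, apply_ite]
  simp only [hamiltonian, Matrix.add_apply, add_div, Complex.ofReal_add, add_smul,
    Finset.sum_add_distrib, sum_single, eta2_symm ν μ, Pi.zero_apply, Complex.ofReal_zero,
    zero_smul, Finset.sum_const_zero, add_zero]
  rw [← add_smul, add_halves, one_smul]

theorem hamiltonian_mem_span (S : Matrix (Idx n) (Idx n) ℝ) (c : Idx n → ℝ) :
    hamiltonian θ S c ∈ Submodule.span ℝ (Set.range (eta1 n θ) ∪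
      Set.range (fun q : Idx n × Idx n => eta2 n θ q.1 q.2)) :=
  add_mem
    (sum_mem fun μ _ => sum_mem fun ν _ =>
      Submodule.smul_mem _ (_ : ℝ) (Submodule.subset_span (Or.inr ⟨(μ, ν), rfl⟩)))
    (sum_mem fun μ _ => Submodule.smul_mem _ (_ : ℝ) (Submodule.subset_span (Or.inl ⟨μ, rfl⟩)))

variable [hθ : NeZero θ]

theorem comm_sum_left {ι : Type*} (s : Finset ι) (f : ι → Alg n θ) (b : Alg n θ) :
    comm (∑ i ∈ s, f i) b = ∑ i ∈ s, comm (f i) b :=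
  (commₗ n θ).map_sum₂ s f b

theorem comm_sum_right {ι : Type*} (s : Finset ι) (f : ι → Alg n θ) (a : Alg n θ) :
    comm a (∑ i ∈ s, f i) = ∑ i ∈ s, comm a (f i) :=
  map_sum (commₗ n θ a) f s

theorem smul_one_eq_zero {k : ℂ} : k • (1 : Alg n θ) = 0 ↔ k = 0 := by
  rw [← poly_C, ← map_zero (polyₗ n θ), polyₗ_apply, poly_injective.eq_iff,
    MvPolynomial.C_eq_zero]

theorem eta_Ad_of_mem_eta_image {a : Alg n θ} (ha : a ∈ eta '' G2 n θ) : eta (Ad a) = a := by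
  obtain ⟨X, hX, rfl⟩ := ha
  rw [Ad_eta hX]

theorem Ad_mem_G2_of_mem_eta_image {a : Alg n θ} (ha : a ∈ eta '' G2 n θ) : Ad a ∈ G2 n θ := by
  obtain ⟨X, hX, rfl⟩ := ha
  rwa [Ad_eta hX]

theorem eta_eq_of_apply_xi_eq {X Y : Alg n θ → Alg n θ} (hX : X ∈ G2 n θ) (hY : Y ∈ G2 n θ)
    (h : ∀ ρ, X (poly θ (xi n θ ρ)) = Y (poly θ (xi n θ ρ))) : eta X = eta Y := by
  obtain ⟨p, hp, rfl⟩ := mem_G2_iff.1 hX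
  obtain ⟨q, hq, rfl⟩ := mem_G2_iff.1 hY
  rw [eta_Ad_poly hp, eta_Ad_poly hq, sub_C_eq_of_comm_eq h]

theorem hamiltonian_mem_eta_image (S : Matrix (Idx n) (Idx n) ℝ) (c : Idx n → ℝ) :
    hamiltonian θ S c ∈ eta '' G2 n θ := by
  rw [eta_image_G2_eq_span]
  exact Submodule.span_le_restrictScalars ℝ ℂ _ (hamiltonian_mem_span S c)

theorem comm_eta1_xi (μ ρ : Idx n) : comm (eta1 n θ μ) (poly θ (xi n θ ρ)) =
    (((Theta n θ)⁻¹ μ ρ : ℝ) : ℂ) • 1 := by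
  rw [eta1_eq, comm_smul_left, comm_xi_xi, smul_smul]
  congr 1
  linear_combination -(((Theta n θ)⁻¹ μ ρ : ℝ) : ℂ) * Complex.I_sq

theorem comm_sum_eta1_xi (c : Idx n → ℝ) (ρ : Idx n) :
    comm (∑ μ, (c μ : ℂ) • eta1 n θ μ) (poly θ (xi n θ ρ)) =
      -((((Theta n θ)⁻¹ *ᵥ c) ρ : ℝ) : ℂ) • 1 := by
  simp only [comm_sum_left, comm_smul_left, comm_eta1_xi, smul_smul, ← Finset.sum_smul,
    Theta_inv_apply_swap n hθ.out ρ, Matrix.mulVec, dotProduct, Complex.ofReal_sum,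
    Complex.ofReal_mul, Complex.ofReal_neg, mul_neg, Finset.sum_neg_distrib]
  simp only [mul_comm]

theorem comm_sum_eta2_xi {S : Matrix (Idx n) (Idx n) ℝ} (hS : S.IsSymm) (ρ : Idx n) :
    comm (∑ μ, ∑ ν, ((S μ ν / 2 : ℝ) : ℂ) • eta2 n θ μ ν) (poly θ (xi n θ ρ)) =
      ∑ μ, (((S * (Theta n θ)⁻¹) μ ρ : ℝ) : ℂ) • poly θ (xi n θ μ) := by
  have half_sum (μ : Idx n) : ∑ ν, ((S μ ν / 2 : ℝ) : ℂ) * (((Theta n θ)⁻¹ ν ρ : ℝ) : ℂ) =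
      (((S * (Theta n θ)⁻¹) μ ρ / 2 : ℝ) : ℂ) := by
    rw [Matrix.mul_apply, Finset.sum_div]
    push_cast
    simp only [div_mul_eq_mul_div]
  simp only [comm_sum_left, comm_smul_left, comm_eta2_xi, smul_add, smul_smul,
    Finset.sum_add_distrib]
  conv_lhs => enter [2]; rw [Finset.sum_comm]
  simp only [← Finset.sum_smul, half_sum, hS.apply]
  simp only [← Finset.sum_add_distrib, ← add_smul, ← Complex.ofReal_add, add_halves]

theorem comm_hamiltonian_xi {S : Matrix (Idx n) (Idx n) ℝ} (hS : S.IsSymm) (c : Idx n → ℝ)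
    (ρ : Idx n) : comm (hamiltonian θ S c) (poly θ (xi n θ ρ)) =
      ∑ μ, (((S * (Theta n θ)⁻¹) μ ρ : ℝ) : ℂ) • poly θ (xi n θ μ) -
        ((((Theta n θ)⁻¹ *ᵥ c) ρ : ℝ) : ℂ) • 1 := by
  rw [hamiltonian, comm_add_left, comm_sum_eta2_xi hS, comm_sum_eta1_xi, neg_smul, sub_eq_add_neg]

theorem comm_hamiltonian_comm_hamiltonian_xi {S T : Matrix (Idx n) (Idx n) ℝ} (hS : S.IsSymm)
    (hT : T.IsSymm) (c d : Idx n → ℝ) (ρ : Idx n) :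
    comm (hamiltonian θ S c) (comm (hamiltonian θ T d) (poly θ (xi n θ ρ))) =
      ∑ μ, (((S * (Theta n θ)⁻¹ * T * (Theta n θ)⁻¹) μ ρ : ℝ) : ℂ) • poly θ (xi n θ μ) +
        ((((Theta n θ)⁻¹ *ᵥ (T *ᵥ ((Theta n θ)⁻¹ *ᵥ c))) ρ : ℝ) : ℂ) • 1 := by
  set W := (Theta n θ)⁻¹
  have transpose_mul_inv : (T * W)ᵀ = -(W * T) := by
    rw [Matrix.transpose_mul, hT.eq, Theta_inv_transpose n hθ.out, Matrix.neg_mul]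
  have linear_part : ∑ μ, ∑ κ, (((T * W) μ ρ : ℝ) : ℂ) • (((S * W) κ μ : ℝ) : ℂ) •
      poly θ (xi n θ κ) = ∑ κ, (((S * W * T * W) κ ρ : ℝ) : ℂ) • poly θ (xi n θ κ) := by
    rw [Finset.sum_comm, Matrix.mul_assoc (S * W)]
    simp only [smul_smul, ← Finset.sum_smul, ← Complex.ofReal_mul, ← Complex.ofReal_sum,
      Matrix.mul_apply (M := S * W), mul_comm]
  have constant_part : ∑ μ, (T * W) μ ρ * (W *ᵥ c) μ = -(W *ᵥ (T *ᵥ (W *ᵥ c))) ρ := by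
    rw [Matrix.mulVec_mulVec, ← Pi.neg_apply, ← Matrix.neg_mulVec, ← transpose_mul_inv]
    rfl
  rw [comm_hamiltonian_xi hT, comm_sub_right, comm_smul_right, comm_one_right, smul_zero, sub_zero,
    comm_sum_right]
  simp only [comm_smul_right, comm_hamiltonian_xi hS, smul_sub, Finset.sum_sub_distrib,
    Finset.smul_sum]
  rw [linear_part, sub_eq_add_neg]
  congr 1
  simp only [smul_smul, ← Finset.sum_smul, ← Complex.ofReal_mul, ← Complex.ofReal_sum]
  rw [constant_part, Complex.ofReal_neg, neg_smul, neg_neg]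

theorem isSymm_mul_Theta_inv_mul_sub {S T : Matrix (Idx n) (Idx n) ℝ} (hS : S.IsSymm)
    (hT : T.IsSymm) : (S * (Theta n θ)⁻¹ * T - T * (Theta n θ)⁻¹ * S).IsSymm := by
  rw [Matrix.IsSymm, Matrix.transpose_sub]
  simp only [Matrix.transpose_mul, hS.eq, hT.eq, Theta_inv_transpose n hθ.out]
  noncomm_ring

theorem eta_bracket_Ad_hamiltonian {S T : Matrix (Idx n) (Idx n) ℝ} (hS : S.IsSymm)
    (hT : T.IsSymm) (c d : Idx n → ℝ) :
    eta (bracket (Ad (hamiltonian θ S c)) (Ad (hamiltonian θ T d))) =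
      hamiltonian θ (S * (Theta n θ)⁻¹ * T - T * (Theta n θ)⁻¹ * S)
        (S *ᵥ ((Theta n θ)⁻¹ *ᵥ d) - T *ᵥ ((Theta n θ)⁻¹ *ᵥ c)) := by
  have Ad_mem (S : Matrix (Idx n) (Idx n) ℝ) (c : Idx n → ℝ) :
      Ad (hamiltonian θ S c) ∈ G2 n θ :=
    Ad_mem_G2_of_mem_eta_image (hamiltonian_mem_eta_image S c)
  rw [← eta_Ad_of_mem_eta_image (hamiltonian_mem_eta_image (_ - _) (_ - _))]
  refine eta_eq_of_apply_xi_eq (bracket_mem_G2 (Ad_mem S c) (Ad_mem T d)) (Ad_mem _ _) fun ρ => ?_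
  rw [bracket_Ad, Ad, Ad, comm_jacobi, comm_hamiltonian_comm_hamiltonian_xi hS hT,
    comm_hamiltonian_comm_hamiltonian_xi hT hS,
    comm_hamiltonian_xi (isSymm_mul_Theta_inv_mul_sub hS hT)]
  simp only [Matrix.sub_mul, Matrix.sub_apply, Matrix.mulVec_sub, Pi.sub_apply,
    Complex.ofReal_sub, sub_smul, Finset.sum_sub_distrib]
  abel

theorem eq_zero_of_sum_smul_xi_sub_smul_one_eq_zero {a : Idx n → ℝ} {k : ℝ}
    (h : ∑ μ, (a μ : ℂ) • poly θ (xi n θ μ) - (k : ℂ) • 1 = 0) : a = 0 ∧ k = 0 := by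
  have vecMul_eq_zero : a ᵥ* (Theta n θ)⁻¹ = 0 := by
    funext κ
    have comm_eq_zero := congrArg (comm · (poly θ (xi n θ κ))) h
    simp only [comm_sub_left, comm_sum_left, comm_smul_left, comm_one_left, smul_zero, sub_zero,
      comm_xi_xi, smul_smul, ← Finset.sum_smul] at comm_eq_zero
    rw [show comm 0 (poly θ (xi n θ κ)) = 0 by simp [comm], smul_one_eq_zero] at comm_eq_zero
    simpa [Matrix.vecMul, dotProduct, mul_left_comm _ Complex.I, ← Finset.mul_sum,
      ← Complex.ofReal_mul, ← Complex.ofReal_sum] using comm_eq_zero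
  have a_eq_zero : a = 0 := by
    rw [← Matrix.vecMul_one a, ← Matrix.nonsing_inv_mul _ (isUnit_Theta_det n hθ.out),
      ← Matrix.vecMul_vecMul, vecMul_eq_zero, Matrix.zero_vecMul]
  rw [a_eq_zero] at h
  simp only [Pi.zero_apply, Complex.ofReal_zero, zero_smul, Finset.sum_const_zero, zero_sub,
    neg_eq_zero, smul_one_eq_zero, Complex.ofReal_eq_zero] at h
  exact ⟨a_eq_zero, h⟩

theorem eq_zero_of_hamiltonian_eq_zero {S : Matrix (Idx n) (Idx n) ℝ} (hS : S.IsSymm)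
    {c : Idx n → ℝ} (h : hamiltonian θ S c = 0) : S = 0 ∧ c = 0 := by
  have coeff_eq_zero (ρ : Idx n) := eq_zero_of_sum_smul_xi_sub_smul_one_eq_zero (θ := θ)
    ((comm_hamiltonian_xi hS c ρ).symm.trans (by rw [h]; simp [comm]))
  have mul_eq_zero : S * (Theta n θ)⁻¹ = 0 := by
    ext μ ρ
    exact congrFun (coeff_eq_zero ρ).1 μ
  have mulVec_eq_zero : (Theta n θ)⁻¹ *ᵥ c = 0 := funext fun ρ => (coeff_eq_zero ρ).2
  constructor
  · rw [← Matrix.mul_one S, ← Matrix.nonsing_inv_mul _ (isUnit_Theta_det n hθ.out),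
      ← Matrix.mul_assoc, mul_eq_zero, Matrix.zero_mul]
  · rw [← Matrix.one_mulVec c, ← Matrix.mul_nonsing_inv _ (isUnit_Theta_det n hθ.out),
      ← Matrix.mulVec_mulVec, mulVec_eq_zero, Matrix.mulVec_zero]

end Hamiltonian

section AffineSymplectic

variable {n : ℕ} {θ : ℝ}

variable (n) in
/-- The enumeration of the coordinates in which `Θ` is a multiple of the standard
symplectic matrix. -/
def sumEquivIdx : Fin n ⊕ Fin n ≃ Idx n where
  toFun := Sum.elim (fun k => (0, k)) fun k => (1, k)
  invFun μ := if μ.1 = 0 then Sum.inl μ.2 else Sum.inr μ.2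
  left_inv := by rintro (k | k) <;> simp
  right_inv := by
    rintro ⟨j, k⟩
    fin_cases j <;> simp

theorem Theta_submatrix : (Theta n θ).submatrix (sumEquivIdx n) (sumEquivIdx n) =
    θ • Matrix.J (Fin n) ℝ := by
  ext (i | i) (j | j) <;>
    simp [Theta, sumEquivIdx, Matrix.J, Matrix.blockDiagonal_apply, Matrix.one_apply]
  split_ifs <;> simp

theorem mem_sp_iff {A : Matrix (Fin n ⊕ Fin n) (Fin n ⊕ Fin n) ℝ} :
    A ∈ LieAlgebra.Symplectic.sp (Fin n) ℝ ↔
      Aᵀ * Matrix.J (Fin n) ℝ = Matrix.J (Fin n) ℝ * -A := by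
  rw [LieAlgebra.Symplectic.sp, mem_skewAdjointMatricesLieSubalgebra,
    mem_skewAdjointMatricesSubmodule]
  rfl

theorem mem_sp_iff_isSymm_mul_J {A : Matrix (Fin n ⊕ Fin n) (Fin n ⊕ Fin n) ℝ} :
    A ∈ LieAlgebra.Symplectic.sp (Fin n) ℝ ↔ (A * Matrix.J (Fin n) ℝ).IsSymm := by
  rw [mem_sp_iff, Matrix.IsSymm, Matrix.transpose_mul, Matrix.J_transpose]
  have J_mul_J_mul (M : Matrix (Fin n ⊕ Fin n) (Fin n ⊕ Fin n) ℝ) :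
      Matrix.J (Fin n) ℝ * (Matrix.J (Fin n) ℝ * M) = -M := by
    rw [← Matrix.mul_assoc, Matrix.J_squared, Matrix.neg_mul, Matrix.one_mul]
  constructor <;> intro h <;>
    simpa [Matrix.mul_assoc, Matrix.J_squared, J_mul_J_mul] using
      congrArg (Matrix.J (Fin n) ℝ * · * Matrix.J (Fin n) ℝ) h

theorem submatrix_mem_sp_iff [hθ : NeZero θ] {A : Matrix (Idx n) (Idx n) ℝ} :
    A.submatrix (sumEquivIdx n) (sumEquivIdx n) ∈ LieAlgebra.Symplectic.sp (Fin n) ℝ ↔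
      (A * Theta n θ).IsSymm := by
  have submatrix_mul : (A * Theta n θ).submatrix (sumEquivIdx n) (sumEquivIdx n) =
      θ • (A.submatrix (sumEquivIdx n) (sumEquivIdx n) * Matrix.J (Fin n) ℝ) := by
    rw [← Matrix.submatrix_mul_equiv _ _ _ (sumEquivIdx n), Theta_submatrix, Matrix.mul_smul]
  rw [mem_sp_iff_isSymm_mul_J, Matrix.IsSymm, Matrix.IsSymm,
    ← (Matrix.reindex (sumEquivIdx n).symm (sumEquivIdx n).symm).injective.eq_iff]
  change _ ↔ ((A * Theta n θ).submatrix (sumEquivIdx n) (sumEquivIdx n))ᵀ =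
    (A * Theta n θ).submatrix (sumEquivIdx n) (sumEquivIdx n)
  rw [submatrix_mul, Matrix.transpose_smul, (smul_right_injective _ hθ.out).eq_iff]

/-- The linear part `A` of an affine symplectic transformation `(A, v; 0, 0)`, in the
coordinates of the Moyal space. -/
def linearPart (u : isp n) : Matrix (Idx n) (Idx n) ℝ :=
  u.1.toBlocks₁₁.submatrix (sumEquivIdx n).symm (sumEquivIdx n).symm

/-- The translation `v` of an affine symplectic transformation `(A, v; 0, 0)`, in the
coordinates of the Moyal space. -/
def translationPart (u : isp n) : Idx n → ℝ :=
  fun μ => u.1.toBlocks₁₂ ((sumEquivIdx n).symm μ) ()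

theorem isSymm_linearPart_mul_Theta [NeZero θ] (u : isp n) :
    (linearPart u * Theta n θ).IsSymm := by
  obtain ⟨_, A, hA, v, rfl⟩ := u
  rw [← submatrix_mem_sp_iff]
  simpa [linearPart] using hA

theorem exists_isp_of_isSymm [NeZero θ] {A : Matrix (Idx n) (Idx n) ℝ}
    (hA : (A * Theta n θ).IsSymm) (v : Idx n → ℝ) :
    ∃ u : isp n, linearPart u = A ∧ translationPart u = v := by
  refine ⟨⟨_, _, submatrix_mem_sp_iff.2 hA, Matrix.of fun i _ => v (sumEquivIdx n i), rfl⟩, ?_, ?_⟩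
  · simp [linearPart]
  · funext μ
    simp [translationPart]

theorem eq_zero_of_linearPart_eq_zero_of_translationPart_eq_zero {u : isp n}
    (linearPart_eq : linearPart u = 0) (translationPart_eq : translationPart u = 0) : u = 0 := by
  obtain ⟨_, A, hA, v, rfl⟩ := u
  have A_eq_zero : A = 0 := by
    ext i j
    simpa [linearPart] using congrFun (congrFun linearPart_eq (sumEquivIdx n i)) (sumEquivIdx n j)
  have v_eq_zero : v = 0 := by
    ext i
    simpa [translationPart] using congrFun translationPart_eq (sumEquivIdx n i)
  subst A_eq_zero v_eq_zero
  exact Subtype.ext Matrix.fromBlocks_zero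

theorem coe_isp_lie {A B : Matrix (Fin n ⊕ Fin n) (Fin n ⊕ Fin n) ℝ}
    {v w : Matrix (Fin n ⊕ Fin n) Unit ℝ} {u u' : isp n}
    (hu : u.1 = Matrix.fromBlocks A v 0 0)
    (hu' : u'.1 = Matrix.fromBlocks B w 0 0) :
    (⁅u, u'⁆ : isp n).1 = Matrix.fromBlocks (A * B - B * A) (A * w - B * v) 0 0 := by
  change u.1 * u'.1 - u'.1 * u.1 = _
  simp [hu, hu', Matrix.fromBlocks_multiply, sub_eq_add_neg, Matrix.fromBlocks_neg,
    Matrix.fromBlocks_add]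

theorem linearPart_lie (u u' : isp n) :
    linearPart ⁅u, u'⁆ = linearPart u * linearPart u' - linearPart u' * linearPart u := by
  obtain ⟨A, -, v, hu⟩ := u.2
  obtain ⟨B, -, w, hu'⟩ := u'.2
  simp only [linearPart, coe_isp_lie hu hu', hu, hu', Matrix.toBlocks_fromBlocks₁₁,
    Matrix.submatrix_sub, Matrix.submatrix_mul_equiv, Pi.sub_apply]

theorem submatrix_mulVec_comp_symm (A : Matrix (Fin n ⊕ Fin n) (Fin n ⊕ Fin n) ℝ)
    (v : Matrix (Fin n ⊕ Fin n) Unit ℝ) (μ : Idx n) :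
    (A.submatrix (sumEquivIdx n).symm (sumEquivIdx n).symm *ᵥ
      fun ν => v ((sumEquivIdx n).symm ν) ()) μ = (A * v) ((sumEquivIdx n).symm μ) () :=
  (sumEquivIdx n).symm.sum_comp fun i => A ((sumEquivIdx n).symm μ) i * v i ()

theorem translationPart_lie (u u' : isp n) : translationPart ⁅u, u'⁆ =
    linearPart u *ᵥ translationPart u' - linearPart u' *ᵥ translationPart u := by
  obtain ⟨_, A, hA, v, rfl⟩ := u
  obtain ⟨_, B, hB, w, rfl⟩ := u'
  funext μ
  rw [translationPart, coe_isp_lie rfl rfl, Matrix.toBlocks_fromBlocks₁₂, Matrix.sub_apply,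
    ← submatrix_mulVec_comp_symm, ← submatrix_mulVec_comp_symm]
  rfl

variable (n θ) in
/-- The representation of `isp(2n, ℝ)` by quadratic Hamiltonians; the sign of the linear term
turns the commutator of Hamiltonians into the bracket of affine transformations. -/
noncomputable def ispRep : isp n →ₗ[ℝ] Alg n θ where
  toFun u := hamiltonian θ (linearPart u * Theta n θ) (-translationPart u)
  map_add' u v := by
    rw [← hamiltonian_add, ← Matrix.add_mul, ← neg_add]
    rfl
  map_smul' r u := by
    refine Eq.trans ?_ (hamiltonian_smul r _ _)
    rw [← Matrix.smul_mul, smul_neg]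
    rfl

variable [hθ : NeZero θ]

theorem Ad_ispRep_mem_G2 (u : isp n) : Ad (ispRep n θ u) ∈ G2 n θ :=
  Ad_mem_G2_of_mem_eta_image (hamiltonian_mem_eta_image _ _)

theorem eta_Ad_ispRep (u : isp n) : eta (Ad (ispRep n θ u)) = ispRep n θ u :=
  eta_Ad_of_mem_eta_image (hamiltonian_mem_eta_image _ _)

theorem mul_Theta_mul_Theta_inv (A : Matrix (Idx n) (Idx n) ℝ) :
    A * Theta n θ * (Theta n θ)⁻¹ = A :=
  Matrix.mul_nonsing_inv_cancel_right _ A (isUnit_Theta_det n hθ.out)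

theorem ispRep_lie (u v : isp n) : ispRep n θ ⁅u, v⁆ =
    eta (bracket (Ad (ispRep n θ u)) (Ad (ispRep n θ v))) := by
  change hamiltonian θ _ _ = eta (bracket (Ad (hamiltonian θ _ _)) (Ad (hamiltonian θ _ _)))
  rw [eta_bracket_Ad_hamiltonian (isSymm_linearPart_mul_Theta u) (isSymm_linearPart_mul_Theta v),
    linearPart_lie, translationPart_lie]
  congr 1
  · rw [mul_Theta_mul_Theta_inv, mul_Theta_mul_Theta_inv, Matrix.sub_mul, Matrix.mul_assoc,
      Matrix.mul_assoc]
  · simp only [Matrix.mulVec_mulVec, mul_Theta_mul_Theta_inv, Matrix.mulVec_neg, neg_sub,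
      sub_neg_eq_add, neg_add_eq_sub]

theorem ispRep_injective : Function.Injective (ispRep n θ) := by
  rw [← LinearMap.ker_eq_bot, LinearMap.ker_eq_bot']
  intro u hu
  obtain ⟨mul_Theta_eq, neg_translation_eq⟩ :=
    eq_zero_of_hamiltonian_eq_zero (isSymm_linearPart_mul_Theta u) hu
  refine eq_zero_of_linearPart_eq_zero_of_translationPart_eq_zero ?_
    (neg_eq_zero.1 neg_translation_eq)
  rw [← mul_Theta_mul_Theta_inv (θ := θ) (linearPart u), mul_Theta_eq, Matrix.zero_mul]

theorem hamiltonian_mem_range_ispRep {S : Matrix (Idx n) (Idx n) ℝ} (hS : S.IsSymm)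
    (c : Idx n → ℝ) : hamiltonian θ S c ∈ LinearMap.range (ispRep n θ) := by
  have mul_inv_mul : S * (Theta n θ)⁻¹ * Theta n θ = S :=
    Matrix.nonsing_inv_mul_cancel_right _ S (isUnit_Theta_det n hθ.out)
  obtain ⟨u, linearPart_eq, translationPart_eq⟩ :=
    exists_isp_of_isSymm (θ := θ) (A := S * (Theta n θ)⁻¹) (by rwa [mul_inv_mul]) (-c)
  refine ⟨u, ?_⟩
  change hamiltonian θ _ _ = _
  rw [linearPart_eq, translationPart_eq, mul_inv_mul, neg_neg]

theorem range_ispRep : LinearMap.range (ispRep n θ) =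
    Submodule.span ℝ (Set.range (eta1 n θ) ∪
      Set.range (fun q : Idx n × Idx n => eta2 n θ q.1 q.2)) := by
  refine le_antisymm ?_ (Submodule.span_le.2 ?_)
  · rintro _ ⟨u, rfl⟩
    exact hamiltonian_mem_span _ _
  · rintro _ (⟨μ, rfl⟩ | ⟨⟨μ, ν⟩, rfl⟩)
    · rw [← hamiltonian_zero_single]
      exact hamiltonian_mem_range_ispRep Matrix.isSymm_zero _
    · change eta2 n θ μ ν ∈ _
      rw [← hamiltonian_single_add_single]
      refine hamiltonian_mem_range_ispRep ?_ _
      rw [Matrix.IsSymm, Matrix.transpose_add, Matrix.transpose_single, Matrix.transpose_single,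
        add_comm]

end AffineSymplectic

end Moyal

theorem mainTheorem8 (n : ℕ) (θ : ℝ) (hθ : θ ≠ 0) :
    -- `(𝓢, ⋆)` and the unital associative algebra `(𝓜, ⋆)` are well defined, and `𝓜` contains
    -- the polynomial functions of degree at most two
    ((∀ (a b : 𝓢(Moyal.Space n, ℂ)) (x : Moyal.Space n),
        Moyal.star n θ a b x = Moyal.starIntegral n θ a b x) ∧
      (∀ T S : Moyal.Alg n θ, Moyal.IsProduct T S (T * S)) ∧
      (∀ T S U : Moyal.Alg n θ, (T * S) * U = T * (S * U)) ∧
      (∀ T : Moyal.Alg n θ, 1 * T = T ∧ T * 1 = T) ∧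
      (∀ p : MvPolynomial (Moyal.Idx n) ℂ, p.totalDegree ≤ 2 →
        ((Moyal.poly θ p : Moyal.Alg n θ) : 𝓢'(Moyal.Space n, ℂ)) = Moyal.polyDist p)) ∧
    -- `𝓖₂` is the complex vector space spanned by the `∂_μ` and `X_{(μν)}`, and it is closed
    -- under the bracket; `η(Ad_P) = P - P(0)` is well defined, and `X = Ad_{η(X)}` on `𝓖₂`
    (Moyal.G2 n θ = (Submodule.span ℂ (Set.range (Moyal.D1 n θ) ∪
          Set.range (fun q : Moyal.Idx n × Moyal.Idx n => Moyal.D2 n θ q.1 q.2)) :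
          Set (Moyal.Alg n θ → Moyal.Alg n θ)) ∧
      (∀ X ∈ Moyal.G2 n θ, ∀ Y ∈ Moyal.G2 n θ, Moyal.bracket X Y ∈ Moyal.G2 n θ) ∧
      (∀ p : MvPolynomial (Moyal.Idx n) ℂ, p.totalDegree ≤ 2 →
        Moyal.eta (Moyal.Ad (Moyal.poly θ p)) =
          Moyal.poly θ (p - MvPolynomial.C (MvPolynomial.eval 0 p))) ∧
      (∀ X ∈ Moyal.G2 n θ, X = Moyal.Ad (Moyal.eta X))) ∧
    -- the image of `𝓖₂` under `η` is the complex span of the `η_μ`, `η_{(μν)}`; their real span,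
    -- with the bracket of `𝓖₂` transported by `η`, is the Lie algebra `isp(2n, ℝ)`
    (Moyal.eta '' Moyal.G2 n θ = (Submodule.span ℂ (Set.range (Moyal.eta1 n θ) ∪
          Set.range (fun q : Moyal.Idx n × Moyal.Idx n => Moyal.eta2 n θ q.1 q.2)) :
          Set (Moyal.Alg n θ)) ∧
      ∃ φ : Moyal.isp n →ₗ[ℝ] Moyal.Alg n θ,
        Function.Injective φ ∧
        LinearMap.range φ = Submodule.span ℝ (Set.range (Moyal.eta1 n θ) ∪
          Set.range (fun q : Moyal.Idx n × Moyal.Idx n => Moyal.eta2 n θ q.1 q.2)) ∧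
        (∀ u, Moyal.Ad (φ u) ∈ Moyal.G2 n θ ∧ Moyal.eta (Moyal.Ad (φ u)) = φ u) ∧
        (∀ u v, φ ⁅u, v⁆ =
          Moyal.eta (Moyal.bracket (Moyal.Ad (φ u)) (Moyal.Ad (φ v))))) ∧
    -- the curvature of an arbitrary connection
    (∀ nabla : (Moyal.Alg n θ → Moyal.Alg n θ) → Moyal.Alg n θ → Moyal.Alg n θ,
      Moyal.IsConnection nabla →
      ∀ (A₁ : Moyal.Idx n → Moyal.Alg n θ) (A₂ : Moyal.Idx n → Moyal.Idx n → Moyal.Alg n θ),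
      (∀ μ, A₁ μ = Moyal.covCoord nabla (Moyal.D1 n θ μ)) →
      (∀ μ ν, A₂ μ ν = Moyal.covCoord nabla (Moyal.D2 n θ μ ν)) →
      (∀ X ∈ Moyal.G2 n θ, ∀ a,
        nabla X a = Moyal.canonical X a + Moyal.covCoord nabla X * a) ∧
      (∀ μ ν m, Moyal.curvature nabla (Moyal.D1 n θ μ) (Moyal.D1 n θ ν) m =
        (Moyal.comm (A₁ μ) (A₁ ν)
          - (Complex.I * (((Moyal.Theta n θ)⁻¹ μ ν : ℝ) : ℂ)) • 1) * m) ∧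
      (∀ μ ρ σ m, Moyal.curvature nabla (Moyal.D1 n θ μ) (Moyal.D2 n θ ρ σ) m =
        (Moyal.comm (A₁ μ) (A₂ ρ σ)
          - (((Moyal.Theta n θ)⁻¹ μ ρ : ℝ) : ℂ) • A₁ σ
          - (((Moyal.Theta n θ)⁻¹ μ σ : ℝ) : ℂ) • A₁ ρ) * m) ∧
      (∀ μ ν ρ σ m, Moyal.curvature nabla (Moyal.D2 n θ μ ν) (Moyal.D2 n θ ρ σ) m =
        (Moyal.comm (A₂ μ ν) (A₂ ρ σ)
          + (((Moyal.Theta n θ)⁻¹ ρ ν : ℝ) : ℂ) • A₂ μ σ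
          + (((Moyal.Theta n θ)⁻¹ σ ν : ℝ) : ℂ) • A₂ μ ρ
          + (((Moyal.Theta n θ)⁻¹ ρ μ : ℝ) : ℂ) • A₂ ν σ
          + (((Moyal.Theta n θ)⁻¹ σ μ : ℝ) : ℂ) • A₂ ν ρ) * m)) ∧
    -- the curvature of the canonical connection
    (Moyal.IsConnection (Moyal.canonical (n := n) (θ := θ)) ∧
      (∀ μ ν m, Moyal.curvature Moyal.canonical (Moyal.D1 n θ μ) (Moyal.D1 n θ ν) m =
        (-(Complex.I * (((Moyal.Theta n θ)⁻¹ μ ν : ℝ) : ℂ))) • m) ∧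
      (∀ μ ρ σ m,
        Moyal.curvature Moyal.canonical (Moyal.D1 n θ μ) (Moyal.D2 n θ ρ σ) m = 0) ∧
      (∀ μ ν ρ σ m,
        Moyal.curvature Moyal.canonical (Moyal.D2 n θ μ ν) (Moyal.D2 n θ ρ σ) m = 0)) := by
  have : NeZero θ := ⟨hθ⟩
  refine ⟨⟨Moyal.star_apply n hθ, Moyal.isProduct_mul, mul_assoc,
      fun T => ⟨one_mul T, mul_one T⟩, fun p _ => Moyal.coe_poly p⟩,
    ⟨Moyal.G2_eq_span n θ, fun X hX Y hY => Moyal.bracket_mem_G2 hX hY,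
      fun p hp => Moyal.eta_Ad_poly hp, fun X hX => (Moyal.Ad_eta hX).symm⟩,
    ⟨Moyal.eta_image_G2_eq_span n θ, Moyal.ispRep n θ, Moyal.ispRep_injective, Moyal.range_ispRep,
      fun u => ⟨Moyal.Ad_ispRep_mem_G2 u, Moyal.eta_Ad_ispRep u⟩, Moyal.ispRep_lie⟩,
    fun nabla h A₁ A₂ h₁ h₂ => ⟨fun X hX a => h.apply_eq hX a, fun μ ν m => ?_,
      fun μ ρ σ m => ?_, fun μ ν ρ σ m => ?_⟩,
    ⟨Moyal.isConnection_canonical n θ, Moyal.curvature_canonical_D1_D1,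
      Moyal.curvature_canonical_D1_D2, Moyal.curvature_canonical_D2_D2⟩⟩
  · rw [h₁, h₁, h.curvature_D1_D1]
  · rw [h₁, h₁, h₁, h₂, h.curvature_D1_D2]
  · simp only [h₂, h.curvature_D2_D2]
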